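/- Let $M_n$ denote the $n\times n$ complex matrices. For a hereditary sub-C*-algebra $A\subseteq C[0,1]\otimes M_n$ and $t\in[0,1]$ let $p_A(t)$ be the support projection of $A$ at $t$, i.e. the orthogonal projection of $\mathbb C^n$ onto the span of the ranges of the matrices $a(t)$, $a\in A$; its rank is the dimension function of $A$. Call a function on $[0,1]$ a finite step function if $[0,1]$ is a disjoint union of finitely many intervals (possibly reduced to points) on each of which the function is constant. Call $A$ step hereditary if its dimension function $t\mapsto\operatorname{rank}p_A(t)$ is a finite step function, and strictly step hereditary if $t\mapsto p_A(t)$ itself is a finite step function. (a) For every $n$, every hereditary sub-C*-algebra $A$ of $C[0,1]\otimes M_n$ is the closure of the union of an increasing sequence of step hereditary sub-C*-algebras of $C[0,1]\otimes M_n$. Moreover, $A$ is *-isomorphic to a hereditary sub-C*-algebra of $C[0,1]\otimes M_n$ that is the closure of the union of an increasing sequence of strictly step hereditary sub-C*-algebras of $C[0,1]\otimes M_n$. (b) A C*-algebra has continuous trace if its spectrum (the space of unitary equivalence classes of irreducible representations, with the hull-kernel topology) is Hausdorff and every point of the spectrum has a neighbourhood $V$ and an element $a$ of the algebra such that $\pi(a)$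 is a projection of rank one for all $[\pi]\in V$. Every separable continuous-trace C*-algebra whose spectrum is homeomorphic to $[0,1]$ is the closure of the union of an increasing sequence of sub-C*-algebras, each of which is a continuous-trace C*-algebra with spectrum homeomorphic to $[0,1]$, with all irreducible representations finite-dimensional, and whose dimension function $[\pi]\mapsto\dim H_\pi$ is a finite step function on $[0,1]$. -/

import Mathlib

open scoped unitInterval

universe u

/-! ## Finite step functions -/

/-- `f` is a finite step function: `[0,1]` has a partition into finitely many intervals (open,
half-open, closed, or reduced to a point) on each of which `f` is constant. -/
def IsFiniteStep {α : Type*} (f : I → α) : Prop :=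
  ∃ (m : ℕ) (J : Fin m → Set I),
    (∀ i, (J i).OrdConnected) ∧ Pairwise (fun i j => Disjoint (J i) (J j)) ∧
    (⋃ i, J i) = Set.univ ∧ ∀ i, ∀ s ∈ J i, ∀ t ∈ J i, f s = f t

/-! ## Hereditary subalgebras of interval algebras -/

/-- The interval algebra `C[0,1] ⊗ M_n`, as the *-algebra of continuous functions from `[0,1]` to
the `n × n` matrices. Its topology is that of uniform convergence, which is the topology of the
C*-norm. -/
abbrev IntervalAlgebra (n : ℕ) : Type := C(I, Matrix (Fin n) (Fin n) ℂ)

/-- A hereditary sub-C*-algebra: a norm-closed *-subalgebra `B` with `b a b' ∈ B` for all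
`b, b' ∈ B` and all `a` in the ambient algebra. -/
structure IsHereditary {M : Type*} [NonUnitalRing M] [StarRing M] [Module ℂ M]
    [TopologicalSpace M] (B : NonUnitalStarSubalgebra ℂ M) : Prop where
  isClosed : IsClosed (B : Set M)
  mul_mul_mem : ∀ b ∈ B, ∀ b' ∈ B, ∀ a : M, b * a * b' ∈ B

/-- The fibre of `B` at `t` acts nondegenerately on this subspace of `ℂⁿ`, the span of the ranges
of the matrices `b t`, `b ∈ B`. -/
def supportSpace {n : ℕ} (B : NonUnitalStarSubalgebra ℂ (IntervalAlgebra n)) (t : I) :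
    Submodule ℂ (EuclideanSpace ℂ (Fin n)) :=
  Submodule.span ℂ {w | ∃ b ∈ B, ∃ v : EuclideanSpace ℂ (Fin n),
    w = Matrix.toEuclideanLin (b t) v}

/-- The support projection of `B` (the unit of the bidual of `B`) at the point `t`: the orthogonal
projection of `ℂⁿ` onto the support space. -/
noncomputable def supportProjection {n : ℕ} (B : NonUnitalStarSubalgebra ℂ (IntervalAlgebra n))
    (t : I) : EuclideanSpace ℂ (Fin n) →L[ℂ] EuclideanSpace ℂ (Fin n) :=
  (supportSpace B t).starProjection

/-- The dimension function of `B` on `[0,1]`: the rank of the support projection. For hereditary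
`B` it is the dimension of the irreducible representation of `B` given by evaluation at `t`, and
`0` if all elements of `B` vanish at `t`. -/
noncomputable def supportRank {n : ℕ} (B : NonUnitalStarSubalgebra ℂ (IntervalAlgebra n))
    (t : I) : ℕ :=
  Module.finrank ℂ (supportProjection B t).range

/-- A step hereditary sub-C*-algebra: hereditary, and its dimension function is a finite step
function. -/
def IsStepHereditary {n : ℕ} (B : NonUnitalStarSubalgebra ℂ (IntervalAlgebra n)) : Prop :=
  IsHereditary B ∧ IsFiniteStep (supportRank B)

/-- A step hereditary sub-C*-algebra in the strict sense: hereditary, and the support projection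
is the same projection at all points of each subinterval of some finite partition. -/
def IsStrictlyStepHereditary {n : ℕ} (B : NonUnitalStarSubalgebra ℂ (IntervalAlgebra n)) : Prop :=
  IsHereditary B ∧ IsFiniteStep (supportProjection B)

/-! ## The spectrum of a C*-algebra -/

/-- A (nonzero) irreducible *-representation of `A` on a Hilbert space. Irreducible
representations are cyclic, so all of them occur, up to unitary equivalence, on Hilbert spaces
in the universe of `A`. -/
structure IrrepOf (A : Type u) [NonUnitalRing A] [StarRing A] [Module ℂ A] where
  /-- the Hilbert space -/
  H : Type u
  [normed : NormedAddCommGroup H]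
  [inner : InnerProductSpace ℂ H]
  [complete : CompleteSpace H]
  /-- the representation -/
  rep : A →⋆ₙₐ[ℂ] (H →L[ℂ] H)
  ne_zero : rep ≠ 0
  irreducible : ∀ K : Submodule ℂ H, IsClosed (K : Set H) →
    (∀ a : A, ∀ x ∈ K, rep a x ∈ K) → K = ⊥ ∨ K = ⊤

attribute [instance] IrrepOf.normed IrrepOf.inner IrrepOf.complete

section Spectrum

variable (A : Type u) [NonUnitalRing A] [StarRing A] [Module ℂ A]

/-- Unitary equivalence of irreducible representations. -/
instance irrepSetoid : Setoid (IrrepOf A) where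
  r ρ ρ' := ∃ U : ρ.H ≃ₗᵢ[ℂ] ρ'.H, ∀ (a : A) (x : ρ.H), U (ρ.rep a x) = ρ'.rep a (U x)
  iseqv :=
    { refl := fun ρ => ⟨LinearIsometryEquiv.refl ℂ ρ.H, fun _ _ => rfl⟩
      symm := by
        rintro ρ ρ' ⟨U, hU⟩
        refine ⟨U.symm, fun a x => U.injective ?_⟩
        rw [hU, U.apply_symm_apply, U.apply_symm_apply]
      trans := by
        rintro ρ ρ' ρ'' ⟨U, hU⟩ ⟨V, hV⟩
        refine ⟨U.trans V, fun a x => ?_⟩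
        simp [hU, hV] }

/-- The spectrum of `A`: unitary equivalence classes of irreducible representations. -/
def CStarSpectrum : Type (u + 1) := Quotient (irrepSetoid A)

variable {A}

/-- The point of the spectrum given by an irreducible representation. -/
def IrrepOf.toSpectrum (ρ : IrrepOf A) : CStarSpectrum A := Quotient.mk (irrepSetoid A) ρ

/-- The hull-kernel (Jacobson) topology. Its open sets are the sets of classes of representations
that do not vanish on a given closed two-sided ideal; the sets of classes of representations that
do not vanish at a given element (equivalently, on the ideal it generates) form a basis of it. -/
instance : TopologicalSpace (CStarSpectrum A) :=
  TopologicalSpace.generateFrom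
    {O | ∃ a : A, O = {x | ∃ ρ : IrrepOf A, ρ.toSpectrum = x ∧ ρ.rep a ≠ 0}}

/-- The dimension function on the spectrum, with value `⊤` at infinite-dimensional
representations. -/
noncomputable def dimFunction : CStarSpectrum A → ℕ∞ :=
  Quotient.lift (fun ρ : IrrepOf A => Cardinal.toENat (Module.rank ℂ ρ.H)) (by
    rintro ρ ρ' ⟨U, _⟩
    exact congrArg Cardinal.toENat U.toLinearEquiv.rank_eq)

end Spectrum

/-! ## Continuous-trace C*-algebras -/

/-- `A` has continuous trace: its spectrum is Hausdorff and each point of the spectrum has a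
neighbourhood `V` with an `a ∈ A` such that `a(s)` is a projection of rank one for all `s ∈ V`. -/
structure IsContinuousTrace (A : Type u) [NonUnitalRing A] [StarRing A] [Module ℂ A] : Prop where
  hausdorff : T2Space (CStarSpectrum A)
  fell : ∀ x : CStarSpectrum A, ∃ V ∈ nhds x, ∃ a : A, ∀ ρ : IrrepOf A, ρ.toSpectrum ∈ V →
    IsStarProjection (ρ.rep a) ∧ Module.finrank ℂ (ρ.rep a).range = 1

/-- `A` is a special continuous-trace C*-algebra: it has continuous trace, its spectrum is
(homeomorphic to) `[0,1]`, its irreducible representations are finite-dimensional, and its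
dimension function is a finite step function. -/
def IsSpecialContinuousTrace (A : Type u) [NonUnitalRing A] [StarRing A] [Module ℂ A] : Prop :=
  IsContinuousTrace A ∧ (∀ x : CStarSpectrum A, dimFunction x ≠ ⊤) ∧
    ∃ h : CStarSpectrum A ≃ₜ I, IsFiniteStep (fun t => dimFunction (h.symm t))

open scoped InnerProductSpace ComplexOrder Topology Matrix

/-! Both halves concern Hilbert modules over C[0,1]. A hereditary subalgebra `A` of the interval
algebra is recovered from the closed span `E` of `A · C([0,1], ℂⁿ)`: rank-one fields |ξ⟩⟨η| with ξ,
η in `E` lie in `A` because `A` is hereditary (`rankOne_mem`). A continuous-trace algebra over [0,1]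
contains a projection `p` of rank one at every point, obtained by gluing local ones along the
interval (`IsRankOneOn.glue`, `IsSpectralField.exists_rank_one_projection`), and is generated by the
products ξη* with ξ, η in `E = Ap` (`IsLineField.eq_top_of_mul_star_mem`). The interval has real
dimension one, while the vanishing of a complex function is a condition of codimension two. Hence,
by Baire, a generic section of `E` vanishes only where every section does
(`HilbertField.dense_generic`). Gram–Schmidt with generic sections gives pairwise orthogonal ξ₀, ξ₁,
… that decompose `E` as a sum of modules C₀(Uᵢ), where Uᵢ is the set on which ξᵢ is nonzero
(`HilbertField.exists_frame`). The normalized sections are discontinuous at the boundary of Uᵢ, but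
their coefficients against continuous sections are continuous, and that is enough. In this frame `A`
becomes an algebra of matrix functions whose (i, j) entry vanishes off Uᵢ ∩ Uⱼ; in ℂⁿ the first `n`
sections suffice (`exists_isMatrixFrame`). Now replace each Uᵢ by finite unions Vᵢ of intervals that
exhaust it. The resulting subalgebras have dimension function t ↦ #{i | t ∈ Vᵢ}, a finite step
function, and their union is dense because every entry can be approximated by one with compact
support. In the isomorphic algebra of block matrices the support projections are diagonal and are
therefore step functions themselves. In the continuous-trace case the frame is also truncated to
finitely many indices, with V₀ = [0,1] at every stage; the corner at index 0 is then a full copy of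
C[0,1], which identifies the spectrum with [0,1] (`IsBlockModel.homeomorph`). The passage from the
abstract spectrum to fibrewise statements rests on the fact that irreducible representations
separate closed ideals (`exists_irrepOf_ne_zero`). Norm estimates, lower semicontinuity and the
action of C[0,1] on `A` (`IsSpectralField.exists_smul`) follow from it. -/

/-! ### Irreducible representations from extreme states -/

theorem WeakDual.exists_extremePoint {B : Type*} [NormedAddCommGroup B] [NormedSpace ℂ B]
    {K : Set (WeakDual ℂ B)} (hK : IsCompact K) (hne : K.Nonempty) :
    (Set.extremePoints ℝ K).Nonempty := by
  have : LocallyConvexSpace ℝ (WeakDual ℂ B) :=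
    inferInstanceAs (LocallyConvexSpace ℝ (WeakBilin (topDualPairing ℂ B)))
  exact hK.extremePoints_nonempty hne

/-- A norm-one functional with value one at the unit is real on self-adjoint elements. -/
theorem im_apply_eq_zero_of_isSelfAdjoint {B : Type*} [CStarAlgebra B] {φ : StrongDual ℂ B}
    (hφ : ‖φ‖ ≤ 1) (h1 : φ 1 = 1) {a : B} (ha : IsSelfAdjoint a) : (φ a).im = 0 := by
  -- Evaluating at `a + it` bounds (Im φ(a) + t)² by ‖a‖² + t². The t² terms cancel, and a linear
  -- function of t bounded above must have slope zero.
  have key : ∀ t : ℝ, 2 * t * (φ a).im ≤ ‖a‖ ^ 2 := by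
    intro t
    have h2 : ‖a + (t * Complex.I : ℂ) • (1 : B)‖ ^ 2 ≤ ‖a‖ ^ 2 + t ^ 2 * ‖(1 : B)‖ := by
      rw [sq, ← CStarRing.norm_star_mul_self]
      have : star (a + (t * Complex.I : ℂ) • (1 : B)) * (a + (t * Complex.I : ℂ) • (1 : B))
          = a * a + (t ^ 2 : ℂ) • (1 : B) := by
        simp only [star_add, ha.star_eq, star_smul, star_one, RCLike.star_def, map_mul,
          Complex.conj_ofReal, Complex.conj_I, add_mul, mul_add, smul_mul_assoc, mul_smul_comm,
          one_mul, mul_one, smul_add, smul_smul]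
        have : (↑t * Complex.I * (↑t * -Complex.I) : ℂ) = (t : ℂ) ^ 2 := by
          linear_combination (-(t : ℂ) ^ 2) * Complex.I_sq
        rw [this]
        module
      rw [this]
      refine (norm_add_le _ _).trans ?_
      rw [norm_smul]
      gcongr
      · rw [sq]; exact norm_mul_le _ _
      · simp
    have h3 : ‖φ (a + (t * Complex.I : ℂ) • (1 : B))‖ ^ 2 ≤ ‖a‖ ^ 2 + t ^ 2 * ‖(1 : B)‖ := by
      refine le_trans ?_ h2
      gcongr
      exact (φ.le_opNorm _).trans (mul_le_of_le_one_left (norm_nonneg _) hφ)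
    have h4 : ‖(1 : B)‖ ≤ 1 := by
      rcases subsingleton_or_nontrivial B with hs | hs
      · rw [Subsingleton.elim (1 : B) 0]; simp
      · exact CStarRing.norm_one.le
    have h5 : ‖φ (a + (t * Complex.I : ℂ) • (1 : B))‖ ^ 2
        = (φ a).re ^ 2 + ((φ a).im + t) ^ 2 := by
      rw [map_add, map_smul, h1, Complex.sq_norm, Complex.normSq_apply]
      simp
      ring
    nlinarith [sq_nonneg (φ a).re, sq_nonneg (φ a).im, mul_le_mul_of_nonneg_left h4 (sq_nonneg t)]
  by_contra hne
  have := key ((‖a‖ ^ 2 + 1) / (2 * (φ a).im))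
  have h2 : 2 * ((‖a‖ ^ 2 + 1) / (2 * (φ a).im)) * (φ a).im = ‖a‖ ^ 2 + 1 := by
    field_simp
  linarith

/-- For 0 ≤ a one has ‖‖a‖ − a‖ ≤ ‖a‖, so φ(a) lies in the disc of radius ‖a‖ about ‖a‖ and has
nonnegative real part. -/
theorem apply_nonneg_of_norm_le_one {B : Type*} [CStarAlgebra B] [PartialOrder B]
    [StarOrderedRing B] {φ : StrongDual ℂ B} (hφ : ‖φ‖ ≤ 1) (h1 : φ 1 = 1) {a : B} (ha : 0 ≤ a) :
    0 ≤ φ a := by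
  have him := im_apply_eq_zero_of_isSelfAdjoint hφ h1 (IsSelfAdjoint.of_nonneg ha)
  rw [Complex.nonneg_iff]
  refine ⟨?_, him.symm⟩
  have hn : ‖algebraMap ℝ B ‖a‖ - a‖ ≤ ‖a‖ := by
    have h2 : 0 ≤ algebraMap ℝ B ‖a‖ - a := sub_nonneg.2 (IsSelfAdjoint.of_nonneg ha).le_algebraMap_norm_self
    have h3 : algebraMap ℝ B ‖a‖ - a ≤ algebraMap ℝ B ‖a‖ := sub_le_self _ ha
    refine (CStarAlgebra.norm_le_norm_of_nonneg_of_le h2 h3).trans ?_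
    rcases subsingleton_or_nontrivial B with hs | hs
    · rw [Subsingleton.elim (algebraMap ℝ B ‖a‖) 0]; simp
    · rw [norm_algebraMap', norm_norm]
  have h4 : ‖φ (algebraMap ℝ B ‖a‖ - a)‖ ≤ ‖a‖ :=
    ((φ.le_opNorm _).trans (mul_le_of_le_one_left (norm_nonneg _) hφ)).trans hn
  have h5 : φ (algebraMap ℝ B ‖a‖ - a) = ‖a‖ - φ a := by
    rw [map_sub, Algebra.algebraMap_eq_smul_one, ← Complex.coe_smul, map_smul, h1]; simp
  rw [h5] at h4
  have h6 := (Complex.re_le_norm _).trans h4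
  simp at h6
  exact h6

/-- The unit has distance at least one from L = J + B(1 − u). Otherwise some w = j + x(1 − u) would
be invertible, and wh = jh would put h into J. Hahn–Banach on the quotient by the closure of L then
gives a norm-one functional with value one at 1 that kills J and 1 − u; positivity is automatic from
the norm condition. -/
theorem exists_state_vanishing {B : Type*} [CStarAlgebra B] (J : Submodule ℂ B)
    (hJl : ∀ a, ∀ j ∈ J, a * j ∈ J) (hJr : ∀ a, ∀ j ∈ J, j * a ∈ J) {u h : B} (hh : h ∉ J)
    (huh : u * h = h) :
    ∃ φ : StrongDual ℂ B, ‖φ‖ ≤ 1 ∧ φ 1 = 1 ∧ (∀ j ∈ J, φ j = 0) ∧ φ u = 1 := by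
  have hB : Nontrivial B := ⟨⟨h, 0, fun h0 => hh (h0 ▸ J.zero_mem)⟩⟩
  let L : Submodule ℂ B := J ⊔ LinearMap.range (LinearMap.mulRight ℂ (1 - u))
  have hL : ∀ l ∈ L, 1 ≤ ‖(1 : B) - l‖ := by
    intro l hl
    by_contra! hlt
    obtain ⟨j, hj, m, ⟨x, rfl⟩, rfl⟩ := Submodule.mem_sup.1 hl
    obtain ⟨w, hw⟩ : IsUnit (j + x * (1 - u)) := by
      have := isUnit_one_sub_of_norm_lt_one hlt
      simpa using this
    have h1 : (w : B) * h = j * h := by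
      rw [hw, add_mul, mul_assoc, sub_mul, huh, one_mul, sub_self, mul_zero, add_zero]
    have h2 : h = (↑w⁻¹ : B) * (j * h) := by rw [← h1, ← mul_assoc, Units.inv_mul, one_mul]
    exact hh (h2 ▸ hJl _ _ (hJr _ _ hj))
  let L' := L.topologicalClosure
  have : IsClosed (L' : Set B) := L.isClosed_topologicalClosure
  have hn : 1 ≤ ‖(L'.mkQ 1)‖ := by
    have : ∀ l ∈ L', 1 ≤ ‖(1 : B) - l‖ := by
      intro l hl
      have hc : IsClosed {l : B | 1 ≤ ‖(1 : B) - l‖} := isClosed_le continuous_const (by fun_prop)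
      exact closure_minimal (s := (L : Set B)) hL hc hl
    refine le_of_forall_pos_le_add fun ε hε => ?_
    obtain ⟨m, hm, hmn⟩ := Submodule.Quotient.norm_mk_lt (L'.mkQ (1 : B)) hε
    have h3 : (1 : B) - m ∈ L' := by
      rw [← Submodule.Quotient.eq]; exact hm.symm
    have := this _ h3
    rw [sub_sub_cancel] at this
    linarith
  obtain ⟨g, hg, hg1⟩ := exists_dual_vector ℂ (L'.mkQ (1 : B)) (by linarith)
  have hn1 : ‖L'.mkQ (1 : B)‖ = 1 := le_antisymm
    ((Submodule.Quotient.norm_mk_le L' (1 : B)).trans CStarRing.norm_one.le) hn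
  let φ : StrongDual ℂ B := g.comp (L'.mkQL)
  have hφL : ∀ l ∈ L, φ l = 0 := by
    intro l hl
    have : L'.mkQL l = 0 := (Submodule.Quotient.mk_eq_zero _).2 (L.le_topologicalClosure hl)
    change g (L'.mkQL l) = 0
    rw [this, map_zero]
  have hφ1 : φ 1 = 1 := by
    change g (L'.mkQ 1) = 1
    rw [hg1, hn1]; simp
  refine ⟨φ, ?_, hφ1, fun j hj => hφL j (Submodule.mem_sup_left hj), ?_⟩
  · refine ContinuousLinearMap.opNorm_le_bound _ zero_le_one fun x => ?_
    change ‖g (L'.mkQ x)‖ ≤ _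
    refine (g.le_opNorm _).trans ?_
    rw [hg]
    gcongr
    exact Submodule.Quotient.norm_mk_le L' x
  · have : φ (1 - u) = 0 := hφL _ (Submodule.mem_sup_right ⟨1, by simp⟩)
    rw [map_sub, hφ1] at this
    exact (sub_eq_zero.1 this).symm

/-- Composition of a vector with a representation. -/
noncomputable def vectorFunctional {B H : Type*} [CStarAlgebra B] [NormedAddCommGroup H]
    [InnerProductSpace ℂ H] [CompleteSpace H] (π : B →⋆ₐ[ℂ] (H →L[ℂ] H)) (η : H) :
    StrongDual ℂ B :=
  LinearMap.mkContinuous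
    { toFun := fun a => ⟪η, π a η⟫_ℂ
      map_add' := fun a b => by simp
      map_smul' := fun c a => by simp } (‖η‖ ^ 2) (fun a => by
        refine (norm_inner_le_norm _ _).trans ?_
        have h1 : ‖π a η‖ ≤ ‖a‖ * ‖η‖ := ((π a).le_opNorm η).trans
          (mul_le_mul_of_nonneg_right (NonUnitalStarAlgHom.norm_apply_le π a) (norm_nonneg _))
        calc ‖η‖ * ‖π a η‖ ≤ ‖η‖ * (‖a‖ * ‖η‖) := by gcongr
          _ = ‖η‖ ^ 2 * ‖a‖ := by ring)

theorem norm_vectorFunctional_le {B H : Type*} [CStarAlgebra B] [NormedAddCommGroup H]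
    [InnerProductSpace ℂ H] [CompleteSpace H] (π : B →⋆ₐ[ℂ] (H →L[ℂ] H)) (η : H) :
    ‖vectorFunctional π η‖ ≤ ‖η‖ ^ 2 :=
  LinearMap.mkContinuous_norm_le _ (by positivity) _

/-- The states that vanish on `J` and take the value one at `u`. -/
def peakStates {B : Type*} [CStarAlgebra B] (J : Submodule ℂ B) (u : B) : Set (WeakDual ℂ B) :=
  {φ | φ ∈ WeakDual.toStrongDual ⁻¹' Metric.closedBall 0 1 ∧ φ 1 = 1 ∧ (∀ j ∈ J, φ j = 0) ∧
    φ u = 1}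

theorem isCompact_peakStates {B : Type*} [CStarAlgebra B] (J : Submodule ℂ B) (u : B) :
    IsCompact (peakStates J u) := by
  refine (WeakDual.isCompact_closedBall 0 1).inter_right (t := {φ : WeakDual ℂ B | φ 1 = 1 ∧
    (∀ j ∈ J, φ j = 0) ∧ φ u = 1}) ?_
  have he : ∀ x : B, Continuous fun φ : WeakDual ℂ B => φ x := fun x => WeakDual.eval_continuous x
  refine (isClosed_eq (he 1) continuous_const).inter (IsClosed.inter ?_
    (isClosed_eq (he u) continuous_const))
  have hJ : {φ : WeakDual ℂ B | ∀ j ∈ J, φ j = 0} = ⋂ j ∈ J, {φ | φ j = 0} := by ext; simp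
  have : IsClosed {φ : WeakDual ℂ B | ∀ j ∈ J, φ j = 0} := by
    rw [hJ]
    exact isClosed_biInter fun j _ => isClosed_eq (he j) continuous_const
  exact this

/-- A cyclic representation whose vector state is extreme among the peak states is irreducible. -/
theorem irreducible_of_mem_extremePoints {B H : Type*} [CStarAlgebra B] [NormedAddCommGroup H]
    [InnerProductSpace ℂ H] [CompleteSpace H] (π : B →⋆ₐ[ℂ] (H →L[ℂ] H)) (ξ : H)
    (hcyc : Dense (Set.range fun a => π a ξ)) {J : Submodule ℂ B} {u : B} (hu : ‖u‖ ≤ 1)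
    (hJ : ∀ j ∈ J, π j = 0) (φ : WeakDual ℂ B) (hφ : ∀ a, φ a = ⟪ξ, π a ξ⟫_ℂ)
    (hext : φ ∈ Set.extremePoints ℝ (peakStates J u)) (K : Submodule ℂ H)
    (hK : IsClosed (K : Set H)) (hinv : ∀ a : B, ∀ x ∈ K, π a x ∈ K) : K = ⊥ ∨ K = ⊤ := by
  have : CompleteSpace K := hK.completeSpace_coe
  obtain ⟨⟨-, hφ1, hφJ, hφu⟩, hmax⟩ := hext
  set P := K.starProjection with hP
  -- The orthogonal complement of `K` is invariant too, because the image of `π` is closed under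
  -- adjoints.
  have hcomm : ∀ a x, P (π a x) = π a (P x) := by
    intro a x
    refine Submodule.eq_starProjection_of_mem_of_inner_eq_zero (hinv a _ (K.starProjection_apply_mem x)) ?_
    intro w hw
    rw [← map_sub, ← ContinuousLinearMap.adjoint_inner_right, ← ContinuousLinearMap.star_eq_adjoint,
      ← map_star]
    exact Submodule.starProjection_inner_eq_zero x _ (hinv _ _ hw)
  have hext2 : ∀ T : H →L[ℂ] H, (∀ a x, T (π a x) = π a (T x)) → T ξ = 0 → T = 0 := by
    intro T hT h0
    refine ContinuousLinearMap.coeFn_injective (Continuous.ext_on hcyc T.continuous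
      (0 : H →L[ℂ] H).continuous ?_)
    rintro _ ⟨a, rfl⟩
    simp [hT, h0]
  have hξ : ⟪ξ, ξ⟫_ℂ = 1 := by
    have := hφ 1
    rw [hφ1, map_one] at this
    exact this.symm
  set η := P ξ with hη
  set ζ := ξ - η with hζ
  have hηK : η ∈ K := K.starProjection_apply_mem ξ
  have horth : ∀ a, ∀ w ∈ K, ⟪w, π a ζ⟫_ℂ = 0 := by
    intro a w hw
    rw [hζ, map_sub, hη, ← hcomm, ← inner_conj_symm, K.starProjection_inner_eq_zero _ _ hw, map_zero]
  have hηξ : ∀ a, ⟪η, π a ξ⟫_ℂ = ⟪η, π a η⟫_ℂ := by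
    intro a
    have : ξ = η + ζ := by simp [hζ]
    rw [this, map_add, inner_add_right, horth a η hηK, add_zero]
  have hsplit : ∀ a, φ a = ⟪η, π a η⟫_ℂ + ⟪ζ, π a ζ⟫_ℂ := by
    intro a
    have h1 : ξ = η + ζ := by simp [hζ]
    have h2 : ⟪ζ, π a η⟫_ℂ = 0 :=
      K.starProjection_inner_eq_zero _ _ (hinv a _ hηK)
    rw [hφ, h1, map_add, inner_add_left, inner_add_right, inner_add_right, horth a η hηK, h2]
    ring
  have hself : ∀ v : H, ⟪v, v⟫_ℂ = ((‖v‖ ^ 2 : ℝ) : ℂ) := fun v => by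
    rw [inner_self_eq_norm_sq_to_K]; norm_cast
  have hsum : ‖η‖ ^ 2 + ‖ζ‖ ^ 2 = 1 := by
    have := hsplit 1
    rw [hφ1, map_one, one_apply_eq_self, one_apply_eq_self, hself, hself] at this
    exact_mod_cast this.symm
  by_cases hη0 : η = 0
  · left
    have := hext2 P hcomm hη0
    rw [eq_bot_iff]
    intro x hx
    have h1 : P x = x := K.starProjection_eq_self_iff.2 hx
    rw [this] at h1
    exact h1.symm
  by_cases hζ0 : ζ = 0
  · right
    have h1 := hext2 (1 - P) (fun a x => by simp [hcomm]) hζ0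
    rw [eq_top_iff]
    intro x _
    have h2 : (1 - P) x = 0 := by rw [h1]; rfl
    exact K.starProjection_eq_self_iff.1 (sub_eq_zero.1 h2).symm
  exfalso
  have hs : 0 < ‖η‖ ^ 2 := by positivity
  have hr : 0 < ‖ζ‖ ^ 2 := by positivity
  let ψ : H → WeakDual ℂ B := fun v =>
    StrongDual.toWeakDual (((‖v‖ ^ 2 : ℝ) : ℂ)⁻¹ • vectorFunctional π v)
  have hψ : ∀ v a, ψ v a = ((‖v‖ ^ 2 : ℝ) : ℂ)⁻¹ * ⟪v, π a v⟫_ℂ := fun v a => rfl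
  have hψn : ∀ v, v ≠ 0 → ‖((‖v‖ ^ 2 : ℝ) : ℂ)⁻¹ • vectorFunctional π v‖ ≤ 1 := by
    intro v hv
    have : 0 < ‖v‖ ^ 2 := by positivity
    rw [norm_smul, norm_inv, Complex.norm_real, Real.norm_of_nonneg this.le, inv_mul_le_iff₀ this,
      mul_one]
    exact norm_vectorFunctional_le π v
  have hψu : ∀ v, v ≠ 0 → ‖ψ v u‖ ≤ 1 := fun v hv =>
    ((ContinuousLinearMap.le_opNorm _ _).trans
      (mul_le_of_le_one_left (norm_nonneg _) (hψn v hv))).trans hu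
  have hcomb : ∀ a, φ a = ((‖η‖ ^ 2 : ℝ) : ℂ) * ψ η a + ((‖ζ‖ ^ 2 : ℝ) : ℂ) * ψ ζ a := by
    intro a
    rw [hsplit, hψ, hψ, mul_inv_cancel_left₀ (by exact_mod_cast hs.ne'),
      mul_inv_cancel_left₀ (by exact_mod_cast hr.ne')]
  -- Both numbers have real part at most one and a convex combination of them with positive weights
  -- equals one. So the two normalized vector states are again peak states, and extremality applies.
  have hre : (ψ η u).re = 1 ∧ (ψ ζ u).re = 1 := by
    have h1 := (Complex.re_le_norm _).trans (hψu η hη0)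
    have h2 := (Complex.re_le_norm _).trans (hψu ζ hζ0)
    have h3 := congrArg Complex.re (hcomb u)
    rw [hφu, Complex.add_re, Complex.re_ofReal_mul, Complex.re_ofReal_mul, Complex.one_re] at h3
    constructor <;> nlinarith
  have hone : ∀ z : ℂ, ‖z‖ ≤ 1 → z.re = 1 → z = 1 := by
    intro z hz h1
    have h2 : z.re ^ 2 + z.im ^ 2 ≤ 1 := by
      have := Complex.sq_norm z
      rw [Complex.normSq_apply] at this
      nlinarith [norm_nonneg z]
    have h3 : z.im = 0 := by
      rw [h1] at h2
      nlinarith [sq_nonneg z.im]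
    exact Complex.ext h1 h3
  have hmem : ∀ v, v ≠ 0 → (ψ v u).re = 1 → ψ v ∈ peakStates J u := by
    intro v hv h1
    refine ⟨?_, ?_, fun j hj => ?_, hone _ (hψu v hv) h1⟩
    · exact mem_closedBall_zero_iff.2 (hψn v hv)
    · have : ((‖v‖ ^ 2 : ℝ) : ℂ) ≠ 0 := by
        have : 0 < ‖v‖ ^ 2 := by positivity
        exact_mod_cast this.ne'
      rw [hψ, map_one, one_apply_eq_self, hself, inv_mul_cancel₀ this]
    · rw [hψ, hJ j hj, zero_apply, inner_zero_right, mul_zero]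
  have heq := hmax (hmem η hη0 hre.1) (hmem ζ hζ0 hre.2) ⟨‖η‖ ^ 2, ‖ζ‖ ^ 2, hs, hr, hsum, by
    refine DFunLike.ext _ _ fun a => ?_
    rw [hcomb a]
    rfl⟩
  -- Since the state of η equals φ, the vector η − ‖η‖²ξ is orthogonal to the dense orbit of ξ.
  -- Applying `P` to the resulting identity then forces ‖η‖ = 1, against ζ ≠ 0.
  have hprop : η = ((‖η‖ ^ 2 : ℝ) : ℂ) • ξ := by
    rw [← sub_eq_zero, ← inner_self_eq_zero (𝕜 := ℂ)]
    refine congrFun (Continuous.ext_on (f := fun x => ⟪η - ((‖η‖ ^ 2 : ℝ) : ℂ) • ξ, x⟫_ℂ)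
      (g := fun _ => 0) hcyc (by fun_prop) continuous_const ?_) _
    rintro _ ⟨a, rfl⟩
    have h1 := congrArg (fun χ : WeakDual ℂ B => χ a) heq
    simp only [hψ] at h1
    have h2 : ((‖η‖ ^ 2 : ℝ) : ℂ) ≠ 0 := by exact_mod_cast hs.ne'
    simp only
    rw [inner_sub_left, inner_smul_left, hηξ, ← hφ, ← h1, Complex.conj_ofReal,
      mul_inv_cancel_left₀ h2, sub_self]
  have h4 : η = ((‖η‖ ^ 2 : ℝ) : ℂ) • η := by
    have h5 := congrArg P hprop
    rw [map_smul, ← hη] at h5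
    rwa [K.starProjection_eq_self_iff.2 hηK] at h5
  have h6 : ((1 - (‖η‖ ^ 2 : ℝ) : ℂ)) • η = 0 := by rw [sub_smul, one_smul, ← h4, sub_self]
  rcases smul_eq_zero.1 h6 with h | h
  · have : 1 - ‖η‖ ^ 2 = 0 := by exact_mod_cast h
    linarith
  · exact hη0 h

/-- An extreme peak state exists by compactness and Krein–Milman, and its GNS representation is
irreducible. It kills J because J is a two-sided ideal on which the state vanishes, and it does not
kill u because the state is one there. -/
theorem exists_irreducible_unital {B : Type u} [CStarAlgebra B] (J : Submodule ℂ B)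
    (hJl : ∀ a, ∀ j ∈ J, a * j ∈ J) (hJr : ∀ a, ∀ j ∈ J, j * a ∈ J) {u h : B} (hh : h ∉ J)
    (huh : u * h = h) (hu : ‖u‖ ≤ 1) :
    ∃ (H : Type u) (_ : NormedAddCommGroup H) (_ : InnerProductSpace ℂ H) (_ : CompleteSpace H)
      (π : B →⋆ₐ[ℂ] (H →L[ℂ] H)), (∀ j ∈ J, π j = 0) ∧ π u ≠ 0 ∧
      ∀ K : Submodule ℂ H, IsClosed (K : Set H) → (∀ a : B, ∀ x ∈ K, π a x ∈ K) →
        K = ⊥ ∨ K = ⊤ := by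
  let _ : PartialOrder B := CStarAlgebra.spectralOrder B
  have : StarOrderedRing B := CStarAlgebra.spectralOrderedRing B
  obtain ⟨φ₀, h₀, h₀1, h₀J, h₀u⟩ := exists_state_vanishing J hJl hJr hh huh
  obtain ⟨φ, hφ⟩ := WeakDual.exists_extremePoint (isCompact_peakStates J u)
    ⟨StrongDual.toWeakDual φ₀, by
      refine ⟨?_, h₀1, h₀J, h₀u⟩
      simpa using h₀⟩
  obtain ⟨hφn, hφ1, hφJ, hφu⟩ := hφ.1
  have hφn' : ‖WeakDual.toStrongDual φ‖ ≤ 1 := by simpa using hφn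
  let f : B →ₚ[ℂ] ℂ := PositiveLinearMap.mk₀ (WeakDual.toStrongDual φ).toLinearMap
    fun a ha => apply_nonneg_of_norm_le_one hφn' hφ1 ha
  have hf : ∀ a, f a = φ a := fun a => rfl
  let ξ : f.GNS := ((f.toPreGNS 1 : f.PreGNS) : f.GNS)
  have hπ : ∀ a, f.gnsStarAlgHom a ξ = ((f.toPreGNS a : f.PreGNS) : f.GNS) := by
    intro a
    change f.gnsNonUnitalStarAlgHom a ξ = _
    rw [PositiveLinearMap.gnsNonUnitalStarAlgHom_apply_coe]
    simp
  have hin : ∀ a b : B, ⟪((f.toPreGNS a : f.PreGNS) : f.GNS), ((f.toPreGNS b : f.PreGNS) : f.GNS)⟫_ℂ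
      = φ (star a * b) := by
    intro a b
    rw [UniformSpace.Completion.inner_coe, PositiveLinearMap.preGNS_inner_def]
    simp [hf]
  have hφξ : ∀ a, φ a = ⟪ξ, f.gnsStarAlgHom a ξ⟫_ℂ := by
    intro a
    rw [hπ, hin]; simp
  have hcyc : Dense (Set.range fun a => f.gnsStarAlgHom a ξ) := by
    simp_rw [hπ]
    exact (UniformSpace.Completion.denseRange_coe).comp f.toPreGNS.surjective.denseRange
      (UniformSpace.Completion.continuous_coe _)
  have hJ0 : ∀ j ∈ J, f.gnsStarAlgHom j = 0 := by
    intro j hj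
    refine ContinuousLinearMap.coeFn_injective (Continuous.ext_on hcyc
      (ContinuousLinearMap.continuous _) (ContinuousLinearMap.continuous _) ?_)
    rintro _ ⟨a, rfl⟩
    simp only
    rw [← mul_apply_eq_comp, ← map_mul, hπ, zero_apply,
      ← inner_self_eq_zero (𝕜 := ℂ), hin]
    exact hφJ _ (hJl _ _ (hJr _ _ hj))
  refine ⟨f.GNS, inferInstance, inferInstance, inferInstance, f.gnsStarAlgHom, hJ0, ?_, ?_⟩
  · intro h0
    have := hφξ u
    rw [h0, hφu] at this
    simp at this
  · exact irreducible_of_mem_extremePoints _ ξ hcyc hu hJ0 φ hφξ hφ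

/-- Irreducible representations separate the self-adjoint elements from closed ideals. -/
theorem exists_irrepOf_ne_zero {A : Type u} [NonUnitalCStarAlgebra A] (J : Submodule ℂ A)
    (hJc : IsClosed (J : Set A)) (hJl : ∀ a, ∀ j ∈ J, a * j ∈ J) (hJr : ∀ a, ∀ j ∈ J, j * a ∈ J)
    {a : A} (ha : IsSelfAdjoint a) (haJ : a ∉ J) :
    ∃ ρ : IrrepOf A, (∀ j ∈ J, ρ.rep j = 0) ∧ ρ.rep a ≠ 0 := by
  obtain ⟨ε, hε, hball⟩ : ∃ ε > 0, ∀ b : A, ‖a - b‖ ≤ ε → b ∉ J := by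
    obtain ⟨ε, hε, h⟩ := Metric.isOpen_iff.1 hJc.isOpen_compl a haJ
    refine ⟨ε / 2, by positivity, fun b hb => h ?_⟩
    rw [Metric.mem_ball, dist_comm, dist_eq_norm]
    linarith
  -- With `c` the clamp to [−ε, ε], h = a − c(a) is within ε of a and so remains outside J. The
  -- function `g` equals one wherever x − c(x) ≠ 0, which makes u = g(a) a left unit for h.
  let c : ℝ → ℝ := fun x => max (-ε) (min x ε)
  let g : ℝ → ℝ := fun x => min (|x| / ε) 1
  have hc : Continuous c := by fun_prop
  have hg : Continuous g := by fun_prop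
  have hc0 : c 0 = 0 := by simp [c, hε.le]
  have hg0 : g 0 = 0 := by simp [g]
  set u := cfcₙ g a with hu
  set h := cfcₙ (fun x => x - c x) a with hh
  have hcn : ∀ x, |c x| ≤ ε := fun x => abs_le.2 ⟨le_max_left _ _, max_le (by linarith) (min_le_right _ _)⟩
  have hhJ : h ∉ J := by
    refine hball h ?_
    have : a - h = cfcₙ c a := by
      rw [hh, cfcₙ_sub (fun x => x) c a (by fun_prop) rfl hc.continuousOn hc0, cfcₙ_id' ℝ a]
      abel
    rw [this]
    exact norm_cfcₙ_le fun x _ => hcn x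
  have huh : u * h = h := by
    rw [hu, hh, ← cfcₙ_mul g (fun x => x - c x) a hg.continuousOn hg0 (by fun_prop) (by simp [hc0])]
    refine cfcₙ_congr fun x _ => ?_
    by_cases hx : |x| ≤ ε
    · have : c x = x := by
        obtain ⟨h1, h2⟩ := abs_le.1 hx
        simp [c, h1, h2]
      simp [this]
    · have : g x = 1 := min_eq_right ((one_le_div hε).2 (not_le.1 hx).le)
      simp [this]
  have hun : ‖u‖ ≤ 1 := norm_cfcₙ_le fun x _ => by
    rw [Real.norm_of_nonneg (by positivity)]
    exact min_le_right _ _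
  let ι := Unitization.inrNonUnitalStarAlgHom ℂ A
  let J' : Submodule ℂ (Unitization ℂ A) := J.map (ι : A →ₗ[ℂ] Unitization ℂ A)
  have hι : ∀ b, ι b = (b : Unitization ℂ A) := fun b => rfl
  have hmem : ∀ b : A, (b : Unitization ℂ A) ∈ J' ↔ b ∈ J := by
    intro b
    constructor
    · rintro ⟨j, hj, hjb⟩
      have := Unitization.inr_injective (R := ℂ) hjb
      exact this ▸ hj
    · exact fun hb => ⟨b, hb, rfl⟩
  obtain ⟨H, _, _, _, π, hπJ, hπu, hirr⟩ := exists_irreducible_unital J'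
    (u := (u : Unitization ℂ A)) (h := (h : Unitization ℂ A)) (by
      rintro x _ ⟨j, hj, rfl⟩
      induction x with
      | inl_add_inr r x =>
        change (Unitization.inl r + (x : Unitization ℂ A)) * (j : Unitization ℂ A) ∈ J'
        rw [add_mul, ← Unitization.inr_mul, Unitization.inl_mul_inr]
        exact J'.add_mem ((hmem _).2 (J.smul_mem _ hj)) ((hmem _).2 (hJl _ _ hj))) (by
      rintro x _ ⟨j, hj, rfl⟩
      induction x with
      | inl_add_inr r x =>
        change (j : Unitization ℂ A) * (Unitization.inl r + (x : Unitization ℂ A)) ∈ J'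
        rw [mul_add, ← Unitization.inr_mul, Unitization.inr_mul_inl]
        exact J'.add_mem ((hmem _).2 (J.smul_mem _ hj)) ((hmem _).2 (hJr _ _ hj)))
    (fun hm => hhJ ((hmem h).1 hm)) (by rw [← Unitization.inr_mul, huh])
    (by rwa [Unitization.norm_inr])
  let τ : A →⋆ₙₐ[ℂ] (H →L[ℂ] H) := (π : Unitization ℂ A →⋆ₙₐ[ℂ] (H →L[ℂ] H)).comp ι
  have hτ : ∀ b, τ b = π (b : Unitization ℂ A) := fun b => rfl
  have hτu : τ u ≠ 0 := hπu
  have hτc : Continuous τ := (LipschitzWith.of_dist_le_mul (K := 1) fun x y => by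
    rw [dist_eq_norm, dist_eq_norm, ← map_sub, NNReal.coe_one, one_mul]
    exact NonUnitalStarAlgHom.norm_apply_le τ _).continuous
  -- The functional calculus commutes with τ and g(0) = 0, so τ(a) = 0 would force τ(u) = 0.
  have hτa : τ a ≠ 0 := by
    intro h0
    apply hτu
    have hsa : IsSelfAdjoint (τ a) := ha.map τ
    rw [hu, NonUnitalStarAlgHomClass.map_cfcₙ τ g a hg.continuousOn hg0 hτc ha hsa, h0,
      cfcₙ_apply_zero]
  refine ⟨⟨H, τ, fun h0 => hτa (by rw [h0]; rfl), fun K hK hinv => hirr K hK fun x y hy => ?_⟩,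
    fun j hj => hπJ _ ((hmem j).2 hj), hτa⟩
  induction x with
  | inl_add_inr r x =>
    rw [map_add, add_apply]
    refine K.add_mem ?_ (hinv x y hy)
    have : π (Unitization.inl r) = r • 1 := by
      have := π.commutes r
      rwa [Unitization.algebraMap_eq_inl, Algebra.algebraMap_eq_smul_one] at this
    rw [this]
    exact K.smul_mem r hy

/-! ### Soft thresholding of self-adjoint elements -/

/-- Soft thresholding `x ↦ x - max (-r) (min x r)` at level `r`, applied to a self-adjoint
element. -/
noncomputable def softThreshold {A : Type*} [NonUnitalCStarAlgebra A] (r : ℝ) (a : A) : A :=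
  cfcₙ (fun x : ℝ => x - max (-r) (min x r)) a

section SoftThreshold

variable {A : Type*} [NonUnitalCStarAlgebra A] {r : ℝ} {a : A}

theorem sub_softThreshold (hr : 0 ≤ r) (ha : IsSelfAdjoint a) :
    a - softThreshold r a = cfcₙ (fun x : ℝ => max (-r) (min x r)) a := by
  have h0 : max (-r) (min 0 r) = 0 := by simp [hr]
  rw [softThreshold, cfcₙ_sub (fun x => x) (fun x : ℝ => max (-r) (min x r)) a (by fun_prop) rfl
    (by fun_prop) h0, cfcₙ_id' ℝ a]
  abel

theorem norm_sub_softThreshold_le (hr : 0 ≤ r) (ha : IsSelfAdjoint a) :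
    ‖a - softThreshold r a‖ ≤ r := by
  rw [sub_softThreshold hr ha]
  exact norm_cfcₙ_le fun x _ =>
    abs_le.2 ⟨le_max_left _ _, max_le (by linarith) (min_le_right _ _)⟩

theorem abs_sub_clamp_le {x r s : ℝ} (hr : 0 ≤ r) (hs : 0 ≤ s) (hx : |x| ≤ r + s) :
    |x - max (-r) (min x r)| ≤ s := by
  obtain ⟨h1, h2⟩ := abs_le.1 hx
  rw [abs_le]
  rcases le_total x r with h | h
  · rw [min_eq_left h]
    rcases le_total (-r) x with h' | h'
    · rw [max_eq_right h']; constructor <;> linarith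
    · rw [max_eq_left h']; constructor <;> linarith
  · rw [min_eq_right h, max_eq_right (by linarith)]
    constructor <;> linarith

theorem norm_softThreshold_le {s : ℝ} (hr : 0 ≤ r) (hs : 0 ≤ s) (ha : IsSelfAdjoint a)
    (h : ‖a‖ ≤ r + s) : ‖softThreshold r a‖ ≤ s :=
  norm_cfcₙ_le fun _ hx => abs_sub_clamp_le hr hs <|
    (NonUnitalIsometricContinuousFunctionalCalculus.norm_quasispectrum_le a hx ha).trans h

/-- This translates a norm bound into the vanishing of an element. Thresholding commutes with
*-homomorphisms, so facts about where ρ(a) vanishes become facts about the size of ‖ρ(a)‖. -/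
theorem softThreshold_eq_zero_iff (hr : 0 ≤ r) (ha : IsSelfAdjoint a) :
    softThreshold r a = 0 ↔ ‖a‖ ≤ r := by
  constructor
  · intro h
    simpa [h] using norm_sub_softThreshold_le hr ha
  · intro h
    exact norm_le_zero_iff.1 (norm_softThreshold_le hr le_rfl ha (by simpa using h))

theorem NonUnitalStarAlgHom.continuous_of_cstar {A B : Type*} [NonUnitalCStarAlgebra A]
    [NonUnitalCStarAlgebra B] (τ : A →⋆ₙₐ[ℂ] B) : Continuous τ :=
  (LipschitzWith.of_dist_le_mul (K := 1) fun x y => by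
    rw [dist_eq_norm, dist_eq_norm, ← map_sub, NNReal.coe_one, one_mul]
    exact NonUnitalStarAlgHom.norm_apply_le τ _).continuous

theorem map_softThreshold {B : Type*} [NonUnitalCStarAlgebra B] (τ : A →⋆ₙₐ[ℂ] B) (hr : 0 ≤ r)
    (ha : IsSelfAdjoint a) : τ (softThreshold r a) = softThreshold r (τ a) := by
  have h0 : (0 : ℝ) - max (-r) (min 0 r) = 0 := by simp [hr]
  exact NonUnitalStarAlgHomClass.map_cfcₙ τ _ a (by fun_prop) h0
    (NonUnitalStarAlgHom.continuous_of_cstar τ) ha (ha.map τ)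

end SoftThreshold

/-! ### Irreducible representations parametrized by the interval -/

/-- A family of irreducible representations of `A`, indexed by the unit interval, that is a
homeomorphic parametrization of the spectrum of a C⋆-algebra with local rank-one projections. -/
structure IsSpectralField {A : Type u} [NonUnitalCStarAlgebra A] (ρ : I → IrrepOf A) : Prop where
  isOpen_ne (a : A) : IsOpen {t | (ρ t).rep a ≠ 0}
  exists_bump (t : I) (V : Set I) (hV : IsOpen V) (ht : t ∈ V) :
    ∃ b : A, (ρ t).rep b ≠ 0 ∧ ∀ s ∉ V, (ρ s).rep b = 0
  exists_ne_zero (J : Submodule ℂ A) (hJc : IsClosed (J : Set A)) (hJl : ∀ a, ∀ j ∈ J, a * j ∈ J)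
    (hJr : ∀ a, ∀ j ∈ J, j * a ∈ J) (a : A) (ha : IsSelfAdjoint a) (haJ : a ∉ J) :
    ∃ t, (∀ j ∈ J, (ρ t).rep j = 0) ∧ (ρ t).rep a ≠ 0
  exists_rank_one (t : I) : ∃ V ∈ 𝓝 t, ∃ a : A, ∀ s ∈ V,
    IsStarProjection ((ρ s).rep a) ∧ Module.finrank ℂ ((ρ s).rep a).range = 1

section Irrep

variable {A : Type u} [NonUnitalRing A] [StarRing A] [Module ℂ A]

theorem IrrepOf.rep_eq_zero_iff_of_equiv {ρ ρ' : IrrepOf A} (h : ρ ≈ ρ') (a : A) :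
    ρ.rep a = 0 ↔ ρ'.rep a = 0 := by
  obtain ⟨U, hU⟩ := h
  constructor
  · intro h0
    ext y
    obtain ⟨x, rfl⟩ := U.surjective y
    rw [← hU, h0]; simp
  · intro h0
    ext x
    apply U.injective
    rw [hU, h0]; simp

theorem IrrepOf.toSpectrum_mem_iff (ρ : IrrepOf A) (a : A) :
    ρ.toSpectrum ∈ {x | ∃ ρ' : IrrepOf A, ρ'.toSpectrum = x ∧ ρ'.rep a ≠ 0} ↔ ρ.rep a ≠ 0 := by
  constructor
  · rintro ⟨ρ', h, ha⟩
    exact fun h0 => ha ((IrrepOf.rep_eq_zero_iff_of_equiv (Quotient.exact h) a).2 h0)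
  · exact fun ha => ⟨ρ, rfl, ha⟩

/-- The common kernel of all operators is a closed invariant subspace, and it cannot be everything
because the representation is nonzero. -/
theorem IrrepOf.exists_apply_ne_zero (ρ : IrrepOf A) {x : ρ.H} (hx : x ≠ 0) :
    ∃ a, ρ.rep a x ≠ 0 := by
  by_contra! h
  let K : Submodule ℂ ρ.H := ⨅ a : A, LinearMap.ker (ρ.rep a : ρ.H →ₗ[ℂ] ρ.H)
  have hK : ∀ y, y ∈ K ↔ ∀ a, ρ.rep a y = 0 := fun y => by simp [K]
  have hKc : IsClosed (K : Set ρ.H) := by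
    have : (K : Set ρ.H) = ⋂ a : A, {y | ρ.rep a y = 0} := by ext y; simp [hK]
    rw [this]
    exact isClosed_iInter fun a => isClosed_eq (ρ.rep a).continuous continuous_const
  rcases ρ.irreducible K hKc (fun a y hy => by rw [(hK y).1 hy a]; exact K.zero_mem) with h0 | h0
  · exact hx ((Submodule.mem_bot ℂ).1 (h0 ▸ (hK x).2 h))
  · apply ρ.ne_zero
    ext a y
    exact (hK y).1 (h0 ▸ Submodule.mem_top) a

/-- The orbit of a nonzero vector spans a dense subspace. -/
theorem IrrepOf.dense_orbit (ρ : IrrepOf A) {x : ρ.H} (hx : x ≠ 0) :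
    Dense (Submodule.span ℂ (Set.range fun a => ρ.rep a x) : Set ρ.H) := by
  set S := Submodule.span ℂ (Set.range fun a => ρ.rep a x) with hS
  have hinv : ∀ a : A, ∀ y ∈ S, ρ.rep a y ∈ S := by
    intro a y hy
    induction hy using Submodule.span_induction with
    | mem y hy =>
      obtain ⟨b, rfl⟩ := hy
      exact Submodule.subset_span ⟨a * b, by simp⟩
    | zero => rw [map_zero]; exact S.zero_mem
    | add y z _ _ h1 h2 => rw [map_add]; exact S.add_mem h1 h2
    | smul c y _ h => rw [map_smul]; exact S.smul_mem c h
  rw [Submodule.dense_iff_topologicalClosure_eq_top]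
  rcases ρ.irreducible S.topologicalClosure S.isClosed_topologicalClosure (fun a y hy =>
    map_mem_closure (ρ.rep a).continuous hy (hinv a)) with h | h
  · obtain ⟨a, ha⟩ := ρ.exists_apply_ne_zero hx
    exact absurd ((Submodule.mem_bot ℂ).1 (h ▸ S.le_topologicalClosure
      (Submodule.subset_span ⟨a, rfl⟩))) ha
  · exact h

/-- The kernel of an irreducible representation is a prime ideal: the vectors ρ(c)ρ(b)x span a dense
subspace once ρ(b)x ≠ 0, so ρ(a) cannot kill them all. -/
theorem IrrepOf.exists_mul_mul_ne_zero (ρ : IrrepOf A) {a b : A} (ha : ρ.rep a ≠ 0)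
    (hb : ρ.rep b ≠ 0) : ∃ c, ρ.rep (a * c * b) ≠ 0 := by
  by_contra! h
  obtain ⟨x, hx⟩ : ∃ x, ρ.rep b x ≠ 0 := by
    by_contra! h0
    exact hb (ContinuousLinearMap.ext h0)
  apply ha
  refine ContinuousLinearMap.coeFn_injective (Continuous.ext_on (ρ.dense_orbit hx)
    (ρ.rep a).continuous (0 : ρ.H →L[ℂ] ρ.H).continuous ?_)
  intro y hy
  induction hy using Submodule.span_induction with
  | mem y hy =>
    obtain ⟨c, rfl⟩ := hy
    have := congrArg (fun T : ρ.H →L[ℂ] ρ.H => T x) (h c)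
    simpa using this
  | zero => simp
  | add y z _ _ h1 h2 => rw [map_add, h1, h2]; simp
  | smul c y _ h => rw [map_smul, h]; simp

end Irrep

/-- One representative is chosen in each class. All four properties are invariant under unitary
equivalence, so they transfer from the spectrum along the homeomorphism. -/
theorem exists_isSpectralField {A : Type u} [NonUnitalCStarAlgebra A] (hA : IsContinuousTrace A)
    (h : CStarSpectrum A ≃ₜ I) : ∃ ρ : I → IrrepOf A, IsSpectralField ρ := by
  let ρ : I → IrrepOf A := fun t => (h.symm t).out
  have hρ : ∀ t, (ρ t).toSpectrum = h.symm t := fun t => Quotient.out_eq _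
  have hρ' : ∀ ρ' : IrrepOf A, ρ' ≈ ρ (h ρ'.toSpectrum) := fun ρ' => Quotient.exact (by
    change ρ'.toSpectrum = (ρ (h ρ'.toSpectrum)).toSpectrum
    rw [hρ, h.symm_apply_apply])
  refine ⟨ρ, fun a => ?_, fun t V hV ht => ?_, fun J hJc hJl hJr a ha haJ => ?_, fun t => ?_⟩
  · have h1 : IsOpen {x : CStarSpectrum A | ∃ ρ' : IrrepOf A, ρ'.toSpectrum = x ∧ ρ'.rep a ≠ 0} :=
      TopologicalSpace.isOpen_generateFrom_of_mem ⟨a, rfl⟩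
    have h2 := h1.preimage h.symm.continuous
    convert h2 using 1
    ext t
    rw [Set.mem_preimage, ← hρ, IrrepOf.toSpectrum_mem_iff]
    rfl
  -- Induction over the generation of the topology by nonvanishing sets. For an intersection the
  -- product b₁cb₂ does the job, with c supplied by primeness.
  · have key : ∀ O : Set (CStarSpectrum A), IsOpen O → ∀ ρ₀ : IrrepOf A, ρ₀.toSpectrum ∈ O →
        ∃ b : A, ρ₀.rep b ≠ 0 ∧ ∀ ρ' : IrrepOf A, ρ'.toSpectrum ∉ O → ρ'.rep b = 0 := by
      intro O hO ρ₀
      induction hO with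
      | basic O hO =>
        obtain ⟨a, rfl⟩ := hO
        intro h0
        refine ⟨a, (IrrepOf.toSpectrum_mem_iff _ _).1 h0, fun ρ' hρ' => ?_⟩
        rw [IrrepOf.toSpectrum_mem_iff] at hρ'
        exact not_not.1 hρ'
      | univ =>
        intro _
        obtain ⟨a, ha⟩ : ∃ a, ρ₀.rep a ≠ 0 := by
          by_contra! h0
          exact ρ₀.ne_zero (DFunLike.ext _ _ h0)
        exact ⟨a, ha, fun ρ' hρ' => absurd (Set.mem_univ _) hρ'⟩
      | inter O₁ O₂ _ _ h1 h2 =>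
        rintro ⟨hm1, hm2⟩
        obtain ⟨b₁, hb₁, hb₁'⟩ := h1 hm1
        obtain ⟨b₂, hb₂, hb₂'⟩ := h2 hm2
        obtain ⟨c, hc⟩ := ρ₀.exists_mul_mul_ne_zero hb₁ hb₂
        refine ⟨_, hc, fun ρ' hρ' => ?_⟩
        rw [map_mul, map_mul]
        by_cases hm : ρ'.toSpectrum ∈ O₁
        · rw [hb₂' ρ' fun hm2 => hρ' ⟨hm, hm2⟩, mul_zero]
        · rw [hb₁' ρ' hm, zero_mul, zero_mul]
      | sUnion S _ ih =>
        rintro ⟨O, hO, hm⟩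
        obtain ⟨b, hb, hb'⟩ := ih O hO hm
        exact ⟨b, hb, fun ρ' hρ' => hb' ρ' fun hm' => hρ' ⟨O, hO, hm'⟩⟩
    obtain ⟨b, hb, hb'⟩ := key (h ⁻¹' V) (hV.preimage h.continuous) (ρ t) (by
      rw [Set.mem_preimage, hρ, h.apply_symm_apply]; exact ht)
    refine ⟨b, hb, fun s hs => hb' _ ?_⟩
    rw [Set.mem_preimage, hρ, h.apply_symm_apply]
    exact hs
  · obtain ⟨ρ', h1, h2⟩ := exists_irrepOf_ne_zero J hJc hJl hJr ha haJ
    exact ⟨h ρ'.toSpectrum, fun j hj => (IrrepOf.rep_eq_zero_iff_of_equiv (hρ' ρ') j).1 (h1 j hj),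
      fun h0 => h2 ((IrrepOf.rep_eq_zero_iff_of_equiv (hρ' ρ') a).2 h0)⟩
  · obtain ⟨V, hV, a, ha⟩ := hA.fell (h.symm t)
    refine ⟨h.symm ⁻¹' V, h.symm.continuous.continuousAt hV, a, fun s hs => ha _ ?_⟩
    rw [hρ]
    exact hs

/-! ### Norms, ideals and the action of C[0,1] on a spectral field -/

namespace IsSpectralField

variable {A : Type u} [NonUnitalCStarAlgebra A] {ρ : I → IrrepOf A}

theorem eq_zero_of_forall (hρ : IsSpectralField ρ) {a : A} (h : ∀ t, (ρ t).rep a = 0) : a = 0 := by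
  rw [← CStarRing.star_mul_self_eq_zero_iff]
  by_contra h0
  obtain ⟨t, -, ht⟩ := hρ.exists_ne_zero ⊥ (by simp) (by simp) (by simp) _
    (IsSelfAdjoint.star_mul_self a) (by simpa using h0)
  exact ht (by rw [map_mul, h t, mul_zero])

theorem ext (hρ : IsSpectralField ρ) {a b : A} (h : ∀ t, (ρ t).rep a = (ρ t).rep b) : a = b :=
  sub_eq_zero.1 (hρ.eq_zero_of_forall fun t => by rw [map_sub, h, sub_self])

theorem norm_rep_le (t : I) (a : A) : ‖(ρ t).rep a‖ ≤ ‖a‖ :=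
  NonUnitalStarAlgHom.norm_apply_le (ρ t).rep a

/-- The element a*a thresholded at C² vanishes in every fibre, hence vanishes. Thus the norm is
controlled by the fibre norms. -/
theorem norm_le (hρ : IsSpectralField ρ) {a : A} {C : ℝ} (hC : 0 ≤ C)
    (h : ∀ t, ‖(ρ t).rep a‖ ≤ C) : ‖a‖ ≤ C := by
  have hsa := IsSelfAdjoint.star_mul_self a
  have h1 : softThreshold (C ^ 2) (star a * a) = 0 := by
    refine hρ.eq_zero_of_forall fun t => ?_
    rw [map_softThreshold _ (sq_nonneg C) hsa, softThreshold_eq_zero_iff (sq_nonneg C) (hsa.map _),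
      map_mul, map_star, CStarRing.norm_star_mul_self, ← sq]
    gcongr
    exact h t
  rw [softThreshold_eq_zero_iff (sq_nonneg C) hsa, CStarRing.norm_star_mul_self, ← sq] at h1
  exact (sq_le_sq₀ (norm_nonneg _) hC).1 h1

/-- Lower semicontinuity of the norm: the set is the nonvanishing set of a*a thresholded at r². -/
theorem isOpen_lt_norm (hρ : IsSpectralField ρ) (a : A) {r : ℝ} (hr : 0 ≤ r) :
    IsOpen {t | r < ‖(ρ t).rep a‖} := by
  have hsa := IsSelfAdjoint.star_mul_self a
  convert hρ.isOpen_ne (softThreshold (r ^ 2) (star a * a)) using 1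
  ext t
  simp only [Set.mem_ofPred_eq]
  rw [map_softThreshold _ (sq_nonneg r) hsa, Ne, softThreshold_eq_zero_iff (sq_nonneg r)
    (hsa.map _), map_mul, map_star, CStarRing.norm_star_mul_self, ← sq, sq_le_sq₀ (norm_nonneg _) hr,
    not_le]

/-- A self-adjoint element outside J would be detected by some fibre that kills all of J, and there
is no such fibre. Real and imaginary parts give the rest. -/
theorem eq_top (hρ : IsSpectralField ρ) {J : Submodule ℂ A} (hJc : IsClosed (J : Set A))
    (hJl : ∀ a, ∀ j ∈ J, a * j ∈ J) (hJr : ∀ a, ∀ j ∈ J, j * a ∈ J)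
    (h : ∀ t, ∃ j ∈ J, (ρ t).rep j ≠ 0) : J = ⊤ := by
  have key : ∀ a, IsSelfAdjoint a → a ∈ J := by
    intro a ha
    by_contra haJ
    obtain ⟨t, ht, -⟩ := hρ.exists_ne_zero J hJc hJl hJr a ha haJ
    obtain ⟨j, hj, hj'⟩ := h t
    exact hj' (ht j hj)
  rw [eq_top_iff]
  intro a _
  rw [← realPart_add_I_smul_imaginaryPart a]
  exact J.add_mem (key _ (realPart a).2) (J.smul_mem _ (key _ (imaginaryPart a).2))

/-- A field of operators that is uniformly approximable by elements is given by an element. -/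
theorem exists_of_approx (hρ : IsSpectralField ρ) (T : ∀ t, (ρ t).H →L[ℂ] (ρ t).H)
    (h : ∀ ε > 0, ∃ a : A, ∀ t, ‖(ρ t).rep a - T t‖ ≤ ε) : ∃ a : A, ∀ t, (ρ t).rep a = T t := by
  choose a ha using fun n : ℕ => h (1 / ((n : ℝ) + 1)) (by positivity)
  have hlim : Filter.Tendsto (fun n : ℕ => 1 / ((n : ℝ) + 1)) Filter.atTop (𝓝 0) :=
    tendsto_one_div_add_atTop_nhds_zero_nat
  have hc : CauchySeq a := by
    refine cauchySeq_of_le_tendsto_0 (fun n : ℕ => 2 * (1 / ((n : ℝ) + 1))) (fun n m N hn hm => ?_)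
      (by simpa using hlim.const_mul 2)
    rw [dist_eq_norm]
    refine hρ.norm_le (by positivity) fun t => ?_
    have hmono : ∀ k, N ≤ k → ‖(ρ t).rep (a k) - T t‖ ≤ 1 / ((N : ℝ) + 1) := fun k hk =>
      (ha k t).trans (one_div_le_one_div_of_le (by positivity) (by gcongr))
    have : (ρ t).rep (a n - a m) = ((ρ t).rep (a n) - T t) - ((ρ t).rep (a m) - T t) := by
      rw [map_sub]; abel
    rw [this]
    refine (norm_sub_le _ _).trans ?_
    linarith [hmono n hn, hmono m hm]
  obtain ⟨b, hb⟩ := cauchySeq_tendsto_of_complete hc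
  refine ⟨b, fun t => ?_⟩
  have h1 : Filter.Tendsto (fun n => (ρ t).rep (a n)) Filter.atTop (𝓝 ((ρ t).rep b)) :=
    ((NonUnitalStarAlgHom.continuous_of_cstar (ρ t).rep).tendsto b).comp hb
  have h2 : Filter.Tendsto (fun n => (ρ t).rep (a n)) Filter.atTop (𝓝 (T t)) := by
    rw [tendsto_iff_norm_sub_tendsto_zero]
    exact squeeze_zero (fun _ => norm_nonneg _) (fun n => ha n t) hlim
  exact tendsto_nhds_unique h1 h2

/-- Elements can be cut off between disjoint closed sets. -/
theorem exists_cutoff (hρ : IsSpectralField ρ) {C D : Set I} (hC : IsClosed C) (hD : IsClosed D)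
    (hCD : Disjoint C D) {a : A} (ha : IsSelfAdjoint a) {ε : ℝ} (hε : 0 < ε) :
    ∃ c : A, ‖c‖ ≤ ‖a‖ ∧ (∀ t ∈ D, (ρ t).rep c = 0) ∧ ∀ t ∈ C, ‖(ρ t).rep c - (ρ t).rep a‖ ≤ ε := by
  let J : Set I → Submodule ℂ A := fun S => 
    { carrier := {a | ∀ t ∈ S, (ρ t).rep a = 0}
      add_mem' := fun ha hb t ht => by rw [map_add, ha t ht, hb t ht, add_zero]
      zero_mem' := fun t _ => map_zero _
      smul_mem' := fun c a ha t ht => by rw [map_smul, ha t ht, smul_zero] }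
  have hJ : ∀ S a, a ∈ J S ↔ ∀ t ∈ S, (ρ t).rep a = 0 := fun S a => Iff.rfl
  have hl : ∀ a, ∀ j ∈ J C ⊔ J D, a * j ∈ J C ⊔ J D := by
    intro a j hj
    obtain ⟨x, hx, y, hy, rfl⟩ := Submodule.mem_sup.1 hj
    rw [mul_add]
    exact add_mem (Submodule.mem_sup_left fun t ht => by rw [map_mul, hx t ht, mul_zero])
      (Submodule.mem_sup_right fun t ht => by rw [map_mul, hy t ht, mul_zero])
  have hr : ∀ a, ∀ j ∈ J C ⊔ J D, j * a ∈ J C ⊔ J D := by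
    intro a j hj
    obtain ⟨x, hx, y, hy, rfl⟩ := Submodule.mem_sup.1 hj
    rw [add_mul]
    exact add_mem (Submodule.mem_sup_left fun t ht => by rw [map_mul, hx t ht, zero_mul])
      (Submodule.mem_sup_right fun t ht => by rw [map_mul, hy t ht, zero_mul])
  -- Every point avoids C or D, so some bump in one of the two ideals is nonzero there.
  -- Approximating a by x + y, with x zero on C and y zero on D, makes y a cutoff of a up to its
  -- norm.
  have htop : (J C ⊔ J D).topologicalClosure = ⊤ := by
    refine hρ.eq_top (Submodule.isClosed_topologicalClosure _)
      (fun a j hj => map_mem_closure (continuous_const_mul a) hj (hl a))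
      (fun a j hj => map_mem_closure (f := fun x => x * a) (continuous_mul_const a) hj (hr a)) fun t => ?_
    by_cases ht : t ∈ C
    · obtain ⟨b, hb, hb'⟩ := hρ.exists_bump t Dᶜ hD.isOpen_compl
        (fun h => Set.disjoint_left.1 hCD ht h)
      exact ⟨b, Submodule.le_topologicalClosure _ (Submodule.mem_sup_right fun s hs =>
        hb' s (not_not.2 hs)), hb⟩
    · obtain ⟨b, hb, hb'⟩ := hρ.exists_bump t Cᶜ hC.isOpen_compl ht
      exact ⟨b, Submodule.le_topologicalClosure _ (Submodule.mem_sup_left fun s hs =>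
        hb' s (not_not.2 hs)), hb⟩
  have hmem : a ∈ closure ((J C ⊔ J D : Submodule ℂ A) : Set A) := by
    have : a ∈ (J C ⊔ J D).topologicalClosure := htop ▸ Submodule.mem_top
    exact this
  obtain ⟨b, hb, hab⟩ := Metric.mem_closure_iff.1 hmem (ε / 2) (by positivity)
  obtain ⟨x, hx, y, hy, rfl⟩ := Submodule.mem_sup.1 hb
  set y' : A := (2⁻¹ : ℂ) • (y + star y) with hy'
  have hy'sa : IsSelfAdjoint y' := by
    rw [IsSelfAdjoint, hy', star_smul, (IsSelfAdjoint.add_star_self y).star_eq]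
    simp
  have hyD : ∀ t ∈ D, (ρ t).rep y' = 0 := by
    intro t ht
    rw [hy', map_smul, map_add, map_star, hy t ht, star_zero, add_zero, smul_zero]
  have hyC : ∀ t ∈ C, ‖(ρ t).rep y' - (ρ t).rep a‖ ≤ ε / 2 := by
    intro t ht
    have h1 : (ρ t).rep y' - (ρ t).rep a = (ρ t).rep ((2⁻¹ : ℂ) • ((y - a) + star (y - a))) := by
      rw [← map_sub, hy', star_sub, ha.star_eq]
      congr 1
      module
    have h2 : ‖(ρ t).rep (y - a)‖ ≤ ε / 2 := by
      have : (ρ t).rep (y - a) = (ρ t).rep (x + y - a) := by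
        rw [map_sub, map_sub, map_add, hx t ht, zero_add]
      rw [this]
      refine (norm_rep_le t _).trans ?_
      rw [← dist_eq_norm, dist_comm]
      exact hab.le
    rw [h1, map_smul, map_add, map_star, norm_smul]
    have h3 := norm_add_le ((ρ t).rep (y - a)) (star ((ρ t).rep (y - a)))
    rw [norm_star] at h3
    have : ‖(2⁻¹ : ℂ)‖ = 2⁻¹ := by norm_num
    rw [this]
    linarith
  -- Clamping y' to the level ‖a‖ restores the norm bound, keeps the zeros on D, and moves y' by at
  -- most ε/2 on C, where it is already close to a.
  refine ⟨y' - softThreshold ‖a‖ y', norm_sub_softThreshold_le (norm_nonneg _) hy'sa,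
    fun t ht => ?_, fun t ht => ?_⟩
  · rw [map_sub, map_softThreshold _ (norm_nonneg _) hy'sa, hyD t ht, zero_sub, neg_eq_zero,
      softThreshold_eq_zero_iff (norm_nonneg _) (IsSelfAdjoint.zero _)]
    simp
  · have h1 : ‖(ρ t).rep y'‖ ≤ ‖a‖ + ε / 2 := by
      have h2 := norm_add_le ((ρ t).rep y' - (ρ t).rep a) ((ρ t).rep a)
      rw [sub_add_cancel] at h2
      linarith [hyC t ht, norm_rep_le (ρ := ρ) t a]
    have h2 := norm_softThreshold_le (norm_nonneg a) (by positivity) (hy'sa.map (ρ t).rep) h1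
    rw [map_sub, map_softThreshold _ (norm_nonneg _) hy'sa, sub_right_comm]
    refine (norm_sub_le _ _).trans ?_
    linarith [hyC t ht]

/-- Slice Nf into layers: f is the average of the N functions wₖ = min(Nf, k+1) − min(Nf, k), each
zero where Nf ≤ k and one where Nf ≥ k + 1. Replace wₖa by a cutoff cₖ of a between these two closed
sets. At a given point at most one layer, k = ⌊Nf⌋, is in transition, and its error 2‖a‖ is divided
by N. -/
theorem exists_approx_smul (hρ : IsSpectralField ρ) (f : C(I, ℝ)) (hf : ∀ t, f t ∈ Set.Icc 0 1)
    {a : A} (ha : IsSelfAdjoint a) {ε : ℝ} (hε : 0 < ε) :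
    ∃ b : A, ∀ t, ‖(ρ t).rep b - (f t : ℂ) • (ρ t).rep a‖ ≤ ε := by
  obtain ⟨N, hN⟩ := exists_nat_gt (4 * (‖a‖ + 1) / ε)
  have hN0 : (0 : ℝ) < N := lt_of_le_of_lt (by positivity) hN
  have hcut : ∀ k : ℕ, ∃ c : A, ‖c‖ ≤ ‖a‖ ∧ (∀ t ∈ {t | N * f t ≤ k}, (ρ t).rep c = 0) ∧
      ∀ t ∈ {t | (k : ℝ) + 1 ≤ N * f t}, ‖(ρ t).rep c - (ρ t).rep a‖ ≤ ε / 2 := fun k =>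
    hρ.exists_cutoff (isClosed_le (by fun_prop) (by fun_prop))
      (isClosed_le (by fun_prop) (by fun_prop)) (Set.disjoint_left.2 fun t h1 h2 => by
        have h3 : (k : ℝ) + 1 ≤ N * f t := h1
        have h4 : (N : ℝ) * f t ≤ k := h2
        linarith) ha (by positivity)
  choose c hcn hc0 hc1 using hcut
  refine ⟨((N : ℂ)⁻¹) • ∑ k ∈ Finset.range N, c k, fun t => ?_⟩
  obtain ⟨hf0, hf1⟩ := hf t
  set x : ℝ := N * f t with hx
  have hx0 : 0 ≤ x := by positivity
  have hxN : x ≤ N := mul_le_of_le_one_right hN0.le hf1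
  let w : ℕ → ℝ := fun k => min x ((k : ℝ) + 1) - min x k
  have hw : ∑ k ∈ Finset.range N, w k = x := by
    have := Finset.sum_range_sub (fun k : ℕ => min x (k : ℝ)) N
    simp only [Nat.cast_add, Nat.cast_one] at this
    rw [this, min_eq_left hxN]
    simp [hx0]
  have hna := norm_rep_le (ρ := ρ) t a
  have hterm : ∀ k : ℕ, ‖(ρ t).rep (c k) - (w k : ℂ) • (ρ t).rep a‖ ≤
      ε / 2 + if k = ⌊x⌋₊ then 2 * ‖a‖ else 0 := by
    intro k
    have h0 : (0 : ℝ) ≤ if k = ⌊x⌋₊ then 2 * ‖a‖ else 0 := by split_ifs <;> positivity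
    rcases le_or_gt x k with hk | hk
    · have hwk : w k = 0 := by simp only [w]; rw [min_eq_left hk, min_eq_left (by linarith)]; simp
      rw [hc0 k t hk, hwk]
      simp
      positivity
    rcases le_or_gt ((k : ℝ) + 1) x with hk1 | hk1
    · have hwk : w k = 1 := by simp only [w]; rw [min_eq_right hk.le, min_eq_right hk1]; simp
      rw [hwk, Complex.ofReal_one, one_smul]
      exact (hc1 k t hk1).trans (by linarith)
    · have hkf : k = ⌊x⌋₊ := ((Nat.floor_eq_iff hx0).2 ⟨hk.le, hk1⟩).symm
      rw [if_pos hkf]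
      have hwk : |w k| ≤ 1 := by
        simp only [w]
        rw [min_eq_left hk1.le, min_eq_right hk.le, abs_le]
        constructor <;> linarith
      have h5 : ‖(w k : ℂ) • (ρ t).rep a‖ ≤ 1 * ‖a‖ := by
        rw [norm_smul, Complex.norm_real, Real.norm_eq_abs]
        gcongr
      refine (norm_sub_le _ _).trans ?_
      linarith [(norm_rep_le (ρ := ρ) t (c k)).trans (hcn k)]
  have hfx : (f t : ℂ) = (N : ℂ)⁻¹ * (x : ℂ) := by
    have : (N : ℂ) ≠ 0 := by exact_mod_cast hN0.ne'
    rw [hx]; push_cast; field_simp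
  have hsum : (ρ t).rep ((N : ℂ)⁻¹ • ∑ k ∈ Finset.range N, c k) - (f t : ℂ) • (ρ t).rep a
      = (N : ℂ)⁻¹ • ∑ k ∈ Finset.range N, ((ρ t).rep (c k) - (w k : ℂ) • (ρ t).rep a) := by
    rw [map_smul, map_sum, Finset.sum_sub_distrib, smul_sub, ← Finset.sum_smul, hfx, mul_smul]
    congr 3
    rw [← hw]; push_cast; rfl
  rw [hsum, norm_smul, norm_inv, Complex.norm_natCast, inv_mul_le_iff₀ hN0]
  refine (norm_sum_le _ _).trans ((Finset.sum_le_sum fun k _ => hterm k).trans ?_)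
  rw [Finset.sum_add_distrib, Finset.sum_const, Finset.card_range, nsmul_eq_mul,
    Finset.sum_ite_eq']
  have h6 : (if ⌊x⌋₊ ∈ Finset.range N then 2 * ‖a‖ else 0) ≤ 2 * ‖a‖ := by
    split_ifs
    · exact le_rfl
    · positivity
  rw [div_lt_iff₀ hε] at hN
  linarith [norm_nonneg a]

/-- The continuous functions on the spectrum act on the algebra (Dauns–Hofmann). -/
theorem exists_smul (hρ : IsSpectralField ρ) (f : C(I, ℂ)) (a : A) :
    ∃ b : A, ∀ t, (ρ t).rep b = f t • (ρ t).rep a := by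
  have h1 : ∀ f : C(I, ℝ), (∀ t, f t ∈ Set.Icc 0 1) → ∀ a : A, IsSelfAdjoint a →
      ∃ b : A, ∀ t, (ρ t).rep b = (f t : ℂ) • (ρ t).rep a := fun f hf a ha =>
    hρ.exists_of_approx _ fun ε hε => hρ.exists_approx_smul f hf ha hε
  have h2 : ∀ f : C(I, ℝ), ∀ a : A, IsSelfAdjoint a →
      ∃ b : A, ∀ t, (ρ t).rep b = (f t : ℂ) • (ρ t).rep a := by
    intro f a ha
    have hR : (0 : ℝ) < 2 * (‖f‖ + 1) := by positivity
    -- An affine change brings f into [0,1]; the summand 1 keeps the denominator positive when f =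
    -- 0.
    let g : C(I, ℝ) := ⟨fun t => (f t + (‖f‖ + 1)) / (2 * (‖f‖ + 1)), by fun_prop⟩
    obtain ⟨b, hb⟩ := h1 g (fun t => by
      have := abs_le.1 (f.norm_coe_le_norm t)
      constructor
      · exact div_nonneg (by linarith) hR.le
      · exact (div_le_one hR).2 (by linarith)) a ha
    refine ⟨((2 * (‖f‖ + 1) : ℝ) : ℂ) • b - ((‖f‖ + 1 : ℝ) : ℂ) • a, fun t => ?_⟩
    rw [map_sub, map_smul, map_smul, hb, smul_smul, ← sub_smul]
    congr 1
    have : f t = 2 * (‖f‖ + 1) * g t - (‖f‖ + 1) := by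
      simp only [g, ContinuousMap.coe_mk]
      field_simp
      ring
    rw [this]; push_cast; ring
  have h3 : ∀ f : C(I, ℝ), ∀ a : A, ∃ b : A, ∀ t, (ρ t).rep b = (f t : ℂ) • (ρ t).rep a := by
    intro f a
    obtain ⟨b, hb⟩ := h2 f _ (realPart a).2
    obtain ⟨c, hc⟩ := h2 f _ (imaginaryPart a).2
    refine ⟨b + Complex.I • c, fun t => ?_⟩
    conv_rhs => rw [← realPart_add_I_smul_imaginaryPart a]
    rw [map_add, map_add, map_smul, map_smul, hb, hc, smul_add, smul_comm]
  obtain ⟨b, hb⟩ := h3 ⟨fun t => (f t).re, by fun_prop⟩ a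
  obtain ⟨c, hc⟩ := h3 ⟨fun t => (f t).im, by fun_prop⟩ a
  refine ⟨b + Complex.I • c, fun t => ?_⟩
  rw [map_add, map_smul, hb, hc, smul_smul, ← add_smul]
  congr 1
  simp only [ContinuousMap.coe_mk]
  rw [mul_comm, Complex.re_add_im]

end IsSpectralField

/-! ### A global projection of rank one -/

section RankOne

variable {H : Type*} [NormedAddCommGroup H] [InnerProductSpace ℂ H] [CompleteSpace H]

/-- The operator `T` has range contained in a line. -/
def HasLineRange (T : H →L[ℂ] H) : Prop := ∃ u : H, ∀ x, ∃ z : ℂ, T x = z • u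

/-- A self-adjoint operator with range in the line of the unit vector v is r|v⟩⟨v| with r = ⟨v, Tv⟩,
and positivity decides the sign of r. -/
theorem HasLineRange.exists_eq {T : H →L[ℂ] H} (hT : HasLineRange T) (hsa : IsSelfAdjoint T)
    (hpos : ∀ x, 0 ≤ (⟪x, T x⟫_ℂ).re) (h0 : T ≠ 0) :
    ∃ (v : H) (r : ℝ), ‖v‖ = 1 ∧ 0 < r ∧ ‖T‖ ≤ r ∧ ∀ x, T x = ((r : ℂ) * ⟪v, x⟫_ℂ) • v := by
  obtain ⟨u, hu⟩ := hT
  have hu0 : u ≠ 0 := by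
    rintro rfl
    apply h0
    ext x
    obtain ⟨z, hz⟩ := hu x
    simp [hz]
  have hun : (‖u‖ : ℂ) ≠ 0 := by exact_mod_cast norm_ne_zero_iff.2 hu0
  set v : H := (‖u‖ : ℂ)⁻¹ • u with hv
  have hv1 : ‖v‖ = 1 := by
    rw [hv, norm_smul, norm_inv, Complex.norm_real, norm_norm, inv_mul_cancel₀ (norm_ne_zero_iff.2 hu0)]
  have hvv : ⟪v, v⟫_ℂ = 1 := by rw [inner_self_eq_norm_sq_to_K, hv1]; simp
  have hsymm : ∀ x y, ⟪T x, y⟫_ℂ = ⟪x, T y⟫_ℂ := fun x y => by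
    rw [← ContinuousLinearMap.adjoint_inner_right, ← ContinuousLinearMap.star_eq_adjoint, hsa.star_eq]
  have h1 : ∀ x, T x = ⟪v, T x⟫_ℂ • v := by
    intro x
    obtain ⟨z, hz⟩ := hu x
    have : T x = (z * ‖u‖) • v := by
      rw [hz, hv, smul_smul, mul_assoc, mul_inv_cancel₀ hun, mul_one]
    conv_rhs => rw [this, inner_smul_right, hvv, mul_one]
    exact this
  have hre : (starRingEnd ℂ) ⟪v, T v⟫_ℂ = ⟪v, T v⟫_ℂ := by rw [inner_conj_symm, hsymm]
  have hr : (((⟪v, T v⟫_ℂ).re : ℝ) : ℂ) = ⟪v, T v⟫_ℂ := Complex.conj_eq_iff_re.1 hre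
  have h2 : ∀ x, T x = (((⟪v, T v⟫_ℂ).re : ℝ) * ⟪v, x⟫_ℂ) • v := by
    intro x
    conv_lhs => rw [h1 x, ← hsymm, h1 v, inner_smul_left, hre]
    rw [hr]
  have hne : (⟪v, T v⟫_ℂ).re ≠ 0 := by
    intro h
    apply h0
    ext x
    rw [h2, h]; simp
  refine ⟨v, _, hv1, lt_of_le_of_ne (hpos v) hne.symm, ?_, h2⟩
  refine ContinuousLinearMap.opNorm_le_bound _ (hpos v) fun x => ?_
  rw [h2 x, norm_smul, norm_mul, hv1, Complex.norm_real, Real.norm_of_nonneg (hpos v), mul_one]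
  gcongr
  · exact hpos v
  · simpa [hv1] using norm_inner_le_norm (𝕜 := ℂ) v x

end RankOne

section Field

variable {A : Type u} [NonUnitalCStarAlgebra A] {ρ : I → IrrepOf A}

/-- A positive field of operators of rank at most one that does not vanish on `S`. -/
structure IsRankOneOn (ρ : I → IrrepOf A) (c : A) (S : Set I) : Prop where
  isSelfAdjoint : IsSelfAdjoint c
  nonneg (t : I) (x : (ρ t).H) : 0 ≤ (⟪x, (ρ t).rep c x⟫_ℂ).re
  hasLineRange (t : I) : HasLineRange ((ρ t).rep c)
  ne_zero (t : I) (ht : t ∈ S) : (ρ t).rep c ≠ 0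

theorem IsRankOneOn.mono {c : A} {S S' : Set I} (h : IsRankOneOn ρ c S) (hS : S' ⊆ S) :
    IsRankOneOn ρ c S' :=
  ⟨h.1, h.2, h.3, fun t ht => h.4 t (hS ht)⟩

theorem IrrepOf.inner_rep_star {A : Type u} [NonUnitalRing A] [StarRing A] [Module ℂ A]
    (ρ : IrrepOf A) (a : A) (x y : ρ.H) :
    ⟪x, ρ.rep (star a) y⟫_ℂ = ⟪ρ.rep a x, y⟫_ℂ := by
  rw [map_star, ContinuousLinearMap.star_eq_adjoint, ContinuousLinearMap.adjoint_inner_right]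

theorem re_inner_mul_star (ρ : IrrepOf A) (a : A) (x : ρ.H) :
    (⟪x, ρ.rep (a * star a) x⟫_ℂ).re = ‖ρ.rep (star a) x‖ ^ 2 := by
  have h : ⟪x, ρ.rep (a * star a) x⟫_ℂ = ⟪ρ.rep (star a) x, ρ.rep (star a) x⟫_ℂ := by
    rw [map_mul, mul_apply_eq_comp, ← ρ.inner_rep_star (star a), star_star]
  rw [h, inner_self_eq_norm_sq_to_K]
  norm_cast

/-- The local projection a is controlled only on V. Multiplying it by a bump function supported in V
gives an element e that is zero elsewhere, so ee* has rank at most one at every point of the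
interval. -/
theorem IsSpectralField.exists_isRankOneOn_nhds (hρ : IsSpectralField ρ) (t₀ : I) :
    ∃ U : Set I, IsOpen U ∧ t₀ ∈ U ∧ ∃ d : A, IsRankOneOn ρ d U := by
  obtain ⟨V, hV, a, ha⟩ := hρ.exists_rank_one t₀
  obtain ⟨r, hr, hball⟩ := Metric.mem_nhds_iff.1 hV
  let f : C(I, ℂ) := ⟨fun t => ((max 0 (r - dist t t₀) : ℝ) : ℂ), by fun_prop⟩
  have hf0 : ∀ t, t ∉ V → f t = 0 := by
    intro t ht
    have : r ≤ dist t t₀ := by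
      by_contra! h
      exact ht (hball h)
    simp [f, this]
  obtain ⟨e, he⟩ := hρ.exists_smul f a
  refine ⟨Metric.ball t₀ r, Metric.isOpen_ball, Metric.mem_ball_self hr, e * star e,
    IsSelfAdjoint.mul_star_self e, fun t x => ?_, fun t => ?_, fun t ht => ?_⟩
  · rw [re_inner_mul_star]; positivity
  · by_cases ht : t ∈ V
    · obtain ⟨-, h1⟩ := ha t ht
      obtain ⟨⟨_, u, rfl⟩, -, hu⟩ := finrank_eq_one_iff'.1 h1
      refine ⟨(ρ t).rep a u, fun x => ?_⟩
      obtain ⟨z, hz⟩ := hu ⟨(ρ t).rep a ((ρ t).rep (star e) x), _, rfl⟩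
      refine ⟨f t * z, ?_⟩
      have hz' : z • (ρ t).rep a u = (ρ t).rep a ((ρ t).rep (star e) x) := congrArg Subtype.val hz
      rw [map_mul, mul_apply_eq_comp, he, smul_apply, ← hz', smul_smul]
    · exact ⟨0, fun x => ⟨0, by rw [map_mul, he, hf0 t ht]; simp⟩⟩
  · have hft : f t ≠ 0 := by
      have : 0 < r - dist t t₀ := sub_pos.2 ht
      simp only [f, ContinuousMap.coe_mk]
      exact_mod_cast (lt_max_of_lt_right this).ne'
    have hat : (ρ t).rep a ≠ 0 := by
      intro h0
      have := (ha t (hball ht)).2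
      rw [h0, ContinuousLinearMap.toLinearMap_zero, LinearMap.range_zero, finrank_bot] at this
      omega
    rw [map_mul, map_star]
    intro h0
    rw [CStarRing.mul_star_self_eq_zero_iff, he] at h0
    rcases smul_eq_zero.1 h0 with h | h
    · exact hft h
    · exact hat h

/-- A rank-one field can be perturbed so that its range is not orthogonal to that of another one
at a given point. -/
theorem IsRankOneOn.exists_mul_ne_zero {c d : A} {S T : Set I} (hc : IsRankOneOn ρ c S)
    (hd : IsRankOneOn ρ d T) {s : I} (hsS : s ∈ S) (hsT : s ∈ T) :
    ∃ d', IsRankOneOn ρ d' T ∧ (ρ s).rep (d' * c) ≠ 0 := by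
  by_cases h : (ρ s).rep (d * c) = 0
  swap
  · exact ⟨d, hd, h⟩
  obtain ⟨m, hm⟩ := (ρ s).exists_mul_mul_ne_zero (hc.ne_zero s hsS) (hd.ne_zero s hsT)
  -- This makes ‖τm‖ < 1, so k = 1 + τm is invertible in every fibre and kdk* vanishes exactly where
  -- d does. At s, ck d = cd + τcmd = τcmd ≠ 0. The element d' is kdk* written out, since A need not
  -- have a unit.
  set τ : ℝ := (‖m‖ + 1)⁻¹ with hτ
  have hτ0 : 0 < τ := by positivity
  let k : ∀ t, (ρ t).H →L[ℂ] (ρ t).H := fun t => 1 + (τ : ℂ) • (ρ t).rep m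
  have hk : ∀ t, IsUnit (k t) := by
    intro t
    have : ‖-((τ : ℂ) • (ρ t).rep m)‖ < 1 := by
      rw [norm_neg, norm_smul, Complex.norm_real, Real.norm_of_nonneg hτ0.le, hτ,
        inv_mul_lt_iff₀ (by positivity)]
      linarith [IsSpectralField.norm_rep_le (ρ := ρ) t m]
    have h2 := isUnit_one_sub_of_norm_lt_one this
    rwa [sub_neg_eq_add] at h2
  let d' : A := d + (τ : ℂ) • (m * d) + (τ : ℂ) • (d * star m) + ((τ : ℂ) * τ) • (m * d * star m)
  have hd' : ∀ t, (ρ t).rep d' = k t * (ρ t).rep d * star (k t) := by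
    intro t
    simp only [d', k, map_add, map_smul, map_mul, map_star, star_add, star_one, star_smul,
      Complex.star_def, Complex.conj_ofReal, add_mul, mul_add, one_mul, mul_one, smul_mul_assoc,
      mul_smul_comm]
    rw [smul_add, smul_smul]
    abel
  refine ⟨d', ⟨?_, fun t x => ?_, fun t => ?_, fun t ht h0 => ?_⟩, fun h0 => ?_⟩
  · simp only [d', IsSelfAdjoint, star_add, star_smul, star_mul, star_star, hd.isSelfAdjoint.star_eq,
      Complex.star_def, Complex.conj_ofReal, mul_assoc]
    abel
  · rw [hd', mul_apply_eq_comp, mul_apply_eq_comp, ← ContinuousLinearMap.adjoint_inner_left,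
      ← ContinuousLinearMap.star_eq_adjoint]
    exact hd.nonneg t _
  · obtain ⟨u, hu⟩ := hd.hasLineRange t
    refine ⟨k t u, fun x => ?_⟩
    obtain ⟨z, hz⟩ := hu (star (k t) x)
    exact ⟨z, by rw [hd', mul_apply_eq_comp, mul_apply_eq_comp, hz, map_smul]⟩
  · rw [hd'] at h0
    rw [(hk t).star.mul_left_eq_zero, (hk t).mul_right_eq_zero] at h0
    exact hd.ne_zero t ht h0
  · have h1 : (ρ s).rep (c * d') = 0 := by
      have := congrArg star h0
      have hd'sa : star d' = d' := by
        simp only [d', star_add, star_smul, star_mul, star_star, hd.isSelfAdjoint.star_eq,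
          Complex.star_def, Complex.conj_ofReal, mul_assoc]
        abel
      rwa [← map_star, star_mul, hd'sa, hc.isSelfAdjoint.star_eq, star_zero] at this
    have h2 : (ρ s).rep (c * d) = 0 := by
      have := congrArg star h
      rwa [← map_star, star_mul, hd.isSelfAdjoint.star_eq, hc.isSelfAdjoint.star_eq, star_zero]
        at this
    rw [map_mul, hd', ← mul_assoc, (hk s).star.mul_left_eq_zero, ← mul_assoc] at h1
    simp only [k] at h1
    rw [mul_add, mul_one, add_mul, ← map_mul, h2, zero_add, mul_smul_comm, smul_mul_assoc,
      ← map_mul, ← map_mul] at h1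
    rcases smul_eq_zero.1 h1 with h3 | h3
    · exact hτ0.ne' (by exact_mod_cast h3)
    · exact hm h3

/-- After perturbing d so that dc ≠ 0 at s, hence on some [s, s + ε], the line of c is rotated into
that of d by x = αc + βdc. Before s + ε its range lies in the image of the line of c under α + βd;
from s + ε on only multiples of d remain. The element xx* + e₃e₃* is positive, has rank at most one
everywhere, and vanishes only where both x and e₃ do. -/
theorem IsRankOneOn.glue (hρ : IsSpectralField ρ) {c d : A} {s s' : I} (hss : s ≤ s')
    (hc : IsRankOneOn ρ c (Set.Iic s)) (hd : IsRankOneOn ρ d (Set.Icc s s')) :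
    ∃ c', IsRankOneOn ρ c' (Set.Iic s') := by
  obtain ⟨d, hd, hdc⟩ := hc.exists_mul_ne_zero hd (s := s) (Set.mem_Iic.2 le_rfl) ⟨le_rfl, hss⟩
  obtain ⟨r, hr, hball⟩ := Metric.isOpen_iff.1 (hρ.isOpen_ne (d * c)) s hdc
  set ε := r / 2 with hε
  have hε0 : 0 < ε := by positivity
  have hdcε : ∀ t : I, (s : ℝ) ≤ t → (t : ℝ) ≤ s + ε → (ρ t).rep (d * c) ≠ 0 := by
    intro t h1 h2
    refine hball ?_
    rw [Metric.mem_ball, Subtype.dist_eq, Real.dist_eq, abs_of_nonneg (by linarith)]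
    linarith
  -- α is one up to s and zero from s + ε on, β is positive exactly after s, and μ exactly after s +
  -- ε. Thus μ starts only when c has disappeared, and the rank never exceeds one.
  let α : I → ℝ := fun t => max 0 (min 1 (1 - (t - s) / ε))
  let β : I → ℝ := fun t => max 0 (t - s)
  let μ : I → ℝ := fun t => max 0 (t - s - ε)
  obtain ⟨e₁, he₁⟩ := hρ.exists_smul ⟨fun t => (α t : ℂ), by fun_prop⟩ c
  obtain ⟨e₂, he₂⟩ := hρ.exists_smul ⟨fun t => (β t : ℂ), by fun_prop⟩ (d * c)
  obtain ⟨e₃, he₃⟩ := hρ.exists_smul ⟨fun t => (μ t : ℂ), by fun_prop⟩ d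
  simp only [ContinuousMap.coe_mk] at he₁ he₂ he₃
  set x := e₁ + e₂ with hx
  have hrx : ∀ t, (ρ t).rep x = (α t : ℂ) • (ρ t).rep c + (β t : ℂ) • (ρ t).rep (d * c) := fun t => by
    rw [hx, map_add, he₁, he₂]
  have hpos : ∀ t v, (⟪v, (ρ t).rep (x * star x + e₃ * star e₃) v⟫_ℂ).re
      = ‖(ρ t).rep (star x) v‖ ^ 2 + ‖(ρ t).rep (star e₃) v‖ ^ 2 := by
    intro t v
    rw [map_add, add_apply, inner_add_right, Complex.add_re, re_inner_mul_star, re_inner_mul_star]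
  have hsymm : ∀ t v w, ⟪(ρ t).rep c v, w⟫_ℂ = ⟪v, (ρ t).rep c w⟫_ℂ := fun t v w => by
    rw [← IrrepOf.inner_rep_star, hc.isSelfAdjoint.star_eq]
  have hα0 : ∀ t : I, (s : ℝ) + ε ≤ t → α t = 0 := by
    intro t ht
    have : 1 ≤ ((t : ℝ) - s) / ε := (one_le_div hε0).2 (by linarith)
    simp only [α]
    rw [max_eq_left]
    exact (min_le_right _ _).trans (by linarith)
  have hαpos : ∀ t : I, (t : ℝ) < s + ε → 0 < α t := by
    intro t ht
    have : ((t : ℝ) - s) / ε < 1 := (div_lt_one hε0).2 (by linarith)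
    exact lt_max_of_lt_right (lt_min one_pos (by linarith))
  refine ⟨x * star x + e₃ * star e₃, (IsSelfAdjoint.mul_star_self x).add (IsSelfAdjoint.mul_star_self e₃),
    fun t v => by rw [hpos]; positivity, fun t => ?_, fun t ht h0 => ?_⟩
  · rcases lt_or_ge (t : ℝ) (s + ε) with hts | hts
    · obtain ⟨u, hu⟩ := hc.hasLineRange t
      have hμ : μ t = 0 := max_eq_left (by linarith)
      refine ⟨(α t : ℂ) • u + (β t : ℂ) • (ρ t).rep d u, fun y => ?_⟩
      obtain ⟨z, hz⟩ := hu ((ρ t).rep (star x) y)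
      refine ⟨z, ?_⟩
      rw [map_add, map_mul, map_mul, he₃, hμ, Complex.ofReal_zero, zero_smul, zero_mul, add_zero, mul_apply_eq_comp,
        hrx, add_apply, smul_apply, smul_apply, map_mul, mul_apply_eq_comp, hz, map_smul, smul_add,
        smul_comm z, smul_comm z]
    · obtain ⟨u, hu⟩ := hd.hasLineRange t
      refine ⟨u, fun y => ?_⟩
      obtain ⟨z₁, hz₁⟩ := hu ((ρ t).rep c ((ρ t).rep (star x) y))
      obtain ⟨z₂, hz₂⟩ := hu ((ρ t).rep (star e₃) y)
      refine ⟨β t * z₁ + μ t * z₂, ?_⟩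
      rw [map_add, map_mul, map_mul, add_apply, mul_apply_eq_comp, mul_apply_eq_comp, hrx, he₃, hα0 t hts,
        Complex.ofReal_zero, zero_smul, zero_add, smul_apply, smul_apply, map_mul, mul_apply_eq_comp,
        hz₁, hz₂, smul_smul, smul_smul, add_smul]
  · have hzero : ∀ v, ‖(ρ t).rep (star x) v‖ ^ 2 + ‖(ρ t).rep (star e₃) v‖ ^ 2 = 0 := fun v => by
      rw [← hpos, h0]; simp
    have hx0 : (ρ t).rep x = 0 := by
      rw [← star_eq_zero, ← map_star]
      ext v
      have := hzero v
      have h2 : ‖(ρ t).rep (star x) v‖ ^ 2 = 0 := by nlinarith [sq_nonneg ‖(ρ t).rep (star x) v‖, sq_nonneg ‖(ρ t).rep (star e₃) v‖]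
      simpa using h2
    have he0 : (ρ t).rep e₃ = 0 := by
      rw [← star_eq_zero, ← map_star]
      ext v
      have := hzero v
      have h2 : ‖(ρ t).rep (star e₃) v‖ ^ 2 = 0 := by nlinarith [sq_nonneg ‖(ρ t).rep (star x) v‖, sq_nonneg ‖(ρ t).rep (star e₃) v‖]
      simpa using h2
    rcases lt_or_ge (t : ℝ) (s + ε) with hts | hts
    · have hct : (ρ t).rep c ≠ 0 := by
        rcases le_total t s with h | h
        · exact hc.ne_zero t h
        · intro h1
          apply hdcε t h hts.le
          rw [map_mul, h1, mul_zero]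
      apply hct
      ext v
      -- The real part of ⟨cv, xv⟩ is α‖cv‖² plus a term that is nonnegative because d is positive.
      -- No cancellation between αc and βdc is possible.
      have h1 : ⟪(ρ t).rep c v, (ρ t).rep x v⟫_ℂ = 0 := by rw [hx0]; simp
      rw [hrx, add_apply, inner_add_right, smul_apply, smul_apply, inner_smul_right,
        inner_smul_right, map_mul, mul_apply_eq_comp] at h1
      have h2 := congrArg Complex.re h1
      rw [Complex.add_re, Complex.re_ofReal_mul, Complex.re_ofReal_mul, inner_self_eq_norm_sq_to_K]
        at h2
      have h3 : (((‖(ρ t).rep c v‖ : ℂ)) ^ 2).re = ‖(ρ t).rep c v‖ ^ 2 := by norm_cast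
      have h4 := hd.nonneg t ((ρ t).rep c v)
      have h5 := mul_nonneg (le_max_left 0 ((t : ℝ) - s)) h4
      simp only [Complex.coe_algebraMap, Complex.zero_re] at h2
      rw [h3] at h2
      have h6 : α t * ‖(ρ t).rep c v‖ ^ 2 = 0 := le_antisymm (by linarith) (mul_nonneg (hαpos t hts).le (sq_nonneg _))
      rcases mul_eq_zero.1 h6 with h7 | h7
      · exact absurd h7 (hαpos t hts).ne'
      · simpa using h7
    -- At s + ε itself both α and μ are zero, and nonvanishing comes from βdc; beyond that point it
    -- comes from μd.
    · rcases hts.eq_or_lt with hts' | hts'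
      · rw [hrx, hα0 t hts, Complex.ofReal_zero, zero_smul, zero_add] at hx0
        rcases smul_eq_zero.1 hx0 with h | h
        · have : 0 < β t := lt_max_of_lt_right (by linarith)
          exact this.ne' (by exact_mod_cast h)
        · exact hdcε t (by linarith) hts'.ge h
      · rw [he₃] at he0
        rcases smul_eq_zero.1 he0 with h | h
        · have : 0 < μ t := lt_max_of_lt_right (by linarith)
          exact this.ne' (by exact_mod_cast h)
        · exact hd.ne_zero t ⟨Subtype.coe_le_coe.1 (by linarith), ht⟩ h

/-- Compactness gives a finite subdivision of the interval subordinate to the local fields, and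
gluing proceeds from left to right, one subinterval at a time. -/
theorem IsSpectralField.exists_isRankOneOn_univ (hρ : IsSpectralField ρ) :
    ∃ c, IsRankOneOn ρ c Set.univ := by
  choose U hUo hUm d hd using hρ.exists_isRankOneOn_nhds
  obtain ⟨t, ht0, htm, ⟨n, hn⟩, hcov⟩ := exists_monotone_Icc_subset_open_cover_unitInterval hUo
    (fun s _ => Set.mem_iUnion.2 ⟨s, hUm s⟩)
  have key : ∀ n, ∃ c, IsRankOneOn ρ c (Set.Iic (t n)) := by
    intro n
    induction n with
    | zero =>
      refine ⟨d 0, (hd 0).mono fun s hs => ?_⟩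
      have : s = 0 := le_antisymm (ht0 ▸ hs) s.2.1
      exact this ▸ hUm 0
    | succ n ih =>
      obtain ⟨c, hc⟩ := ih
      obtain ⟨i, hi⟩ := hcov n
      exact hc.glue hρ (htm n.le_succ) ((hd i).mono hi)
  obtain ⟨c, hc⟩ := key n
  refine ⟨c, hc.mono fun s _ => ?_⟩
  rw [Set.mem_Iic, hn n le_rfl]
  exact s.2.2

/-- There is a global projection of rank one. -/
theorem IsSpectralField.exists_rank_one_projection (hρ : IsSpectralField ρ) :
    ∃ (p : A) (v : ∀ t, (ρ t).H), (∀ t, ‖v t‖ = 1) ∧ ∀ t x, (ρ t).rep p x = ⟪v t, x⟫_ℂ • v t := by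
  obtain ⟨c, hc⟩ := hρ.exists_isRankOneOn_univ
  -- The nested open sets on which ‖ρ(c)‖ exceeds 1/(n+1) cover the compact interval, so one of them
  -- is everything.
  obtain ⟨δ, hδ, hcδ⟩ : ∃ δ > 0, ∀ t, δ < ‖(ρ t).rep c‖ := by
    have hdir : Directed (· ⊆ ·) fun n : ℕ => {t | 1 / ((n : ℝ) + 1) < ‖(ρ t).rep c‖} := by
      refine directed_of_isDirected_le fun m n hmn t ht => ?_
      have h1 : 1 / ((n : ℝ) + 1) ≤ 1 / ((m : ℝ) + 1) :=
        one_div_le_one_div_of_le (by positivity) (by gcongr)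
      exact lt_of_le_of_lt h1 ht
    obtain ⟨n, hn⟩ := isCompact_univ.elim_directed_cover _
      (fun n : ℕ => hρ.isOpen_lt_norm c (r := 1 / ((n : ℝ) + 1)) (by positivity))
      (fun t _ => Set.mem_iUnion.2 <| exists_nat_one_div_lt
        (norm_pos_iff.2 (hc.ne_zero t (Set.mem_univ t)))) hdir
    exact ⟨1 / ((n : ℝ) + 1), by positivity, fun t => hn (Set.mem_univ t)⟩
  choose v r hv hr hTr hT using fun t => (hc.hasLineRange t).exists_eq
    (hc.isSelfAdjoint.map (ρ t).rep) (hc.nonneg t) (hc.ne_zero t (Set.mem_univ t))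
  -- In each fibre the nonzero spectral value r satisfies r ≥ ‖ρ(c)‖ > δ, so `g` sends it to one and
  -- the positive rank-one operator to its range projection.
  let g : ℝ → ℝ := fun x => min (|x| / δ) 1
  have hg : Continuous g := by fun_prop
  have hg0 : g 0 = 0 := by simp [g]
  refine ⟨cfcₙ g c, v, hv, fun t x => ?_⟩
  have hsa : IsSelfAdjoint ((ρ t).rep c) := hc.isSelfAdjoint.map _
  set T := (ρ t).rep c with hTdef
  have hvv : ⟪v t, v t⟫_ℂ = 1 := by rw [inner_self_eq_norm_sq_to_K, hv]; simp
  have hT2 : T * T = r t • T := by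
    ext y
    rw [mul_apply_eq_comp, smul_apply, hT t (T y), hT t y, inner_smul_right, hvv, mul_one,
      ← Complex.coe_smul, smul_smul]
  -- The identity T² = rT passes through the functional calculus and confines the quasispectrum to
  -- {0, r}.
  have hspec : ∀ y ∈ quasispectrum ℝ T, y * y = r t * y := by
    have h1 : cfcₙ (fun y : ℝ => y * y) T = cfcₙ (fun y : ℝ => r t * y) T := by
      rw [cfcₙ_mul (fun y : ℝ => y) (fun y => y) T, cfcₙ_const_mul (r t) (fun y : ℝ => y) T,
        cfcₙ_id' ℝ T, hT2]
    exact (cfcₙ_eq_cfcₙ_iff_eqOn (R := ℝ) (a := T) (ha := hsa) (by fun_prop) (by simp) (by fun_prop) (by simp)).1 h1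
  have h2 : (ρ t).rep (cfcₙ g c) = (r t)⁻¹ • T := by
    rw [NonUnitalStarAlgHomClass.map_cfcₙ (ρ t).rep g c hg.continuousOn hg0
      (NonUnitalStarAlgHom.continuous_of_cstar _) hc.isSelfAdjoint hsa]
    have : (r t)⁻¹ • T = cfcₙ (fun y : ℝ => (r t)⁻¹ * y) T := by
      rw [cfcₙ_const_mul (r t)⁻¹ (fun y : ℝ => y) T, cfcₙ_id' ℝ T]
    rw [this]
    refine cfcₙ_congr fun y hy => ?_
    have h3 : y * (y - r t) = 0 := by linarith [hspec y hy, mul_sub y y (r t), mul_comm y (r t)]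
    rcases mul_eq_zero.1 h3 with h | h
    · simp [h, hg0]
    · have : y = r t := sub_eq_zero.1 h
      simp only [this, g]
      rw [abs_of_pos (hr t), inv_mul_cancel₀ (hr t).ne', min_eq_right]
      exact (one_le_div hδ).2 ((hcδ t).le.trans (hTr t))
  rw [h2, smul_apply, hT, ← Complex.coe_smul, smul_smul, ← mul_assoc]
  have : ((r t : ℝ) : ℂ) ≠ 0 := by exact_mod_cast (hr t).ne'
  rw [Complex.ofReal_inv, inv_mul_cancel₀ this, one_mul]

end Field

/-! ### Approximation by nonvanishing functions -/

theorem exists_polynomial_near (f : C(I, ℝ)) {ε : ℝ} (hε : 0 < ε) :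
    ∃ p : Polynomial ℝ, ∀ t : I, ‖p.eval (t : ℝ) - f t‖ ≤ ε := by
  obtain ⟨p, hp⟩ := exists_polynomial_near_of_continuousOn 0 1 (Set.IccExtend zero_le_one f)
    f.continuous.Icc_extend'.continuousOn ε hε
  refine ⟨p, fun t => ?_⟩
  have := hp t t.2
  rw [Set.IccExtend_val] at this
  exact this.le

theorem exists_contDiff_near (m : C(I, ℂ)) {ε : ℝ} (hε : 0 < ε) :
    ∃ F : ℝ → ℂ, ContDiff ℝ 1 F ∧ ∀ t : I, ‖F t - m t‖ ≤ ε := by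
  obtain ⟨p, hp⟩ := exists_polynomial_near ⟨fun t => (m t).re, by fun_prop⟩ (half_pos hε)
  obtain ⟨q, hq⟩ := exists_polynomial_near ⟨fun t => (m t).im, by fun_prop⟩ (half_pos hε)
  have hp' : ContDiff ℝ 1 fun x => p.eval x := by simpa using p.contDiff_aeval (𝕜 := ℝ) 1
  have hq' : ContDiff ℝ 1 fun x => q.eval x := by simpa using q.contDiff_aeval (𝕜 := ℝ) 1
  refine ⟨fun x => Complex.ofRealCLM (p.eval x) + Complex.I * Complex.ofRealCLM (q.eval x),
    (Complex.ofRealCLM.contDiff.comp hp').add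
      (contDiff_const.mul (Complex.ofRealCLM.contDiff.comp hq')), fun t => ?_⟩
  have h3 : ((p.eval (t : ℝ) : ℝ) : ℂ) + Complex.I * ((q.eval (t : ℝ) : ℝ) : ℂ) - m t
      = ((p.eval (t : ℝ) - (m t).re : ℝ) : ℂ) + Complex.I * ((q.eval (t : ℝ) - (m t).im : ℝ) : ℂ) := by
    conv_lhs => rw [← Complex.re_add_im (m t)]
    push_cast
    ring
  have h4 := norm_add_le ((p.eval (t : ℝ) - (m t).re : ℝ) : ℂ)
    (Complex.I * ((q.eval (t : ℝ) - (m t).im : ℝ) : ℂ))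
  rw [norm_mul, Complex.norm_I, one_mul, Complex.norm_real, Complex.norm_real, ← h3] at h4
  have h5 := hp t
  have h6 := hq t
  simp only [ContinuousMap.coe_mk] at h5 h6
  exact h4.trans (by linarith)

/-- A C¹ curve in the plane has an image with dense complement. Approximate m by such a curve and
subtract a small value it does not take. This is where the dimension of the interval matters. -/
theorem exists_nonvanishing_near (m : C(I, ℂ)) {ε : ℝ} (hε : 0 < ε) :
    ∃ m' : C(I, ℂ), (∀ t, m' t ≠ 0) ∧ ∀ t, ‖m' t - m t‖ ≤ ε := by
  obtain ⟨F, hF, hFm⟩ := exists_contDiff_near m (half_pos hε)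
  obtain ⟨z, hz, hzε⟩ := (hF.dense_compl_range_of_finrank_lt_finrank
    (by rw [Module.finrank_self, Complex.finrank_real_complex]; norm_num)).exists_dist_lt 0 (half_pos hε)
  rw [dist_zero_left] at hzε
  refine ⟨⟨fun t => F t - z, (hF.continuous.comp continuous_subtype_val).sub continuous_const⟩,
    fun t h => hz ⟨t, sub_eq_zero.1 h⟩, fun t => ?_⟩
  have h3 : F t - z - m t = (F t - m t) - z := by ring
  rw [ContinuousMap.coe_mk, h3]
  exact (norm_sub_le _ _).trans (by linarith [hFm t])

/-- If `F` vanishes wherever `g` does, then `F` is small wherever `g` is. -/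
theorem exists_pos_forall_lt {g : I → ℝ} (hg : Continuous g) (hg0 : ∀ t, 0 ≤ g t) {F : I → ℂ}
    (hF : Continuous F) (h : ∀ t, g t = 0 → F t = 0) {ε : ℝ} (hε : 0 < ε) :
    ∃ κ > 0, ∀ t, g t < κ → ‖F t‖ ≤ ε := by
  have hK : IsCompact {t | ε ≤ ‖F t‖} := (isClosed_le continuous_const hF.norm).isCompact
  rcases Set.eq_empty_or_nonempty {t | ε ≤ ‖F t‖} with h0 | h0
  · refine ⟨1, one_pos, fun t _ => ?_⟩
    by_contra! hlt
    have : t ∈ {t | ε ≤ ‖F t‖} := hlt.le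
    rw [h0] at this
    exact this
  · obtain ⟨s, hs, hmin⟩ := hK.exists_isMinOn h0 hg.continuousOn
    refine ⟨g s, lt_of_le_of_ne (hg0 s) fun h1 => ?_, fun t ht => ?_⟩
    · have h2 : ε ≤ ‖F s‖ := hs
      rw [h s h1.symm, norm_zero] at h2
      linarith
    · by_contra! hlt
      exact absurd (hmin (show t ∈ {t | ε ≤ ‖F t‖} from hlt.le)) (not_le.2 ht)

/-! ### Hilbert fields: generic sections and orthogonal frames -/

/-- A continuous field of Hilbert spaces over the unit interval, given by its space `E` of
continuous sections. -/
structure HilbertField (E : Type*) [NormedAddCommGroup E] [NormedSpace ℂ E] (H : I → Type*)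
    [∀ t, NormedAddCommGroup (H t)] [∀ t, InnerProductSpace ℂ (H t)] where
  /-- evaluation of a section at a point -/
  ev (t : I) : E →ₗ[ℂ] H t
  norm_ev_le (t : I) (ξ : E) : ‖ev t ξ‖ ≤ ‖ξ‖
  norm_le (ξ : E) (C : ℝ) (hC : 0 ≤ C) (h : ∀ t, ‖ev t ξ‖ ≤ C) : ‖ξ‖ ≤ C
  continuous_inner (ξ η : E) : Continuous fun t => ⟪ev t ξ, ev t η⟫_ℂ
  exists_smul (f : C(I, ℂ)) (ξ : E) : ∃ η, ∀ t, ev t η = f t • ev t ξ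

namespace HilbertField

variable {E : Type*} [NormedAddCommGroup E] [NormedSpace ℂ E] {H : I → Type*}
  [∀ t, NormedAddCommGroup (H t)] [∀ t, InnerProductSpace ℂ (H t)] (Γ : HilbertField E H)

theorem continuous_norm (ξ : E) : Continuous fun t => ‖Γ.ev t ξ‖ := by
  simp_rw [norm_eq_sqrt_re_inner (𝕜 := ℂ)]
  exact Real.continuous_sqrt.comp (Complex.continuous_re.comp (Γ.continuous_inner ξ ξ))

theorem exists_of_approx [CompleteSpace E] (T : ∀ t, H t)
    (h : ∀ ε > 0, ∃ ξ : E, ∀ t, ‖Γ.ev t ξ - T t‖ ≤ ε) : ∃ ξ : E, ∀ t, Γ.ev t ξ = T t := by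
  choose a ha using fun n : ℕ => h (1 / ((n : ℝ) + 1)) (by positivity)
  have hlim : Filter.Tendsto (fun n : ℕ => 1 / ((n : ℝ) + 1)) Filter.atTop (𝓝 0) :=
    tendsto_one_div_add_atTop_nhds_zero_nat
  have hc : CauchySeq a := by
    refine cauchySeq_of_le_tendsto_0 (fun n : ℕ => 2 * (1 / ((n : ℝ) + 1))) (fun n m N hn hm => ?_)
      (by simpa using hlim.const_mul 2)
    rw [dist_eq_norm]
    refine Γ.norm_le _ _ (by positivity) fun t => ?_
    have hmono : ∀ k, N ≤ k → ‖Γ.ev t (a k) - T t‖ ≤ 1 / ((N : ℝ) + 1) := fun k hk =>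
      (ha k t).trans (one_div_le_one_div_of_le (by positivity) (by gcongr))
    have : Γ.ev t (a n - a m) = (Γ.ev t (a n) - T t) - (Γ.ev t (a m) - T t) := by
      rw [map_sub]; abel
    rw [this]
    refine (norm_sub_le _ _).trans ?_
    linarith [hmono n hn, hmono m hm]
  obtain ⟨b, hb⟩ := cauchySeq_tendsto_of_complete hc
  refine ⟨b, fun t => ?_⟩
  have hcont : Continuous (Γ.ev t) := (LinearMap.mkContinuous (Γ.ev t) 1 fun ξ => by
    rw [one_mul]; exact Γ.norm_ev_le t ξ).continuous
  have h1 : Filter.Tendsto (fun n => Γ.ev t (a n)) Filter.atTop (𝓝 (Γ.ev t b)) :=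
    (hcont.tendsto b).comp hb
  have h2 : Filter.Tendsto (fun n => Γ.ev t (a n)) Filter.atTop (𝓝 (T t)) := by
    rw [tendsto_iff_norm_sub_tendsto_zero]
    exact squeeze_zero (fun _ => norm_nonneg _) (fun n => ha n t) hlim
  exact tendsto_nhds_unique h1 h2

/-- On the compact set where ‖ξ₀‖ ≥ κ the continuous norm of ξ has a positive minimum, which bounds
the admissible perturbations. -/
theorem isOpen_nonvanishing (ξ₀ : E) (κ : ℝ) :
    IsOpen {ξ : E | ∀ t, κ ≤ ‖Γ.ev t ξ₀‖ → Γ.ev t ξ ≠ 0} := by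
  rw [Metric.isOpen_iff]
  intro ξ hξ
  have hK : IsCompact {t | κ ≤ ‖Γ.ev t ξ₀‖} :=
    (isClosed_le continuous_const (Γ.continuous_norm ξ₀)).isCompact
  obtain ⟨δ, hδ, h⟩ : ∃ δ > 0, ∀ t, κ ≤ ‖Γ.ev t ξ₀‖ → δ ≤ ‖Γ.ev t ξ‖ := by
    rcases Set.eq_empty_or_nonempty {t | κ ≤ ‖Γ.ev t ξ₀‖} with h0 | h0
    · refine ⟨1, one_pos, fun t ht => ?_⟩
      have : t ∈ {t | κ ≤ ‖Γ.ev t ξ₀‖} := ht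
      rw [h0] at this
      exact this.elim
    · obtain ⟨s, hs, hmin⟩ := hK.exists_isMinOn h0 (Γ.continuous_norm ξ).continuousOn
      exact ⟨_, norm_pos_iff.2 (hξ s hs), fun t ht => hmin ht⟩
  refine ⟨δ, hδ, fun η hη t ht h0 => ?_⟩
  rw [Metric.mem_ball, dist_eq_norm] at hη
  have h1 := (Γ.norm_ev_le t (η - ξ)).trans_lt hη
  rw [map_sub, h0, zero_sub, norm_neg] at h1
  exact absurd (h t ht) (not_le.2 h1)

/-- Perturb ξ along ξ₀ only: adding a multiple δξ₀ can turn the function ⟨ξ₀, ξ⟩ into a nearby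
function without zeros on the set where ‖ξ₀‖ ≥ κ, and then ξ + δξ₀ has no zeros there. -/
theorem dense_nonvanishing (ξ₀ : E) {κ : ℝ} (hκ : 0 < κ) :
    Dense {ξ : E | ∀ t, κ ≤ ‖Γ.ev t ξ₀‖ → Γ.ev t ξ ≠ 0} := by
  rw [Metric.dense_iff]
  intro ξ r hr
  set M := ‖ξ₀‖ + 1 with hM
  have hMpos : 0 < M := by positivity
  -- Chosen so that ‖δξ₀‖ ≤ (ε/κ²)M = r/2.
  set ε := r / 2 * κ ^ 2 / M with hε
  have hε0 : 0 < ε := by positivity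
  let m : C(I, ℂ) := ⟨fun t => ⟪Γ.ev t ξ₀, Γ.ev t ξ⟫_ℂ, Γ.continuous_inner ξ₀ ξ⟩
  obtain ⟨m', hm', hmm⟩ := exists_nonvanishing_near m hε0
  have hden : ∀ t, (0 : ℝ) < max (‖Γ.ev t ξ₀‖ ^ 2) (κ ^ 2) := fun t =>
    lt_max_of_lt_right (by positivity)
  let δ : C(I, ℂ) := ⟨fun t => (m' t - m t) / ((max (‖Γ.ev t ξ₀‖ ^ 2) (κ ^ 2) : ℝ) : ℂ), by
    have := Γ.continuous_norm ξ₀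
    refine Continuous.div (by fun_prop) (by fun_prop) fun t => ?_
    exact_mod_cast (hden t).ne'⟩
  obtain ⟨ζ, hζ⟩ := Γ.exists_smul δ ξ₀
  refine ⟨ξ + ζ, ?_, fun t ht h0 => hm' t ?_⟩
  · rw [Metric.mem_ball, dist_eq_norm, add_sub_cancel_left]
    refine lt_of_le_of_lt (Γ.norm_le ζ (r / 2) (by positivity) fun t => ?_) (by linarith)
    rw [hζ, norm_smul]
    have h1 : ‖δ t‖ ≤ ε / κ ^ 2 := by
      simp only [δ, ContinuousMap.coe_mk]
      rw [norm_div, Complex.norm_real, Real.norm_of_nonneg (hden t).le]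
      gcongr
      · exact hmm t
      · exact le_max_right _ _
    have h2 : ‖Γ.ev t ξ₀‖ ≤ M := (Γ.norm_ev_le t ξ₀).trans (by linarith)
    calc ‖δ t‖ * ‖Γ.ev t ξ₀‖ ≤ ε / κ ^ 2 * M := by gcongr
      _ = r / 2 := by rw [hε]; field_simp
  · have h1 : ⟪Γ.ev t ξ₀, Γ.ev t (ξ + ζ)⟫_ℂ = 0 := by rw [h0, inner_zero_right]
    rw [map_add, hζ, inner_add_right, inner_smul_right, inner_self_eq_norm_sq_to_K] at h1
    have h2 : δ t = (m' t - m t) / ((‖Γ.ev t ξ₀‖ ^ 2 : ℝ) : ℂ) := by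
      simp only [δ, ContinuousMap.coe_mk]
      rw [max_eq_left (by gcongr)]
    have h3 : ((‖Γ.ev t ξ₀‖ : ℝ) : ℂ) ≠ 0 := by
      exact_mod_cast (hκ.trans_le ht).ne'
    rw [h2] at h1
    have h4 : m t + (m' t - m t) = 0 := by
      rw [← h1]
      simp only [m, ContinuousMap.coe_mk, Complex.coe_algebraMap]
      push_cast
      field_simp
    rwa [add_sub_cancel] at h4

/-- Sections that vanish only where all sections vanish are dense. -/
theorem dense_generic [CompleteSpace E] :
    Dense {ξ : E | ∀ t, Γ.ev t ξ = 0 → ∀ η, Γ.ev t η = 0} := by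
  let U : Set I := {t | ∃ η, Γ.ev t η ≠ 0}
  have hU : ∀ t : I, ∃ η : E, t ∈ U → Γ.ev t η ≠ 0 := fun t => by
    by_cases h : t ∈ U
    · exact ⟨h.choose, fun _ => h.choose_spec⟩
    · exact ⟨0, fun h' => absurd h' h⟩
  choose η hη using hU
  let κ : I → ℝ := fun t => ‖Γ.ev t (η t)‖ / 2
  let O : I → Set I := fun t => {s | κ t < ‖Γ.ev s (η t)‖}
  -- By the Lindelöf property countably many of the sets `O t` cover the region where some section
  -- is nonzero. The generic sections then contain a countable intersection of dense open sets, and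
  -- Baire applies.
  obtain ⟨T, hTU, hTc, hT⟩ := TopologicalSpace.isOpen_biUnion_countable U O fun t _ =>
    isOpen_lt continuous_const (Γ.continuous_norm (η t))
  refine (dense_biInter_of_isOpen (S := T) (f := fun t => {ξ : E | ∀ s, κ t ≤ ‖Γ.ev s (η t)‖ → Γ.ev s ξ ≠ 0})
    (fun t _ => Γ.isOpen_nonvanishing _ _) hTc
    fun t ht => Γ.dense_nonvanishing _ (half_pos (norm_pos_iff.2 (hη t (hTU ht))))).mono ?_
  intro ξ hξ t h0 ζ
  by_contra h
  have htU : t ∈ U := ⟨ζ, h⟩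
  have : t ∈ ⋃ t ∈ T, O t := by
    rw [hT]
    exact Set.mem_biUnion htU (half_lt_self (norm_pos_iff.2 (hη t htU)))
  obtain ⟨s, hs, hts⟩ := Set.mem_iUnion₂.1 this
  have hlt : κ s < ‖Γ.ev t (η s)‖ := hts
  exact Set.mem_iInter₂.1 hξ s hs t hlt.le h0

/-- The normalization of a section; zero where the section vanishes. -/
noncomputable def unit (ξ : E) (t : I) : H t := ((‖Γ.ev t ξ‖ : ℝ) : ℂ)⁻¹ • Γ.ev t ξ

theorem unit_eq_zero {ξ : E} {t : I} (h : Γ.ev t ξ = 0) : Γ.unit ξ t = 0 := by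
  rw [unit, h, smul_zero]

theorem norm_unit {ξ : E} {t : I} (h : Γ.ev t ξ ≠ 0) : ‖Γ.unit ξ t‖ = 1 := by
  rw [unit, norm_smul, norm_inv, Complex.norm_real, norm_norm,
    inv_mul_cancel₀ (norm_ne_zero_iff.2 h)]

theorem norm_unit_le (ξ : E) (t : I) : ‖Γ.unit ξ t‖ ≤ 1 := by
  by_cases h : Γ.ev t ξ = 0
  · rw [Γ.unit_eq_zero h]; simp
  · exact (Γ.norm_unit h).le

theorem norm_smul_unit (ξ : E) (t : I) : ((‖Γ.ev t ξ‖ : ℝ) : ℂ) • Γ.unit ξ t = Γ.ev t ξ := by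
  by_cases h : Γ.ev t ξ = 0
  · rw [h]; simp
  · rw [unit, smul_inv_smul₀]
    exact_mod_cast norm_ne_zero_iff.2 h

theorem inner_unit_unit (ξ : E) (t : I) : ⟪Γ.unit ξ t, Γ.unit ξ t⟫_ℂ • Γ.unit ξ t = Γ.unit ξ t := by
  by_cases h : Γ.ev t ξ = 0
  · rw [Γ.unit_eq_zero h, smul_zero]
  · rw [inner_self_eq_norm_sq_to_K, Γ.norm_unit h]; simp

/-- The product of a function with the normalization of a section is a section when the function
vanishes wherever the section does. -/
theorem exists_smul_unit [CompleteSpace E] (F : C(I, ℂ)) (ξ : E)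
    (h : ∀ t, Γ.ev t ξ = 0 → F t = 0) : ∃ ζ, ∀ t, Γ.ev t ζ = F t • Γ.unit ξ t := by
  refine Γ.exists_of_approx _ fun ε hε => ?_
  obtain ⟨κ, hκ, hF⟩ := exists_pos_forall_lt (Γ.continuous_norm ξ) (fun _ => norm_nonneg _)
    F.continuous (fun t ht => h t (norm_eq_zero.1 ht)) hε
  have hden : ∀ t, (0 : ℝ) < max ‖Γ.ev t ξ‖ κ := fun t => lt_max_of_lt_right hκ
  -- Dividing by max(‖ξ‖, κ) instead of ‖ξ‖ gives a continuous multiplier. It is exact where ‖ξ‖ ≥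
  -- κ; elsewhere F itself is at most ε in modulus.
  obtain ⟨ζ, hζ⟩ := Γ.exists_smul ⟨fun t => F t / ((max ‖Γ.ev t ξ‖ κ : ℝ) : ℂ), by
    have := Γ.continuous_norm ξ
    refine Continuous.div (by fun_prop) (by fun_prop) fun t => ?_
    exact_mod_cast (hden t).ne'⟩ ξ
  refine ⟨ζ, fun t => ?_⟩
  rw [hζ, ContinuousMap.coe_mk]
  rcases le_or_gt κ ‖Γ.ev t ξ‖ with hk | hk
  · rw [max_eq_left hk, unit, smul_smul, div_eq_mul_inv, sub_self, norm_zero]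
    exact hε.le
  · rw [max_eq_right hk.le, ← Γ.norm_smul_unit ξ t, smul_smul, ← sub_smul, norm_smul]
    have h1 : ‖F t / (κ : ℂ) * ((‖Γ.ev t ξ‖ : ℝ) : ℂ) - F t‖ ≤ ‖F t‖ := by
      have h2 : F t / (κ : ℂ) * ((‖Γ.ev t ξ‖ : ℝ) : ℂ) - F t
          = F t * ((‖Γ.ev t ξ‖ / κ - 1 : ℝ) : ℂ) := by push_cast; ring
      rw [h2, norm_mul, Complex.norm_real]
      refine mul_le_of_le_one_right (norm_nonneg _) (abs_le.2 ⟨?_, ?_⟩)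
      · have : 0 ≤ ‖Γ.ev t ξ‖ / κ := by positivity
        linarith
      · have : ‖Γ.ev t ξ‖ / κ ≤ 1 := (div_le_one hκ).2 hk.le
        linarith
    calc _ ≤ ‖F t‖ * 1 := mul_le_mul h1 (Γ.norm_unit_le ξ t) (norm_nonneg _) (norm_nonneg _)
      _ ≤ ε := by rw [mul_one]; exact hF t hk

/-- Away from the zeros of ξ this is a quotient of continuous functions; at a zero it is dominated
by ‖η‖, which tends to zero. So the discontinuity of the normalization is harmless against such η.
-/
theorem continuous_inner_unit {ξ η : E} (h : ∀ t, Γ.ev t ξ = 0 → Γ.ev t η = 0) :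
    Continuous fun t => ⟪Γ.unit ξ t, Γ.ev t η⟫_ℂ := by
  have h1 : ∀ t, ⟪Γ.unit ξ t, Γ.ev t η⟫_ℂ = ((‖Γ.ev t ξ‖ : ℝ) : ℂ)⁻¹ * ⟪Γ.ev t ξ, Γ.ev t η⟫_ℂ := by
    intro t
    rw [unit, inner_smul_left, map_inv₀, Complex.conj_ofReal]
  have hn := Γ.continuous_norm ξ
  rw [continuous_iff_continuousAt]
  intro t
  by_cases ht : Γ.ev t ξ = 0
  · rw [ContinuousAt, h t ht, inner_zero_right]
    refine squeeze_zero_norm (fun s => (norm_inner_le_norm _ _).trans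
      (mul_le_of_le_one_left (norm_nonneg _) (Γ.norm_unit_le ξ s))) ?_
    have := (Γ.continuous_norm η).tendsto t
    rwa [h t ht, norm_zero] at this
  · simp_rw [h1]
    refine ContinuousAt.mul (ContinuousAt.inv₀ (by fun_prop) ?_) (Γ.continuous_inner ξ η).continuousAt
    exact_mod_cast norm_ne_zero_iff.2 ht

/-- The restriction of a field to a closed submodule of sections. -/
noncomputable def restrict (P : Submodule ℂ E)
    (hP : ∀ (f : C(I, ℂ)), ∀ ξ ∈ P, ∀ η, (∀ t, Γ.ev t η = f t • Γ.ev t ξ) → η ∈ P) :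
    HilbertField P H where
  ev t := (Γ.ev t).comp P.subtype
  norm_ev_le t ξ := Γ.norm_ev_le t ξ
  norm_le ξ := Γ.norm_le ξ
  continuous_inner ξ η := Γ.continuous_inner ξ η
  exists_smul f ξ := by
    obtain ⟨η, hη⟩ := Γ.exists_smul f ξ
    exact ⟨⟨η, hP f ξ ξ.2 η hη⟩, hη⟩

/-- The sections that are orthogonal to all members of a list. -/
def orth (l : List E) : Submodule ℂ E where
  carrier := {η | ∀ ξ ∈ l, ∀ t, ⟪Γ.ev t ξ, Γ.ev t η⟫_ℂ = 0}
  add_mem' h1 h2 ξ hξ t := by rw [map_add, inner_add_right, h1 ξ hξ, h2 ξ hξ, add_zero]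
  zero_mem' ξ _ t := by rw [map_zero, inner_zero_right]
  smul_mem' c η h ξ hξ t := by rw [map_smul, inner_smul_right, h ξ hξ, mul_zero]

theorem isClosed_orth (l : List E) : IsClosed (Γ.orth l : Set E) := by
  have h : (Γ.orth l : Set E) = ⋂ ξ ∈ l, ⋂ t, {η | ⟪Γ.ev t ξ, Γ.ev t η⟫_ℂ = 0} := by
    ext η
    simp only [Set.mem_iInter]
    exact Iff.rfl
  rw [h]
  refine isClosed_biInter fun ξ _ => isClosed_iInter fun t => isClosed_eq ?_ continuous_const
  have hcont : Continuous (Γ.ev t) := (LinearMap.mkContinuous (Γ.ev t) 1 fun ξ => by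
    rw [one_mul]; exact Γ.norm_ev_le t ξ).continuous
  exact continuous_const.inner hcont

/-- The defect of a section with respect to the normalizations of the members of a list. -/
noncomputable def residue (l : List E) (x : E) (t : I) : H t :=
  Γ.ev t x - (l.map fun ξ => ⟪Γ.unit ξ t, Γ.ev t x⟫_ℂ • Γ.unit ξ t).sum

theorem inner_unit_eq_zero {ξ : E} {t : I} {w : H t} (h : ⟪Γ.ev t ξ, w⟫_ℂ = 0) :
    ⟪Γ.unit ξ t, w⟫_ℂ = 0 := by
  rw [unit, inner_smul_left, h, mul_zero]

theorem inner_unit_residue {l : List E} {ξ : E} (hξ : ξ ∈ Γ.orth l) (x : E) (t : I) :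
    ⟪Γ.unit ξ t, Γ.residue l x t⟫_ℂ = ⟪Γ.unit ξ t, Γ.ev t x⟫_ℂ := by
  rw [residue, inner_sub_right, sub_eq_self]
  induction l with
  | nil => simp
  | cons ζ l ih =>
    rw [List.map_cons, List.sum_cons, inner_add_right, inner_smul_right,
      ih fun η hη => hξ η (List.mem_cons_of_mem _ hη), add_zero]
    have h1 : ⟪Γ.unit ξ t, Γ.unit ζ t⟫_ℂ = 0 := by
      refine Γ.inner_unit_eq_zero ?_
      rw [← inner_conj_symm, Γ.inner_unit_eq_zero (hξ ζ List.mem_cons_self t), map_zero]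
    rw [h1, mul_zero]

theorem residue_cons (l : List E) (ξ x : E) (t : I) :
    Γ.residue (ξ :: l) x t = Γ.residue l x t - ⟪Γ.unit ξ t, Γ.ev t x⟫_ℂ • Γ.unit ξ t := by
  rw [residue, residue, List.map_cons, List.sum_cons]
  abel

/-- One step of the orthogonalization process. -/
theorem exists_orthogonal_step [CompleteSpace E] {l : List E}
    (hl : ∀ x, ∃ y ∈ Γ.orth l, ∀ t, Γ.ev t y = Γ.residue l x t) (x : E) {ε : ℝ} (hε : 0 < ε) :
    ∃ ξ ∈ Γ.orth l, (∀ t, Γ.ev t ξ = 0 → ∀ η ∈ Γ.orth l, Γ.ev t η = 0) ∧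
      (∀ t, ‖Γ.residue (ξ :: l) x t‖ ≤ ε) ∧
      ∀ x, ∃ y ∈ Γ.orth (ξ :: l), ∀ t, Γ.ev t y = Γ.residue (ξ :: l) x t := by
  have hPc := Γ.isClosed_orth l
  have hP : ∀ (f : C(I, ℂ)), ∀ ξ ∈ Γ.orth l, ∀ η, (∀ t, Γ.ev t η = f t • Γ.ev t ξ) →
      η ∈ Γ.orth l := fun f ξ hξ η hη ζ hζ t => by
    rw [hη, inner_smul_right, hξ ζ hζ, mul_zero]
  have : CompleteSpace (Γ.orth l) := hPc.completeSpace_coe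
  obtain ⟨y, hy, hyx⟩ := hl x
  -- The new frame member is a generic section of the orthogonal complement, taken ε-close to the
  -- residue y of x. Genericity makes the next residues continuous sections; closeness makes the
  -- residue of x small.
  obtain ⟨⟨ξ, hξ⟩, hgen, hdist⟩ := (Γ.restrict (Γ.orth l) hP).dense_generic.exists_dist_lt ⟨y, hy⟩ hε
  have hgen' : ∀ t, Γ.ev t ξ = 0 → ∀ η ∈ Γ.orth l, Γ.ev t η = 0 := fun t ht η hη =>
    hgen t ht ⟨η, hη⟩
  have hdist' : ‖y - ξ‖ < ε := by rw [← dist_eq_norm]; exact hdist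
  refine ⟨ξ, hξ, hgen', fun t => ?_, fun x => ?_⟩
  · rw [residue_cons, ← Γ.inner_unit_residue hξ, ← hyx]
    -- Removing the component along ξ annihilates ξ, so y may be replaced by y − ξ, and the removal
    -- does not increase norms.
    have h1 : Γ.ev t y - ⟪Γ.unit ξ t, Γ.ev t y⟫_ℂ • Γ.unit ξ t
        = Γ.ev t (y - ξ) - ⟪Γ.unit ξ t, Γ.ev t (y - ξ)⟫_ℂ • Γ.unit ξ t := by
      rw [map_sub, inner_sub_right, sub_smul]
      have h2 : ⟪Γ.unit ξ t, Γ.ev t ξ⟫_ℂ • Γ.unit ξ t = Γ.ev t ξ := by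
        rw [← Γ.norm_smul_unit ξ t, inner_smul_right, mul_smul, Γ.inner_unit_unit]
      rw [h2]; abel
    rw [h1]
    refine le_trans ?_ ((Γ.norm_ev_le t (y - ξ)).trans hdist'.le)
    set w := Γ.ev t (y - ξ)
    by_cases h0 : Γ.ev t ξ = 0
    · rw [Γ.unit_eq_zero h0, smul_zero, sub_zero]
    · have h3 : ‖w - ⟪Γ.unit ξ t, w⟫_ℂ • Γ.unit ξ t‖ ^ 2 ≤ ‖w‖ ^ 2 := by
        rw [norm_sub_sq (𝕜 := ℂ), inner_smul_right, norm_smul, Γ.norm_unit h0, mul_one]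
        have h4 : RCLike.re (⟪Γ.unit ξ t, w⟫_ℂ * ⟪w, Γ.unit ξ t⟫_ℂ) = ‖⟪Γ.unit ξ t, w⟫_ℂ‖ ^ 2 := by
          rw [← inner_conj_symm w, RCLike.mul_conj]
          norm_cast
        rw [h4]
        nlinarith [sq_nonneg ‖⟪Γ.unit ξ t, w⟫_ℂ‖]
      exact (sq_le_sq₀ (norm_nonneg _) (norm_nonneg _)).1 h3
  · obtain ⟨y, hy, hyx⟩ := hl x
    have hzero : ∀ t, Γ.ev t ξ = 0 → Γ.ev t y = 0 := fun t ht => hgen' t ht y hy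
    obtain ⟨ζ, hζ⟩ := Γ.exists_smul_unit ⟨_, Γ.continuous_inner_unit hzero⟩ ξ
      (fun t ht => by rw [ContinuousMap.coe_mk, hzero t ht, inner_zero_right])
    simp only [ContinuousMap.coe_mk] at hζ
    refine ⟨y - ζ, fun η hη t => ?_, fun t => ?_⟩
    · rw [map_sub, hζ, inner_sub_right, inner_smul_right]
      rcases List.mem_cons.1 hη with rfl | hη
      · conv_lhs => rw [← Γ.norm_smul_unit η t, inner_smul_left, inner_smul_left]
        by_cases h0 : Γ.ev t η = 0
        · rw [h0]; simp
        · rw [inner_self_eq_norm_sq_to_K, Γ.norm_unit h0]; simp; ring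
      · have h1 : ⟪Γ.ev t η, Γ.unit ξ t⟫_ℂ = 0 := by
          rw [← inner_conj_symm, Γ.inner_unit_eq_zero, map_zero]
          rw [← inner_conj_symm, hξ η hη, map_zero]
        rw [hy η hη, h1, mul_zero, sub_zero]
    · rw [residue_cons, ← Γ.inner_unit_residue hξ, ← hyx, map_sub, hζ]

/-- Existence of a generalized orthonormal frame, adapted to a sequence of sections. -/
theorem exists_frame [CompleteSpace E] (x : ℕ → E) :
    ∃ ξ : ℕ → E, (∀ i j, i ≠ j → ∀ t, ⟪Γ.ev t (ξ i), Γ.ev t (ξ j)⟫_ℂ = 0) ∧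
      (∀ i η, Continuous fun t => ⟪Γ.unit (ξ i) t, Γ.ev t η⟫_ℂ) ∧
      (∀ n t, Γ.ev t (ξ n) = 0 → ∀ η, Γ.ev t η =
        ∑ i ∈ Finset.range n, ⟪Γ.unit (ξ i) t, Γ.ev t η⟫_ℂ • Γ.unit (ξ i) t) ∧
      ∀ n t, ‖Γ.ev t (x n) - ∑ i ∈ Finset.range (n + 1),
        ⟪Γ.unit (ξ i) t, Γ.ev t (x n)⟫_ℂ • Γ.unit (ξ i) t‖ ≤ 1 / ((n : ℝ) + 1) := by
  -- The recursion carries the fact that residues with respect to the list so far are again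
  -- sections; only then can the orthogonal complement be split off and the step repeated.
  let S := {l : List E // ∀ x, ∃ y ∈ Γ.orth l, ∀ t, Γ.ev t y = Γ.residue l x t}
  have hstep : ∀ (n : ℕ) (l : S), ∃ ξ ∈ Γ.orth l.1,
      (∀ t, Γ.ev t ξ = 0 → ∀ η ∈ Γ.orth l.1, Γ.ev t η = 0) ∧
      (∀ t, ‖Γ.residue (ξ :: l.1) (x n) t‖ ≤ 1 / ((n : ℝ) + 1)) ∧
      ∀ x, ∃ y ∈ Γ.orth (ξ :: l.1), ∀ t, Γ.ev t y = Γ.residue (ξ :: l.1) x t := fun n l =>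
    Γ.exists_orthogonal_step l.2 (x n) (by positivity)
  choose ζ h1 h2 h3 h4 using hstep
  let L : ℕ → S := fun n => Nat.rec
    ⟨[], fun x => ⟨x, fun _ h => absurd h List.not_mem_nil, fun t => by simp [residue]⟩⟩
    (fun n l => ⟨ζ n l :: l.1, h4 n l⟩) n
  have hL : ∀ n, (L (n + 1)).1 = ζ n (L n) :: (L n).1 := fun n => rfl
  have hmem : ∀ n i, i < n → ζ i (L i) ∈ (L n).1 := by
    intro n
    induction n with
    | zero => intro i hi; omega
    | succ n ih =>
      intro i hi
      rw [hL]
      rcases Nat.lt_succ_iff_lt_or_eq.1 hi with h | rfl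
      · exact List.mem_cons_of_mem _ (ih i h)
      · exact List.mem_cons_self
  have hres : ∀ n y t, Γ.residue (L n).1 y t = Γ.ev t y - ∑ i ∈ Finset.range n,
      ⟪Γ.unit (ζ i (L i)) t, Γ.ev t y⟫_ℂ • Γ.unit (ζ i (L i)) t := by
    intro n y t
    induction n with
    | zero =>
      change Γ.residue [] y t = _
      simp [residue]
    | succ n ih => rw [hL, residue_cons, ih, Finset.sum_range_succ]; abel
  have horth : ∀ i j, i < j → ∀ t, ⟪Γ.ev t (ζ i (L i)), Γ.ev t (ζ j (L j))⟫_ℂ = 0 := fun i j hij t =>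
    h1 j (L j) _ (hmem j i hij) t
  refine ⟨fun n => ζ n (L n), fun i j hij t => ?_, fun i η => ?_, fun n t ht η => ?_, fun n t => ?_⟩
  · rcases lt_or_gt_of_ne hij with h | h
    · exact horth i j h t
    · rw [← inner_conj_symm, horth j i h t, map_zero]
  -- The section η need not vanish where ξᵢ does, but its residue y does, and it has the same
  -- coefficient along ξᵢ.
  · obtain ⟨y, hy, hyx⟩ := (L i).2 η
    simp_rw [← Γ.inner_unit_residue (h1 i (L i)) η, ← hyx]
    exact Γ.continuous_inner_unit fun t ht => h2 i (L i) t ht y hy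
  -- At a zero of the generic ξₙ the whole complement of the first n members vanishes, so the
  -- residue of η is zero there.
  · obtain ⟨y, hy, hyx⟩ := (L n).2 η
    have h5 := hyx t
    rw [h2 n (L n) t ht y hy, hres] at h5
    exact sub_eq_zero.1 h5.symm
  · rw [← hres (n + 1), hL]
    exact h3 n (L n) t

end HilbertField

/-! ### Finite step functions and exhaustions by intervals -/

section FiniteStep

variable {α β : Type*}

theorem IsFiniteStep.of_finite {ι : Type*} [Finite ι] {f : I → α} (J : ι → Set I)
    (hJ : ∀ i, (J i).OrdConnected) (hd : Pairwise fun i j => Disjoint (J i) (J j))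
    (hu : ∀ t, ∃ i, t ∈ J i) (hf : ∀ i, ∀ s ∈ J i, ∀ t ∈ J i, f s = f t) : IsFiniteStep f := by
  obtain ⟨m, ⟨e⟩⟩ := Finite.exists_equiv_fin ι
  refine ⟨m, fun k => J (e.symm k), fun k => hJ _, fun k l hkl => hd (e.symm.injective.ne hkl),
    Set.eq_univ_of_forall fun t => ?_, fun k => hf _⟩
  obtain ⟨i, hi⟩ := hu t
  exact Set.mem_iUnion.2 ⟨e i, by simpa using hi⟩

theorem IsFiniteStep.comp {f : I → α} (hf : IsFiniteStep f) (g : α → β) :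
    IsFiniteStep fun t => g (f t) := by
  obtain ⟨m, J, h1, h2, h3, h4⟩ := hf
  exact ⟨m, J, h1, h2, h3, fun i s hs t ht => congrArg g (h4 i s hs t ht)⟩

/-- Intersections of intervals are intervals, so finitely many partitions have a common refinement.
-/
theorem IsFiniteStep.pi {ι : Type*} [Finite ι] {f : I → ι → α}
    (hf : ∀ i, IsFiniteStep fun t => f t i) : IsFiniteStep f := by
  choose m J h1 h2 h3 h4 using hf
  refine IsFiniteStep.of_finite (ι := ∀ i, Fin (m i)) (fun x => ⋂ i, J i (x i))
    (fun x => Set.ordConnected_iInter fun i => h1 i _) (fun x y hxy => ?_) (fun t => ?_)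
    (fun x s hs t ht => funext fun i => h4 i (x i) s (Set.mem_iInter.1 hs i) t
      (Set.mem_iInter.1 ht i))
  · obtain ⟨i, hi⟩ := Function.ne_iff.1 hxy
    exact (h2 i hi).mono (Set.iInter_subset _ i) (Set.iInter_subset _ i)
  · have : ∀ i, ∃ k, t ∈ J i k := fun i => by
      have : t ∈ ⋃ k, J i k := (h3 i) ▸ Set.mem_univ t
      exact Set.mem_iUnion.1 this
    choose k hk using this
    exact ⟨k, Set.mem_iInter.2 hk⟩

/-- The complement of an interval falls into the part to its left and the part to its right; for
empty `S` everything counts as right. -/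
theorem IsFiniteStep.of_ordConnected {S : Set I} (hS : S.OrdConnected) :
    IsFiniteStep fun t => t ∈ S := by
  let L : Set I := {t | t ∉ S ∧ ∃ s ∈ S, t < s}
  let R : Set I := {t | t ∉ S ∧ ∀ s ∈ S, s < t}
  have hL : L.OrdConnected := by
    refine ⟨fun a ha b hb c hc => ?_⟩
    obtain ⟨s, hs, hbs⟩ := hb.2
    exact ⟨fun hcS => hb.1 (hS.out hcS hs ⟨hc.2, hbs.le⟩), s, hs, hc.2.trans_lt hbs⟩
  have hR : R.OrdConnected := by
    refine ⟨fun a ha b hb c hc => ?_⟩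
    exact ⟨fun hcS => absurd (ha.2 c hcS) (not_lt.2 hc.1), fun s hs => (ha.2 s hs).trans_le hc.1⟩
  have hSL : Disjoint S L := Set.disjoint_left.2 fun t h1 h2 => h2.1 h1
  have hSR : Disjoint S R := Set.disjoint_left.2 fun t h1 h2 => h2.1 h1
  have hLR : Disjoint L R := Set.disjoint_left.2 fun t h1 h2 => by
    obtain ⟨s, hs, hts⟩ := h1.2
    exact lt_asymm hts (h2.2 s hs)
  refine IsFiniteStep.of_finite (ι := Fin 3) ![S, L, R] (fun i => ?_) (fun i j hij => ?_)
    (fun t => ?_) (fun i s hs t ht => ?_)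
  · fin_cases i
    · exact hS
    · exact hL
    · exact hR
  · fin_cases i <;> fin_cases j <;> first | exact absurd rfl hij | skip
    · exact hSL
    · exact hSR
    · exact hSL.symm
    · exact hLR
    · exact hSR.symm
    · exact hLR.symm
  · by_cases h : t ∈ S
    · exact ⟨0, h⟩
    by_cases h' : ∃ s ∈ S, t < s
    · exact ⟨1, h, h'⟩
    · push Not at h'
      exact ⟨2, h, fun s hs => lt_of_le_of_ne (h' s hs) fun hst => h (hst ▸ hs)⟩
  · fin_cases i
    · exact propext ⟨fun _ => ht, fun _ => hs⟩
    · exact propext ⟨fun h => absurd h hs.1, fun h => absurd h ht.1⟩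
    · exact propext ⟨fun h => absurd h hs.1, fun h => absurd h ht.1⟩

end FiniteStep

/-- An exhaustion of an open subset of the interval by finite unions of intervals. -/
structure IsExhaustion (U : Set I) (W : ℕ → Set I) : Prop where
  isOpen (n : ℕ) : IsOpen (W n)
  mono : Monotone W
  iUnion_eq : ⋃ n, W n = U
  isFiniteStep (n : ℕ) : IsFiniteStep fun t => t ∈ W n

theorem IsExhaustion.subset {U : Set I} {W : ℕ → Set I} (h : IsExhaustion U W) (n : ℕ) : W n ⊆ U :=
  h.iUnion_eq ▸ Set.subset_iUnion W n

theorem IsExhaustion.exists_subset {U : Set I} {W : ℕ → Set I} (h : IsExhaustion U W) {K : Set I}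
    (hK : IsCompact K) (hKU : K ⊆ U) : ∃ N, ∀ n ≥ N, K ⊆ W n := by
  obtain ⟨N, hN⟩ := hK.elim_directed_cover W h.isOpen (h.iUnion_eq ▸ hKU) h.mono.directed_le
  exact ⟨N, fun n hn => hN.trans (h.mono hn)⟩

/-- An open set is a union of countably many balls, which are intervals; take the union of the first
n of them. -/
theorem exists_isExhaustion {U : Set I} (hU : IsOpen U) : ∃ W, IsExhaustion U W := by
  have hball : ∀ t : I, ∃ r > 0, t ∈ U → Metric.ball t r ⊆ U := by
    intro t
    by_cases ht : t ∈ U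
    · obtain ⟨r, hr, h⟩ := Metric.isOpen_iff.1 hU t ht
      exact ⟨r, hr, fun _ => h⟩
    · exact ⟨1, one_pos, fun h => absurd h ht⟩
  choose r hr hrU using hball
  obtain ⟨T, hTU, hTc, hT⟩ := TopologicalSpace.isOpen_biUnion_countable U
    (fun t => Metric.ball t (r t)) fun t _ => Metric.isOpen_ball
  have hT' : ⋃ t ∈ T, Metric.ball t (r t) = U := by
    rw [hT]
    refine subset_antisymm (Set.iUnion₂_subset hrU) fun t ht => ?_
    exact Set.mem_biUnion ht (Metric.mem_ball_self (hr t))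
  obtain ⟨f, hf⟩ := Set.countable_iff_exists_subset_range.1 hTc
  -- The enumeration `f` may take values outside `T`; those indices contribute the empty set.
  let S : ℕ → Set I := fun i => {t | f i ∈ T ∧ t ∈ Metric.ball (f i) (r (f i))}
  have hSo : ∀ i, IsOpen (S i) := fun i => by
    by_cases h : f i ∈ T
    · have : S i = Metric.ball (f i) (r (f i)) := by ext t; exact ⟨fun h => h.2, fun h' => ⟨h, h'⟩⟩
      rw [this]; exact Metric.isOpen_ball
    · have : S i = ∅ := by ext t; exact ⟨fun h' => h h'.1, fun h => h.elim⟩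
      rw [this]; exact isOpen_empty
  have hSc : ∀ i, (S i).OrdConnected := fun i => by
    refine ⟨fun a ha b hb c hc => ⟨ha.1, ?_⟩⟩
    have h1 : |(a : ℝ) - f i| < r (f i) := ha.2
    have h2 : |(b : ℝ) - f i| < r (f i) := hb.2
    have h3 : (a : ℝ) ≤ c := hc.1
    have h4 : (c : ℝ) ≤ b := hc.2
    change |(c : ℝ) - f i| < r (f i)
    rw [abs_lt] at *
    constructor <;> linarith
  refine ⟨fun n => ⋃ i : Fin n, S i, ⟨fun n => isOpen_iUnion fun i => hSo i, fun m n hmn => ?_, ?_,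
    fun n => ?_⟩⟩
  · exact Set.iUnion_subset fun i => Set.subset_iUnion (fun i : Fin n => S i) (Fin.castLE hmn i)
  · rw [← hT']
    ext t
    simp only [Set.mem_iUnion]
    constructor
    · rintro ⟨n, i, hi⟩
      exact ⟨f i, hi.1, hi.2⟩
    · rintro ⟨s, hs, hts⟩
      obtain ⟨i, rfl⟩ := hf hs
      exact ⟨i + 1, ⟨i, by omega⟩, hs, hts⟩
  · have := (IsFiniteStep.pi (f := fun t (i : Fin n) => t ∈ S i) fun i =>
      IsFiniteStep.of_ordConnected (hSc i)).comp fun x => ∃ i, x i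
    simpa only [Set.mem_iUnion] using this

/-! ### Cutoffs, factorizations and bumps of scalar functions -/

/-- A function can be approximated by functions with compact support inside its support. -/
theorem exists_compact_cutoff (F : C(I, ℂ)) {ε : ℝ} (hε : 0 < ε) :
    ∃ (G : C(I, ℂ)) (K : Set I), IsCompact K ∧ (∀ t ∈ K, F t ≠ 0) ∧ (∀ t ∉ K, G t = 0) ∧
      ∀ t, ‖G t - F t‖ ≤ ε := by
  have hden : ∀ t, (0 : ℝ) < max ‖F t‖ ε := fun t => lt_max_of_lt_right hε
  -- Multiplication by `w` lowers the modulus of F by ε and stops at zero, so F moves by at most ε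
  -- and survives only where ‖F‖ > ε.
  let w : I → ℝ := fun t => max (‖F t‖ - ε) 0 / max ‖F t‖ ε
  have hw : Continuous w := Continuous.div (by fun_prop) (by fun_prop) fun t => (hden t).ne'
  refine ⟨⟨fun t => (w t : ℂ) * F t, by fun_prop⟩, {t | ε ≤ ‖F t‖},
    (isClosed_le continuous_const F.continuous.norm).isCompact, fun t ht h => ?_, fun t ht => ?_,
    fun t => ?_⟩
  · have : ε ≤ ‖F t‖ := ht
    rw [h, norm_zero] at this
    linarith
  · have : ‖F t‖ < ε := not_le.1 ht
    simp [w, this.le]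
  · rw [ContinuousMap.coe_mk]
    have h1 : (w t : ℂ) * F t - F t = ((w t - 1 : ℝ) : ℂ) * F t := by push_cast; ring
    rw [h1, norm_mul, Complex.norm_real, Real.norm_eq_abs]
    rcases le_or_gt ‖F t‖ ε with h | h
    · have : w t = 0 := by simp [w, h]
      rw [this]; simpa using h
    · have hpos : 0 < ‖F t‖ := hε.trans h
      have : w t = (‖F t‖ - ε) / ‖F t‖ := by
        simp only [w]
        rw [max_eq_left h.le, max_eq_left (by linarith)]
      have h2 : w t - 1 = -(ε / ‖F t‖) := by rw [this]; field_simp; ring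
      rw [h2, abs_neg, abs_of_pos (by positivity), div_mul_cancel₀ _ hpos.ne']

/-- A continuous function is a product of two continuous functions with the same zeros. -/
theorem exists_mul_eq (F : C(I, ℂ)) :
    ∃ (R : C(I, ℝ)) (G : C(I, ℂ)), (∀ t, F t = 0 → R t = 0 ∧ G t = 0) ∧ ∀ t, G t * R t = F t := by
  -- The factors are r and F/r, both of modulus at most r. Such a splitting lets a coefficient be
  -- shared between the two vectors of a rank-one operator, each of which must be cut down to a
  -- continuous section.
  let r : I → ℝ := fun t => √‖F t‖
  have hr : Continuous r := by fun_prop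
  have hr0 : ∀ t, F t ≠ 0 → (r t : ℂ) ≠ 0 := fun t h => by
    have : 0 < r t := Real.sqrt_pos.2 (norm_pos_iff.2 h)
    exact_mod_cast this.ne'
  have hn : ∀ t, ‖F t * (r t : ℂ)⁻¹‖ ≤ r t := by
    intro t
    rw [norm_mul, norm_inv, Complex.norm_real, Real.norm_of_nonneg (Real.sqrt_nonneg _),
      ← div_eq_mul_inv]
    exact (Real.div_sqrt (x := ‖F t‖)).le
  refine ⟨⟨r, hr⟩, ⟨fun t => F t * (r t : ℂ)⁻¹, ?_⟩, fun t h => ?_, fun t => ?_⟩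
  · rw [continuous_iff_continuousAt]
    intro t
    by_cases h : F t = 0
    · rw [ContinuousAt, h, zero_mul]
      refine squeeze_zero_norm hn ?_
      have := hr.tendsto t
      have h0 : r t = 0 := by simp [r, h]
      rwa [h0] at this
    · exact F.continuous.continuousAt.mul (ContinuousAt.inv₀ (by fun_prop) (hr0 t h))
  · simp [r, h]
  · by_cases h : F t = 0
    · simp [h]
    · simp only [ContinuousMap.coe_mk]
      rw [mul_assoc, inv_mul_cancel₀ (hr0 t h), mul_one]

theorem exists_bump (U : Set I) (hU : IsOpen U) {t₀ : I} (h : t₀ ∈ U) :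
    ∃ F : C(I, ℂ), F t₀ = 1 ∧ ∀ t ∉ U, F t = 0 := by
  obtain ⟨r, hr, hball⟩ := Metric.isOpen_iff.1 hU t₀ h
  refine ⟨⟨fun t => ((max 0 (1 - dist t t₀ / r) : ℝ) : ℂ), by fun_prop⟩, by simp, fun t ht => ?_⟩
  have : r ≤ dist t t₀ := by
    by_contra! hlt
    exact ht (hball hlt)
  have h1 : 1 ≤ dist t t₀ / r := (one_le_div hr).2 this
  rw [ContinuousMap.coe_mk, max_eq_left (by linarith)]
  simp

theorem ContinuousMap.mem_closure_of_pi {n : ℕ} {S : Set C(I, Fin n → Fin n → ℂ)}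
    {a : C(I, Fin n → Fin n → ℂ)}
    (h : ∀ ε > 0, ∃ b ∈ S, ∀ t i j, ‖b t i j - a t i j‖ ≤ ε) : a ∈ closure S := by
  refine Metric.mem_closure_iff.2 fun ε hε => ?_
  obtain ⟨b, hb, hba⟩ := h (ε / 2) (by positivity)
  refine ⟨b, hb, lt_of_le_of_lt ?_ (half_lt_self hε)⟩
  rw [dist_comm]
  refine (ContinuousMap.dist_le (by positivity)).2 fun t => ?_
  rw [dist_eq_norm]
  exact (pi_norm_le_iff_of_nonneg (by positivity)).2 fun i =>
    (pi_norm_le_iff_of_nonneg (by positivity)).2 fun j => hba t i j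

theorem IntervalAlgebra.mem_closure {n : ℕ} {S : Set (IntervalAlgebra n)} {a : IntervalAlgebra n}
    (h : ∀ ε > 0, ∃ b ∈ S, ∀ t i j, ‖b t i j - a t i j‖ ≤ ε) : a ∈ closure S :=
  ContinuousMap.mem_closure_of_pi (n := n) h

/-! ### Matrix frames and the approximating subalgebras -/

section Frame

variable {n : ℕ}

/-- The matrix functions whose `(i, j)` entry vanishes outside `U i ∩ U j`. -/
def blockAlgebra (U : Fin n → Set I) : NonUnitalStarSubalgebra ℂ (IntervalAlgebra n) where
  carrier := {F | ∀ t i j, F t i j ≠ 0 → t ∈ U i ∧ t ∈ U j}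
  add_mem' {F G} hF hG t i j h := by
    by_cases h0 : F t i j = 0
    · refine hG t i j fun h1 => h ?_
      rw [ContinuousMap.add_apply, Matrix.add_apply, h0, h1, add_zero]
    · exact hF t i j h0
  zero_mem' t i j h := absurd rfl h
  mul_mem' {F G} hF hG t i j h := by
    rw [ContinuousMap.mul_apply, Matrix.mul_apply] at h
    obtain ⟨k, -, hk⟩ := Finset.exists_ne_zero_of_sum_ne_zero h
    exact ⟨(hF t i k (left_ne_zero_of_mul hk)).1, (hG t k j (right_ne_zero_of_mul hk)).2⟩
  smul_mem' c F hF t i j h := by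
    refine hF t i j fun h0 => h ?_
    rw [ContinuousMap.smul_apply, Matrix.smul_apply, h0, smul_zero]
  star_mem' {F} hF t i j h := by
    refine (hF t j i fun h0 => h ?_).symm
    rw [ContinuousMap.star_apply, Matrix.star_apply, h0, star_zero]

theorem mem_blockAlgebra {U : Fin n → Set I} {F : IntervalAlgebra n} :
    F ∈ blockAlgebra U ↔ ∀ t i j, F t i j ≠ 0 → t ∈ U i ∧ t ∈ U j := Iff.rfl

theorem IntervalAlgebra.continuous_entry (t : I) (i j : Fin n) :
    Continuous fun F : IntervalAlgebra n => F t i j :=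
  (ContinuousEvalConst.continuous_eval_const t).matrix_elem i j

/-- The matrix function with `(i, j)` entry `f` and all other entries `0`. -/
noncomputable def coordFun (f : C(I, ℂ)) (i j : Fin n) : IntervalAlgebra n :=
  ⟨fun t => Matrix.single i j (f t), by
    refine continuous_matrix fun k l => ?_
    simp only [Matrix.single_apply]
    split_ifs <;> fun_prop⟩

/-- A field of partial isometries that identifies `A` with `blockAlgebra U`. -/
structure IsMatrixFrame (A : NonUnitalStarSubalgebra ℂ (IntervalAlgebra n)) (U : Fin n → Set I)
    (W : I → Matrix (Fin n) (Fin n) ℂ) : Prop where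
  isOpen (i : Fin n) : IsOpen (U i)
  gram (t : I) : (W t)ᴴ * W t = Matrix.diagonal fun i => (U i).indicator 1 t
  eq_zero (t : I) (i : Fin n) (ht : t ∉ U i) (k : Fin n) : W t k i = 0
  norm_le (t : I) (k i : Fin n) : ‖W t k i‖ ≤ 1
  exists_mem (F : IntervalAlgebra n) (hF : F ∈ blockAlgebra U) :
    ∃ a ∈ A, ∀ t, a t = W t * F t * (W t)ᴴ
  continuous_coeff (a : IntervalAlgebra n) (ha : a ∈ A) : Continuous fun t => (W t)ᴴ * a t * W t
  expand (a : IntervalAlgebra n) (ha : a ∈ A) (t : I) :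
    W t * ((W t)ᴴ * a t * W t) * (W t)ᴴ = a t

namespace IsMatrixFrame

variable {A : NonUnitalStarSubalgebra ℂ (IntervalAlgebra n)} {U : Fin n → Set I}
  {W : I → Matrix (Fin n) (Fin n) ℂ}

theorem gram_mul (h : IsMatrixFrame A U W) (t : I) : (W t)ᴴ * W t * (W t)ᴴ = (W t)ᴴ := by
  rw [h.gram]
  ext i k
  rw [Matrix.diagonal_mul, Matrix.conjTranspose_apply]
  by_cases ht : t ∈ U i
  · simp [ht]
  · rw [h.eq_zero t i ht]; simp

theorem mul_gram (h : IsMatrixFrame A U W) (t : I) : W t * ((W t)ᴴ * W t) = W t := by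
  have := congrArg Matrix.conjTranspose (h.gram_mul t)
  simpa [Matrix.conjTranspose_mul, Matrix.mul_assoc] using this

/-- The initial projection W*W fixes W*, and elements of A are recovered from their coefficients, so
compression by W is multiplicative as soon as one factor lies in A. The other factor is arbitrary,
which is what heredity of `cut` requires. -/
theorem conj_mul (h : IsMatrixFrame A U W) {a : IntervalAlgebra n} (ha : a ∈ A) (t : I)
    (b : Matrix (Fin n) (Fin n) ℂ) :
    (W t)ᴴ * (a t * b) * W t = ((W t)ᴴ * a t * W t) * ((W t)ᴴ * b * W t) := by
  conv_lhs => rw [← h.expand a ha t]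
  have := h.gram_mul t
  calc _ = ((W t)ᴴ * W t * (W t)ᴴ) * a t * W t * ((W t)ᴴ * b * W t) := by
        simp only [Matrix.mul_assoc]
    _ = _ := by rw [this]

theorem mul_conj (h : IsMatrixFrame A U W) {a : IntervalAlgebra n} (ha : a ∈ A) (t : I)
    (b : Matrix (Fin n) (Fin n) ℂ) :
    (W t)ᴴ * (b * a t) * W t = ((W t)ᴴ * b * W t) * ((W t)ᴴ * a t * W t) := by
  conv_lhs => rw [← h.expand a ha t]
  have := h.mul_gram t
  calc _ = (W t)ᴴ * b * W t * ((W t)ᴴ * a t * (W t * ((W t)ᴴ * W t))) := by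
        simp only [Matrix.mul_assoc]
    _ = _ := by rw [this]

theorem conj_star (t : I) (a : IntervalAlgebra n) :
    (W t)ᴴ * (star a) t * W t = ((W t)ᴴ * a t * W t)ᴴ := by
  rw [ContinuousMap.star_apply, Matrix.star_eq_conjTranspose, Matrix.conjTranspose_mul, Matrix.conjTranspose_mul,
    Matrix.conjTranspose_conjTranspose, Matrix.mul_assoc]

theorem conj_apply_eq_zero (h : IsMatrixFrame A U W) (a : Matrix (Fin n) (Fin n) ℂ) {t : I}
    {i j : Fin n} (ht : t ∉ U i ∨ t ∉ U j) : ((W t)ᴴ * a * W t) i j = 0 := by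
  rcases ht with ht | ht
  · rw [Matrix.mul_assoc, Matrix.mul_apply]
    refine Finset.sum_eq_zero fun k _ => ?_
    rw [Matrix.conjTranspose_apply, h.eq_zero t i ht, star_zero, zero_mul]
  · rw [Matrix.mul_apply]
    refine Finset.sum_eq_zero fun k _ => ?_
    rw [h.eq_zero t j ht, mul_zero]

/-- The coefficients of an element of `A` in the frame. -/
noncomputable def coeff (h : IsMatrixFrame A U W) (a : A) : IntervalAlgebra n :=
  ⟨fun t => (W t)ᴴ * (a : IntervalAlgebra n) t * W t, h.continuous_coeff a a.2⟩

theorem coeff_mem (h : IsMatrixFrame A U W) (a : A) : h.coeff a ∈ blockAlgebra U := by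
  intro t i j hne
  by_contra ht
  exact hne (h.conj_apply_eq_zero _ (not_and_or.1 ht))

theorem conj_of_eq (h : IsMatrixFrame A U W) {F a : IntervalAlgebra n} (hF : F ∈ blockAlgebra U)
    {t : I} (ha : a t = W t * F t * (W t)ᴴ) : (W t)ᴴ * a t * W t = F t := by
  have h1 : (W t)ᴴ * a t * W t = ((W t)ᴴ * W t) * F t * ((W t)ᴴ * W t) := by
    rw [ha]; simp only [Matrix.mul_assoc]
  rw [h1, h.gram]
  ext i j
  rw [Matrix.mul_diagonal, Matrix.diagonal_mul]
  by_cases h0 : F t i j = 0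
  · rw [h0]; simp
  · obtain ⟨hi, hj⟩ := hF t i j h0
    simp [hi, hj]

/-- The identification of `A` with `blockAlgebra U` given by a frame. -/
noncomputable def equiv (h : IsMatrixFrame A U W) : A ≃⋆ₐ[ℂ] blockAlgebra U where
  toFun a := ⟨h.coeff a, h.coeff_mem a⟩
  invFun F := ⟨(h.exists_mem F F.2).choose, (h.exists_mem F F.2).choose_spec.1⟩
  left_inv a := by
    refine Subtype.ext (ContinuousMap.ext fun t => ?_)
    have := (h.exists_mem (h.coeff a) (h.coeff_mem a)).choose_spec.2 t
    exact this.trans (h.expand a a.2 t)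
  right_inv F := by
    refine Subtype.ext (ContinuousMap.ext fun t => ?_)
    exact h.conj_of_eq F.2 ((h.exists_mem F F.2).choose_spec.2 t)
  map_mul' a b := by
    refine Subtype.ext (ContinuousMap.ext fun t => ?_)
    exact h.conj_mul a.2 t _
  map_add' a b := by
    refine Subtype.ext (ContinuousMap.ext fun t => ?_)
    change (W t)ᴴ * ((a : IntervalAlgebra n) t + (b : IntervalAlgebra n) t) * W t = _
    rw [Matrix.mul_add, Matrix.add_mul]
    rfl
  map_smul' c a := by
    refine Subtype.ext (ContinuousMap.ext fun t => ?_)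
    change (W t)ᴴ * (c • (a : IntervalAlgebra n) t) * W t = _
    rw [Matrix.mul_smul, Matrix.smul_mul]
    rfl
  map_star' a := by
    refine Subtype.ext (ContinuousMap.ext fun t => ?_)
    exact conj_star t _

/-- The elements of `A` whose coefficients are supported in a smaller family of sets. -/
noncomputable def cut (h : IsMatrixFrame A U W) (V : Fin n → Set I) :
    NonUnitalStarSubalgebra ℂ (IntervalAlgebra n) where
  carrier := {a | a ∈ A ∧ ∀ t i j, ((W t)ᴴ * a t * W t) i j ≠ 0 → t ∈ V i ∧ t ∈ V j}
  add_mem' {a b} ha hb := by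
    refine ⟨A.add_mem ha.1 hb.1, fun t i j hne => ?_⟩
    rw [ContinuousMap.add_apply, Matrix.mul_add, Matrix.add_mul, Matrix.add_apply] at hne
    by_cases h0 : ((W t)ᴴ * a t * W t) i j = 0
    · exact hb.2 t i j fun h1 => hne (by rw [h0, h1, add_zero])
    · exact ha.2 t i j h0
  zero_mem' := ⟨A.zero_mem, fun t i j hne => absurd (by simp) hne⟩
  mul_mem' {a b} ha hb := by
    refine ⟨A.mul_mem ha.1 hb.1, fun t i j hne => ?_⟩
    rw [ContinuousMap.mul_apply, h.conj_mul ha.1, Matrix.mul_apply] at hne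
    obtain ⟨k, -, hk⟩ := Finset.exists_ne_zero_of_sum_ne_zero hne
    exact ⟨(ha.2 t i k (left_ne_zero_of_mul hk)).1, (hb.2 t k j (right_ne_zero_of_mul hk)).2⟩
  smul_mem' c a ha := by
    refine ⟨SMulMemClass.smul_mem c ha.1, fun t i j hne => ?_⟩
    rw [ContinuousMap.smul_apply, Matrix.mul_smul, Matrix.smul_mul, Matrix.smul_apply] at hne
    exact ha.2 t i j fun h1 => hne (by rw [h1, smul_zero])
  star_mem' {a} ha := by
    refine ⟨star_mem ha.1, fun t i j hne => ?_⟩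
    rw [conj_star, Matrix.conjTranspose_apply] at hne
    exact (ha.2 t j i fun h1 => hne (by rw [h1, star_zero])).symm

theorem mem_cut (h : IsMatrixFrame A U W) {V : Fin n → Set I} {a : IntervalAlgebra n} :
    a ∈ h.cut V ↔ a ∈ A ∧ ∀ t i j, ((W t)ᴴ * a t * W t) i j ≠ 0 → t ∈ V i ∧ t ∈ V j := Iff.rfl

/-- The coefficients of bab' are products of those of b, a and b': the row condition is inherited
from b and the column condition from b'. Closedness holds because the constraints are pointwise
linear equations. -/
theorem isHereditary_cut (h : IsMatrixFrame A U W) (hA : IsHereditary A) (V : Fin n → Set I) :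
    IsHereditary (h.cut V) where
  isClosed := by
    have heq : (h.cut V : Set (IntervalAlgebra n)) = (A : Set (IntervalAlgebra n)) ∩
        ⋂ (t : I) (i : Fin n) (j : Fin n) (_ : ¬ (t ∈ V i ∧ t ∈ V j)),
          {a | ((W t)ᴴ * a t * W t) i j = 0} := by
      ext a
      simp only [Set.mem_inter_iff, Set.mem_iInter, SetLike.mem_coe, mem_cut]
      exact and_congr_right fun _ => forall_congr' fun t => forall₂_congr fun i j => not_imp_comm
    rw [heq]
    refine hA.isClosed.inter (isClosed_iInter fun t => isClosed_iInter fun i => isClosed_iInter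
      fun j => isClosed_iInter fun _ => isClosed_eq ?_ continuous_const)
    have h1 : Continuous fun a : IntervalAlgebra n => a t := ContinuousEvalConst.continuous_eval_const t
    exact (((continuous_const (y := (W t)ᴴ)).matrix_mul h1).matrix_mul
      (continuous_const (y := W t))).matrix_elem i j
  mul_mul_mem b hb b' hb' a := by
    refine ⟨hA.mul_mul_mem b hb.1 b' hb'.1 a, fun t i j hne => ?_⟩
    rw [ContinuousMap.mul_apply, h.mul_conj hb'.1, ContinuousMap.mul_apply, h.conj_mul hb.1,
      Matrix.mul_apply] at hne
    obtain ⟨k, -, hk⟩ := Finset.exists_ne_zero_of_sum_ne_zero hne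
    have h1 := left_ne_zero_of_mul hk
    rw [Matrix.mul_apply] at h1
    obtain ⟨l, -, hl⟩ := Finset.exists_ne_zero_of_sum_ne_zero h1
    exact ⟨(hb.2 t i l (left_ne_zero_of_mul hl)).1, (hb'.2 t k j (right_ne_zero_of_mul hk)).2⟩

theorem cut_mono (h : IsMatrixFrame A U W) {V V' : Fin n → Set I} (hV : ∀ i, V i ⊆ V' i) :
    h.cut V ≤ h.cut V' := fun _ ha =>
  ⟨ha.1, fun t i j hne => ⟨hV i (ha.2 t i j hne).1, hV j (ha.2 t i j hne).2⟩⟩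

theorem mem_cut_of_eq (h : IsMatrixFrame A U W) {V : Fin n → Set I} (hV : ∀ i, V i ⊆ U i)
    {F a : IntervalAlgebra n} (hF : F ∈ blockAlgebra V) (haA : a ∈ A)
    (ha : ∀ t, a t = W t * F t * (W t)ᴴ) : a ∈ h.cut V := by
  refine ⟨haA, fun t i j hne => ?_⟩
  have hFU : F ∈ blockAlgebra U := fun s k l hkl => ⟨hV k (hF s k l hkl).1, hV l (hF s k l hkl).2⟩
  rw [h.conj_of_eq hFU (ha t)] at hne
  exact hF t i j hne

end IsMatrixFrame

/-- The columns of a field of matrices. -/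
noncomputable def colVec (W : I → Matrix (Fin n) (Fin n) ℂ) (t : I) (i : Fin n) :
    EuclideanSpace ℂ (Fin n) :=
  WithLp.toLp 2 fun k => W t k i

theorem blockAlgebra_mono {U V : Fin n → Set I} (h : ∀ i, V i ⊆ U i) :
    blockAlgebra V ≤ blockAlgebra U := fun _ hF s k l hkl =>
  ⟨h k (hF s k l hkl).1, h l (hF s k l hkl).2⟩

theorem coordFun_mem {U : Fin n → Set I} {f : C(I, ℂ)} {i j : Fin n}
    (h : ∀ t, f t ≠ 0 → t ∈ U i ∧ t ∈ U j) : coordFun f i j ∈ blockAlgebra U := by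
  intro t k l hne
  change Matrix.single i j (f t) k l ≠ 0 at hne
  rw [Matrix.single_apply] at hne
  split_ifs at hne with h1
  · rw [← h1.1, ← h1.2]; exact h t hne
  · exact absurd rfl hne

namespace IsMatrixFrame

variable {A : NonUnitalStarSubalgebra ℂ (IntervalAlgebra n)} {U : Fin n → Set I}
  {W : I → Matrix (Fin n) (Fin n) ℂ}

theorem inner_colVec (h : IsMatrixFrame A U W) (t : I) (i j : Fin n) :
    ⟪colVec W t i, colVec W t j⟫_ℂ = if i = j then (U i).indicator 1 t else 0 := by
  have h1 := congrFun (congrFun (h.gram t) i) j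
  rw [Matrix.diagonal_apply, Matrix.mul_apply] at h1
  rw [← h1, PiLp.inner_apply]
  refine Finset.sum_congr rfl fun k _ => ?_
  rw [Matrix.conjTranspose_apply, RCLike.inner_apply, mul_comm]
  rfl

/-- An element maps into the span of the columns whose index set contains t, by its expansion in the
frame. Conversely, a bump in the diagonal entry (i, i) gives an element that fixes the i-th column
at t. -/
theorem supportSpace_cut (h : IsMatrixFrame A U W) {V : Fin n → Set I} (hVo : ∀ i, IsOpen (V i))
    (hV : ∀ i, V i ⊆ U i) (t : I) :
    supportSpace (h.cut V) t =
      Submodule.span ℂ (Set.range fun i : {i // t ∈ V i} => colVec W t i) := by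
  refine le_antisymm (Submodule.span_le.2 ?_) (Submodule.span_le.2 ?_)
  · rintro _ ⟨b, hb, v, rfl⟩
    set y : Fin n → ℂ := (((W t)ᴴ * b t * W t) * (W t)ᴴ) *ᵥ WithLp.ofLp v with hy
    have hy0 : ∀ i, t ∉ V i → y i = 0 := by
      intro i hi
      rw [hy, Matrix.mulVec, dotProduct]
      refine Finset.sum_eq_zero fun k _ => ?_
      rw [Matrix.mul_apply, Finset.sum_eq_zero, zero_mul]
      intro l _
      rw [not_not.1 (mt (hb.2 t i l) fun h1 => hi h1.1), zero_mul]
    have h1 : Matrix.toEuclideanLin (b t) v = ∑ i, y i • colVec W t i := by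
      have h2 : b t *ᵥ WithLp.ofLp v = W t *ᵥ y := by
        rw [hy, Matrix.mulVec_mulVec, ← Matrix.mul_assoc, h.expand b hb.1 t]
      ext k
      rw [Matrix.toLpLin_apply, h2]
      simp [Matrix.mulVec, dotProduct, colVec, mul_comm]
    rw [h1]
    refine Submodule.sum_mem _ fun i _ => ?_
    by_cases hi : t ∈ V i
    · exact Submodule.smul_mem _ _ (Submodule.subset_span ⟨⟨i, hi⟩, rfl⟩)
    · rw [hy0 i hi, zero_smul]; exact Submodule.zero_mem _
  · rintro _ ⟨⟨i, hi⟩, rfl⟩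
    obtain ⟨f, hf1, hf0⟩ := exists_bump (V i) (hVo i) hi
    have hmem : coordFun f i i ∈ blockAlgebra V := coordFun_mem fun s hs =>
      ⟨not_not.1 (mt (hf0 s) hs), not_not.1 (mt (hf0 s) hs)⟩
    obtain ⟨a, ha, haF⟩ := h.exists_mem _ (blockAlgebra_mono hV hmem)
    refine Submodule.subset_span ⟨a, h.mem_cut_of_eq hV hmem ha haF, colVec W t i, ?_⟩
    ext k
    have h3 : (W t)ᴴ *ᵥ (fun k => W t k i) = Pi.single i 1 := by
      ext j
      have h1 := congrFun (congrFun (h.gram t) j) i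
      rw [Matrix.diagonal_apply, Matrix.mul_apply] at h1
      rw [Matrix.mulVec, dotProduct, h1, Pi.single_apply]
      by_cases hij : j = i
      · subst hij; simp [hV _ hi]
      · simp [hij]
    have h4 : coordFun f i i t = Matrix.single i i 1 := by
      change Matrix.single i i (f t) = _
      rw [hf1]
    rw [Matrix.toLpLin_apply, haF, h4]
    change W t k i = ((W t * Matrix.single i i 1 * (W t)ᴴ) *ᵥ fun k => W t k i) k
    rw [← Matrix.mulVec_mulVec, h3, Matrix.mulVec_single_one, Matrix.col_apply, Matrix.mul_apply]
    simp [Matrix.single_apply]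

/-- The columns involved are orthonormal, so the rank just counts the sets that contain t. -/
theorem finrank_supportSpace_cut (h : IsMatrixFrame A U W) {V : Fin n → Set I}
    (hVo : ∀ i, IsOpen (V i)) (hV : ∀ i, V i ⊆ U i) (t : I) :
    supportRank (h.cut V) t = Nat.card {i // t ∈ V i} := by
  classical
  rw [supportRank, supportProjection, Submodule.range_starProjection, h.supportSpace_cut hVo hV,
    Nat.card_eq_fintype_card]
  refine finrank_span_eq_card (Orthonormal.linearIndependent (𝕜 := ℂ) ?_)
  rw [orthonormal_iff_ite]
  rintro ⟨i, hi⟩ ⟨j, hj⟩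
  rw [h.inner_colVec]
  simp [hV i hi]

/-- Each coefficient function is replaced by one with compact support in U i ∩ U j. There are
finitely many entries, so a single stage of the exhaustions contains all these supports. -/
theorem exists_approximation (h : IsMatrixFrame A U W) (hA : IsHereditary A) :
    ∃ V : ℕ → Fin n → Set I, (∀ k i, IsOpen (V k i)) ∧ (∀ k i, V k i ⊆ U i) ∧
      (∀ k, IsFiniteStep fun t i => t ∈ V k i) ∧ Monotone (fun k => h.cut (V k)) ∧
      (A : Set (IntervalAlgebra n)) = closure (⋃ k, (h.cut (V k) : Set (IntervalAlgebra n))) := by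
  choose V hV using fun i => exists_isExhaustion (h.isOpen i)
  refine ⟨fun k i => V i k, fun k i => (hV i).isOpen k, fun k i => (hV i).subset k,
    fun k => IsFiniteStep.pi fun i => (hV i).isFiniteStep k,
    fun k l hkl => h.cut_mono fun i => (hV i).mono hkl, subset_antisymm (fun a ha => ?_) ?_⟩
  swap
  · exact closure_minimal (Set.iUnion_subset fun k a ha => ha.1) hA.isClosed
  refine IntervalAlgebra.mem_closure fun ε hε => ?_
  set F := h.coeff ⟨a, ha⟩ with hF
  have hFU : F ∈ blockAlgebra U := h.coeff_mem _
  -- An entry of the error is a sum of n² terms, each at most δ because the entries of W have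
  -- modulus at most one.
  set δ : ℝ := ε / ((n : ℝ) ^ 2 + 1) with hδ
  have hδ0 : 0 < δ := by positivity
  choose G K hK hKF hGK hGF using fun i j => exists_compact_cutoff
    ⟨fun t => F t i j, F.continuous.matrix_elem i j⟩ hδ0
  choose N hN using fun i j => (hV i).exists_subset (hK i j) fun t ht => (hFU t i j (hKF i j t ht)).1
  choose N' hN' using fun i j => (hV j).exists_subset (hK i j) fun t ht => (hFU t i j (hKF i j t ht)).2
  obtain ⟨M, hM⟩ : ∃ M, ∀ i j, N i j ≤ M ∧ N' i j ≤ M := by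
    refine ⟨∑ i, ∑ j, (N i j + N' i j), fun i j => ?_⟩
    have h1 : N i j + N' i j ≤ ∑ j, (N i j + N' i j) :=
      Finset.single_le_sum (f := fun j => N i j + N' i j) (fun _ _ => Nat.zero_le _) (Finset.mem_univ j)
    have h2 : ∑ j, (N i j + N' i j) ≤ ∑ i, ∑ j, (N i j + N' i j) :=
      Finset.single_le_sum (f := fun i => ∑ j, (N i j + N' i j)) (fun _ _ => Nat.zero_le _) (Finset.mem_univ i)
    omega
  let G' : IntervalAlgebra n := ⟨fun t => Matrix.of fun i j => G i j t,
    continuous_matrix fun i j => (G i j).continuous⟩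
  have hG' : G' ∈ blockAlgebra fun i => V i M := by
    intro t i j hne
    have ht : t ∈ K i j := by
      by_contra ht
      exact hne (hGK i j t ht)
    exact ⟨hN i j M (hM i j).1 ht, hN' i j M (hM i j).2 ht⟩
  obtain ⟨b, hb, hbG⟩ := h.exists_mem G' (blockAlgebra_mono (fun i => (hV i).subset M) hG')
  refine ⟨b, Set.mem_iUnion.2 ⟨M, h.mem_cut_of_eq (fun i => (hV i).subset M) hG' hb hbG⟩,
    fun t k l => ?_⟩
  have h1 : b t - a t = W t * (G' t - F t) * (W t)ᴴ := by
    rw [hbG, ← h.expand a ha t, Matrix.mul_sub, Matrix.sub_mul]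
    rfl
  have h2 : b t k l - a t k l = ∑ j, (∑ i, W t k i * (G i j t - F t i j)) * star (W t l j) := by
    rw [← Matrix.sub_apply, h1, Matrix.mul_apply]
    refine Finset.sum_congr rfl fun j _ => ?_
    rw [Matrix.mul_apply]
    rfl
  rw [h2]
  calc _ ≤ ∑ j : Fin n, ∑ i : Fin n, δ := by
        refine (norm_sum_le _ _).trans (Finset.sum_le_sum fun j _ => ?_)
        rw [norm_mul, norm_star]
        refine (mul_le_of_le_one_right (norm_nonneg _) (h.norm_le t l j)).trans ?_
        refine (norm_sum_le _ _).trans (Finset.sum_le_sum fun i _ => ?_)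
        rw [norm_mul]
        exact (mul_le_of_le_one_left (norm_nonneg _) (h.norm_le t k i)).trans (hGF i j t)
    _ = (n : ℝ) ^ 2 * δ := by simp; ring
    _ ≤ ε := by
        rw [hδ, mul_div_assoc', div_le_iff₀ (by positivity)]
        nlinarith

end IsMatrixFrame

/-- The algebra `blockAlgebra U` is hereditary. -/
theorem isHereditary_blockAlgebra (U : Fin n → Set I) : IsHereditary (blockAlgebra U) where
  isClosed := by
    have heq : (blockAlgebra U : Set (IntervalAlgebra n)) =
        ⋂ (t : I) (i : Fin n) (j : Fin n) (_ : ¬ (t ∈ U i ∧ t ∈ U j)), {a | a t i j = 0} := by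
      ext a
      simp only [Set.mem_iInter, SetLike.mem_coe, mem_blockAlgebra]
      exact forall_congr' fun t => forall₂_congr fun i j => not_imp_comm
    rw [heq]
    exact isClosed_iInter fun t => isClosed_iInter fun i => isClosed_iInter
      fun j => isClosed_iInter fun _ => isClosed_eq (IntervalAlgebra.continuous_entry t i j)
        continuous_const
  mul_mul_mem b hb b' hb' a t i j hne := by
    rw [ContinuousMap.mul_apply, Matrix.mul_apply] at hne
    obtain ⟨k, -, hk⟩ := Finset.exists_ne_zero_of_sum_ne_zero hne
    have h1 := left_ne_zero_of_mul hk
    rw [ContinuousMap.mul_apply, Matrix.mul_apply] at h1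
    obtain ⟨l, -, hl⟩ := Finset.exists_ne_zero_of_sum_ne_zero h1
    exact ⟨(hb t i l (left_ne_zero_of_mul hl)).1, (hb' t k j (right_ne_zero_of_mul hk)).2⟩

open Classical in
-- The model algebra has the obvious frame of standard basis vectors, switched off outside the sets
-- U i. The approximation results for frames thus apply to it as well, now with piecewise constant
-- columns.
theorem isMatrixFrame_blockAlgebra {U : Fin n → Set I} (hU : ∀ i, IsOpen (U i)) :
    IsMatrixFrame (blockAlgebra U) U fun t => Matrix.diagonal fun i => (U i).indicator 1 t := by
  have hstar : ∀ t, (Matrix.diagonal fun i => (U i).indicator (1 : I → ℂ) t)ᴴ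
      = Matrix.diagonal fun i => (U i).indicator (1 : I → ℂ) t := by
    intro t
    rw [Matrix.diagonal_conjTranspose]
    congr 1
    ext i
    by_cases h : t ∈ U i <;> simp [h]
  have hconj : ∀ F ∈ blockAlgebra U, ∀ t, (Matrix.diagonal fun i => (U i).indicator (1 : I → ℂ) t)
      * F t * (Matrix.diagonal fun i => (U i).indicator (1 : I → ℂ) t) = F t := by
    intro F hF t
    ext i j
    rw [Matrix.mul_diagonal, Matrix.diagonal_mul]
    by_cases h0 : F t i j = 0
    · rw [h0]; simp
    · obtain ⟨hi, hj⟩ := hF t i j h0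
      simp [hi, hj]
  refine ⟨hU, fun t => ?_, fun t i ht k => ?_, fun t k i => ?_, fun F hF => ⟨F, hF, fun t => ?_⟩,
    fun a ha => ?_, fun a ha t => ?_⟩
  · rw [hstar, Matrix.diagonal_mul_diagonal]
    congr 1
    ext i
    by_cases h : t ∈ U i <;> simp [h]
  · rw [Matrix.diagonal_apply]
    split_ifs with h
    · subst h; simp [ht]
    · rfl
  · rw [Matrix.diagonal_apply]
    split_ifs
    · by_cases h : t ∈ U k <;> simp [h]
    · simp
  · rw [hstar, hconj F hF]
  · simp_rw [hstar, hconj a ha]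
    exact a.continuous
  · rw [hstar, hconj a ha, hconj a ha]

/-- The support space at t is spanned by the standard basis vectors with t ∈ V i, so the projection
depends on t only through this set of indices. -/
theorem isFiniteStep_supportProjection_cut {U V : Fin n → Set I} (hU : ∀ i, IsOpen (U i))
    (hVo : ∀ i, IsOpen (V i)) (hV : ∀ i, V i ⊆ U i) (hs : IsFiniteStep fun t i => t ∈ V i) :
    IsFiniteStep (supportProjection ((isMatrixFrame_blockAlgebra hU).cut V)) := by
  classical
  have key : ∀ t, supportSpace ((isMatrixFrame_blockAlgebra hU).cut V) t =
      (fun x : Fin n → Prop => Submodule.span ℂ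
        (Set.range fun i : {i // x i} => EuclideanSpace.single (i : Fin n) (1 : ℂ)))
        (fun i => t ∈ V i) := by
    intro t
    rw [(isMatrixFrame_blockAlgebra hU).supportSpace_cut hVo hV]
    congr 2
    ext i k
    have hi := hV _ i.2
    by_cases h : k = i
    · subst h; simp [colVec, hi]
    · simp [colVec, h]
  have h1 := hs.comp (fun x : Fin n → Prop => (Submodule.span ℂ
        (Set.range fun i : {i // x i} => EuclideanSpace.single (i : Fin n) (1 : ℂ))).starProjection)
  have h2 : supportProjection ((isMatrixFrame_blockAlgebra hU).cut V) =
      fun t => (fun x : Fin n → Prop => (Submodule.span ℂ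
        (Set.range fun i : {i // x i} => EuclideanSpace.single (i : Fin n) (1 : ℂ))).starProjection)
        (fun i => t ∈ V i) := by
    funext t
    simp only [supportProjection, key]
  rw [h2]
  exact h1

theorem exists_approximation_of_isMatrixFrame {A : NonUnitalStarSubalgebra ℂ (IntervalAlgebra n)}
    (hA : IsHereditary A) {U : Fin n → Set I} {W : I → Matrix (Fin n) (Fin n) ℂ}
    (h : IsMatrixFrame A U W) :
    (∃ B : ℕ → NonUnitalStarSubalgebra ℂ (IntervalAlgebra n),
        (∀ k, IsStepHereditary (B k)) ∧ Monotone B ∧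
        (A : Set (IntervalAlgebra n)) = closure (⋃ k, (B k : Set (IntervalAlgebra n)))) ∧
      (∃ (A' : NonUnitalStarSubalgebra ℂ (IntervalAlgebra n))
          (B : ℕ → NonUnitalStarSubalgebra ℂ (IntervalAlgebra n)),
        IsHereditary A' ∧ Nonempty (A ≃⋆ₐ[ℂ] A') ∧
        (∀ k, IsStrictlyStepHereditary (B k)) ∧ Monotone B ∧
        (A' : Set (IntervalAlgebra n)) = closure (⋃ k, (B k : Set (IntervalAlgebra n)))) := by
  constructor
  · obtain ⟨V, hVo, hV, hs, hm, hc⟩ := h.exists_approximation hA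
    refine ⟨_, fun k => ⟨h.isHereditary_cut hA _, ?_⟩, hm, hc⟩
    have h1 : supportRank (h.cut (V k)) = fun t => Nat.card {i // t ∈ V k i} := funext fun t =>
      h.finrank_supportSpace_cut (hVo k) (hV k) t
    rw [h1]
    exact (hs k).comp fun x : Fin n → Prop => Nat.card {i // x i}
  · have h' := isMatrixFrame_blockAlgebra h.isOpen
    obtain ⟨V, hVo, hV, hs, hm, hc⟩ := h'.exists_approximation (isHereditary_blockAlgebra U)
    exact ⟨blockAlgebra U, _, isHereditary_blockAlgebra U, ⟨h.equiv⟩, fun k =>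
      ⟨h'.isHereditary_cut (isHereditary_blockAlgebra U) _,
        isFiniteStep_supportProjection_cut h.isOpen (hVo k) (hV k) (hs k)⟩, hm, hc⟩

end Frame

/-! ### The section module of a hereditary subalgebra -/

section SectionSpace

variable {n : ℕ}

/-- The pointwise action of matrix functions on vector functions. -/
noncomputable def IntervalAlgebra.act (a : IntervalAlgebra n)
    (ζ : C(I, EuclideanSpace ℂ (Fin n))) : C(I, EuclideanSpace ℂ (Fin n)) :=
  ⟨fun t => WithLp.toLp 2 (a t *ᵥ WithLp.ofLp (ζ t)), by
    have h1 : Continuous fun t => WithLp.ofLp (ζ t) :=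
      (PiLp.continuous_ofLp 2 _).comp ζ.continuous
    exact (PiLp.continuous_toLp 2 _).comp (a.continuous.matrix_mulVec h1)⟩

/-- The rank-one matrix function `|ξ⟩⟨η|`. -/
noncomputable def IntervalAlgebra.rankOne (ξ η : C(I, EuclideanSpace ℂ (Fin n))) :
    IntervalAlgebra n :=
  ⟨fun t => Matrix.vecMulVec (WithLp.ofLp (ξ t)) (star (WithLp.ofLp (η t))), by
    refine continuous_matrix fun k l => ?_
    simp only [Matrix.vecMulVec_apply, Pi.star_apply]
    have h1 : ∀ (ζ : C(I, EuclideanSpace ℂ (Fin n))) k, Continuous fun t => ζ t k := fun ζ k =>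
      (EuclideanSpace.proj (𝕜 := ℂ) k).continuous.comp ζ.continuous
    exact (h1 ξ k).mul (h1 η l).star⟩

namespace IntervalAlgebra

theorem rankOne_apply (ξ η : C(I, EuclideanSpace ℂ (Fin n))) (t : I) (k l : Fin n) :
    rankOne ξ η t k l = ξ t k * star (η t l) := rfl

theorem continuous_rankOne_left (η : C(I, EuclideanSpace ℂ (Fin n))) :
    Continuous fun ξ => rankOne ξ η := by
  refine ContinuousMap.continuous_of_continuous_uncurry _ ?_
  refine continuous_matrix fun k l => ?_
  have h1 : Continuous fun x : C(I, EuclideanSpace ℂ (Fin n)) × I => x.1 x.2 k :=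
    (EuclideanSpace.proj (𝕜 := ℂ) k).continuous.comp ContinuousEval.continuous_eval
  have h2 : Continuous fun x : C(I, EuclideanSpace ℂ (Fin n)) × I => η x.2 l :=
    (EuclideanSpace.proj (𝕜 := ℂ) l).continuous.comp (η.continuous.comp continuous_snd)
  exact h1.mul h2.star

theorem continuous_rankOne_right (ξ : C(I, EuclideanSpace ℂ (Fin n))) :
    Continuous fun η => rankOne ξ η := by
  refine ContinuousMap.continuous_of_continuous_uncurry _ ?_
  refine continuous_matrix fun k l => ?_
  have h1 : Continuous fun x : C(I, EuclideanSpace ℂ (Fin n)) × I => x.1 x.2 l :=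
    (EuclideanSpace.proj (𝕜 := ℂ) l).continuous.comp ContinuousEval.continuous_eval
  have h2 : Continuous fun x : C(I, EuclideanSpace ℂ (Fin n)) × I => ξ x.2 k :=
    (EuclideanSpace.proj (𝕜 := ℂ) k).continuous.comp (ξ.continuous.comp continuous_snd)
  exact h2.mul h1.star

theorem rankOne_act (a b : IntervalAlgebra n) (ξ η : C(I, EuclideanSpace ℂ (Fin n))) :
    rankOne (a.act ξ) (b.act η) = a * rankOne ξ η * star b := by
  ext t : 1
  change Matrix.vecMulVec (a t *ᵥ WithLp.ofLp (ξ t)) (star (b t *ᵥ WithLp.ofLp (η t))) =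
    a t * Matrix.vecMulVec (WithLp.ofLp (ξ t)) (star (WithLp.ofLp (η t))) * (b t)ᴴ
  rw [Matrix.mul_vecMulVec, Matrix.vecMulVec_mul, Matrix.star_mulVec]

end IntervalAlgebra

open IntervalAlgebra

/-- The closed span of the vector functions `a ζ` with `a ∈ A`. -/
noncomputable def sectionSpace (A : NonUnitalStarSubalgebra ℂ (IntervalAlgebra n)) :
    Submodule ℂ C(I, EuclideanSpace ℂ (Fin n)) :=
  (Submodule.span ℂ {ξ | ∃ a ∈ A, ∃ ζ, ξ = a.act ζ}).topologicalClosure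

variable {A : NonUnitalStarSubalgebra ℂ (IntervalAlgebra n)}

theorem sectionSpace_le {P : Submodule ℂ C(I, EuclideanSpace ℂ (Fin n))}
    (hP : IsClosed (P : Set C(I, EuclideanSpace ℂ (Fin n)))) (h : ∀ a ∈ A, ∀ ζ, a.act ζ ∈ P) :
    sectionSpace A ≤ P := by
  refine Submodule.topologicalClosure_minimal _ (Submodule.span_le.2 ?_) hP
  rintro _ ⟨a, ha, ζ, rfl⟩
  exact h a ha ζ

theorem act_mem_sectionSpace {a : IntervalAlgebra n} (ha : a ∈ A)
    (ζ : C(I, EuclideanSpace ℂ (Fin n))) : a.act ζ ∈ sectionSpace A :=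
  Submodule.le_topologicalClosure _ (Submodule.subset_span ⟨a, ha, ζ, rfl⟩)

/-- For generators, |aζ⟩⟨bζ'| = a|ζ⟩⟨ζ'|b* lies in A by heredity. The general case follows by
linearity and closedness, one variable at a time. -/
theorem rankOne_mem (hA : IsHereditary A) {ξ η : C(I, EuclideanSpace ℂ (Fin n))}
    (hξ : ξ ∈ sectionSpace A) (hη : η ∈ sectionSpace A) : rankOne ξ η ∈ A := by
  let P (η : C(I, EuclideanSpace ℂ (Fin n))) : Submodule ℂ C(I, EuclideanSpace ℂ (Fin n)) :=
    { carrier := {ξ | rankOne ξ η ∈ A}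
      add_mem' := fun {ξ ξ'} h h' => by
        have : rankOne (ξ + ξ') η = rankOne ξ η + rankOne ξ' η := by
          ext t k l; exact add_mul _ _ _
        change rankOne (ξ + ξ') η ∈ A
        rw [this]; exact add_mem h h'
      zero_mem' := by
        have : rankOne 0 η = 0 := by ext t k l; exact zero_mul _
        change rankOne 0 η ∈ A
        rw [this]; exact zero_mem A
      smul_mem' := fun c ξ h => by
        have : rankOne (c • ξ) η = c • rankOne ξ η := by
          ext t k l; exact mul_assoc _ _ _
        change rankOne (c • ξ) η ∈ A
        rw [this]; exact SMulMemClass.smul_mem c h }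
  let Q (ξ : C(I, EuclideanSpace ℂ (Fin n))) : Submodule ℂ C(I, EuclideanSpace ℂ (Fin n)) :=
    { carrier := {η | rankOne ξ η ∈ A}
      add_mem' := fun {η η'} h h' => by
        have : rankOne ξ (η + η') = rankOne ξ η + rankOne ξ η' := by
          ext t k l
          change ξ t k * star (η t l + η' t l) = ξ t k * star (η t l) + ξ t k * star (η' t l)
          rw [star_add, mul_add]
        change rankOne ξ (η + η') ∈ A
        rw [this]; exact add_mem h h'
      zero_mem' := by
        have : rankOne ξ 0 = 0 := by
          ext t k l
          change ξ t k * star (0 : ℂ) = 0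
          rw [star_zero, mul_zero]
        change rankOne ξ 0 ∈ A
        rw [this]; exact zero_mem A
      smul_mem' := fun c η h => by
        have : rankOne ξ (c • η) = star c • rankOne ξ η := by
          ext t k l
          change ξ t k * star (c * η t l) = star c * (ξ t k * star (η t l))
          rw [star_mul']; ring
        change rankOne ξ (c • η) ∈ A
        rw [this]; exact SMulMemClass.smul_mem (star c) h }
  have hP : ∀ η, IsClosed (P η : Set C(I, EuclideanSpace ℂ (Fin n))) := fun η =>
    hA.isClosed.preimage (continuous_rankOne_left η)
  have hQ : ∀ ξ, IsClosed (Q ξ : Set C(I, EuclideanSpace ℂ (Fin n))) := fun ξ =>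
    hA.isClosed.preimage (continuous_rankOne_right ξ)
  refine sectionSpace_le (hQ ξ) (fun b hb ζ' => ?_) hη
  refine sectionSpace_le (hP (b.act ζ')) (fun a ha ζ => ?_) hξ
  change rankOne (a.act ζ) (b.act ζ') ∈ A
  rw [rankOne_act]
  exact hA.mul_mul_mem a ha _ (star_mem hb) _

theorem smul_mem_sectionSpace (f : C(I, ℂ)) {ξ : C(I, EuclideanSpace ℂ (Fin n))}
    (hξ : ξ ∈ sectionSpace A) :
    (⟨fun t => f t • ξ t, by fun_prop⟩ : C(I, EuclideanSpace ℂ (Fin n))) ∈ sectionSpace A := by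
  let L : C(I, EuclideanSpace ℂ (Fin n)) →ₗ[ℂ] C(I, EuclideanSpace ℂ (Fin n)) :=
    { toFun := fun ξ => ⟨fun t => f t • ξ t, by fun_prop⟩
      map_add' := fun ξ η => by ext t : 1; exact smul_add _ _ _
      map_smul' := fun c ξ => by ext t : 1; exact smul_comm (f t) c (ξ t) }
  have hL : Continuous L := by
    refine ContinuousMap.continuous_of_continuous_uncurry _ ?_
    have h1 : Continuous fun x : C(I, EuclideanSpace ℂ (Fin n)) × I => x.1 x.2 :=
      ContinuousEval.continuous_eval
    exact (f.continuous.comp continuous_snd).smul h1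
  have hc : IsClosed (sectionSpace A : Set C(I, EuclideanSpace ℂ (Fin n))) :=
    Submodule.isClosed_topologicalClosure _
  refine sectionSpace_le (P := (sectionSpace A).comap L) (hc.preimage hL) (fun a ha ζ => ?_) hξ
  have : L (a.act ζ) = a.act (L ζ) := by
    ext t k
    change f t * (a t *ᵥ WithLp.ofLp (ζ t)) k = (a t *ᵥ (f t • WithLp.ofLp (ζ t))) k
    rw [Matrix.mulVec_smul]; rfl
  change L (a.act ζ) ∈ sectionSpace A
  rw [this]
  exact act_mem_sectionSpace ha _

/-- The Hilbert field of the support spaces of `A`. -/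
noncomputable def sectionField (A : NonUnitalStarSubalgebra ℂ (IntervalAlgebra n)) :
    HilbertField (sectionSpace A) (fun _ => EuclideanSpace ℂ (Fin n)) where
  ev t :=
    { toFun := fun ξ => (ξ : C(I, EuclideanSpace ℂ (Fin n))) t
      map_add' := fun _ _ => rfl
      map_smul' := fun _ _ => rfl }
  norm_ev_le t ξ := (ξ : C(I, EuclideanSpace ℂ (Fin n))).norm_coe_le_norm t
  norm_le _ _ hC h := (ContinuousMap.norm_le _ hC).2 h
  continuous_inner ξ η := (ξ : C(I, EuclideanSpace ℂ (Fin n))).continuous.inner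
    (η : C(I, EuclideanSpace ℂ (Fin n))).continuous
  exists_smul f ξ := ⟨⟨_, smul_mem_sectionSpace f ξ.2⟩, fun _ => rfl⟩

instance : CompleteSpace (sectionSpace A) :=
  (Submodule.isClosed_topologicalClosure _).completeSpace_coe

theorem inner_toLp_mulVec (a : Matrix (Fin n) (Fin n) ℂ) (x y : EuclideanSpace ℂ (Fin n)) :
    ⟪x, WithLp.toLp 2 (a *ᵥ WithLp.ofLp y)⟫_ℂ = ⟪WithLp.toLp 2 (aᴴ *ᵥ WithLp.ofLp x), y⟫_ℂ := by
  rw [EuclideanSpace.inner_eq_star_dotProduct, EuclideanSpace.inner_eq_star_dotProduct]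
  rw [Matrix.star_mulVec, Matrix.conjTranspose_conjTranspose, dotProduct_comm,
    dotProduct_comm _ (star (WithLp.ofLp x) ᵥ* a), Matrix.dotProduct_mulVec]

/-- In ℂⁿ there are no n + 1 nonzero pairwise orthogonal vectors, so at each point one of ξ₀, …, ξₙ
vanishes; from that index on all members vanish and the expansion stops. -/
theorem exists_orthogonal_sections (A : NonUnitalStarSubalgebra ℂ (IntervalAlgebra n)) :
    ∃ ξ : Fin n → sectionSpace A,
      (∀ i j, i ≠ j → ∀ t, ⟪(sectionField A).ev t (ξ i), (sectionField A).ev t (ξ j)⟫_ℂ = 0) ∧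
      (∀ i η, Continuous fun t => ⟪(sectionField A).unit (ξ i) t, (sectionField A).ev t η⟫_ℂ) ∧
      ∀ t η, (sectionField A).ev t η = ∑ i, ⟪(sectionField A).unit (ξ i) t,
        (sectionField A).ev t η⟫_ℂ • (sectionField A).unit (ξ i) t := by
  -- Approximation of prescribed sections is not needed here, since the expansion is finite; hence
  -- the zero sequence.
  obtain ⟨ξ, horth, hcont, hexp, -⟩ := (sectionField A).exists_frame fun _ => 0
  refine ⟨fun i => ξ i, fun i j hij => horth i j fun h => hij (Fin.ext h), fun i => hcont i,
    fun t η => ?_⟩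
  have h0 : ∃ i ≤ n, (sectionField A).ev t (ξ i) = 0 := by
    by_contra! hne
    have hli : LinearIndependent ℂ fun i : Fin (n + 1) => (sectionField A).ev t (ξ i) := by
      refine linearIndependent_of_ne_zero_of_inner_eq_zero (𝕜 := ℂ)
        (fun i => hne i (Nat.lt_succ_iff.1 i.2)) fun i j hij => horth i j (fun h => hij (Fin.ext h)) t
    have := hli.fintype_card_le_finrank
    simp at this
  obtain ⟨i, hin, hi⟩ := h0
  have hz : ∀ j, i ≤ j → (sectionField A).ev t (ξ j) = 0 := by
    intro j hij
    rw [hexp i t hi (ξ j)]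
    refine Finset.sum_eq_zero fun l hl => ?_
    rw [(sectionField A).inner_unit_eq_zero, zero_smul]
    exact horth l j ((Finset.mem_range.1 hl).trans_le hij).ne t
  rw [Fin.sum_univ_eq_sum_range (fun j => ⟪(sectionField A).unit (ξ j) t,
        (sectionField A).ev t η⟫_ℂ • (sectionField A).unit (ξ j) t) n]
  conv_lhs => rw [hexp i t hi η]
  refine Finset.sum_subset (Finset.range_subset_range.2 hin) fun j _ hj => ?_
  rw [(sectionField A).unit_eq_zero (hz j (by simpa using hj)), smul_zero]

/-- The columns of W are the normalizations of the n orthogonal sections. The work lies in showing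
that coefficients remain continuous although W is not. -/
theorem exists_isMatrixFrame (hA : IsHereditary A) : ∃ U W, IsMatrixFrame A U W := by
  classical
  obtain ⟨ξ, horth, hcont, hexp⟩ := exists_orthogonal_sections A
  set Γ := sectionField A with hΓ
  let W : I → Matrix (Fin n) (Fin n) ℂ := fun t => Matrix.of fun k i => Γ.unit (ξ i) t k
  let U : Fin n → Set I := fun i => {t | Γ.ev t (ξ i) ≠ 0}
  have hgram : ∀ t i j, ((W t)ᴴ * W t) i j = ⟪Γ.unit (ξ i) t, Γ.unit (ξ j) t⟫_ℂ := by
    intro t i j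
    rw [Matrix.mul_apply, PiLp.inner_apply]
    refine Finset.sum_congr rfl fun k _ => ?_
    rw [Matrix.conjTranspose_apply, RCLike.inner_apply, mul_comm]
    rfl
  have hcoeff : ∀ (a : Matrix (Fin n) (Fin n) ℂ) t i j, ((W t)ᴴ * a * W t) i j =
      ⟪Γ.unit (ξ i) t, WithLp.toLp 2 (a *ᵥ WithLp.ofLp (Γ.unit (ξ j) t))⟫_ℂ := by
    intro a t i j
    rw [Matrix.mul_assoc, Matrix.mul_apply, PiLp.inner_apply]
    refine Finset.sum_congr rfl fun k _ => ?_
    rw [Matrix.conjTranspose_apply, RCLike.inner_apply, mul_comm]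
    rfl
  -- The columns of a are values of sections, so the frame expansion applies to each of them.
  have hWW : ∀ a ∈ A, ∀ t, W t * (W t)ᴴ * a t = a t := by
    intro a ha t
    ext k m
    have h1 := hexp t ⟨_, act_mem_sectionSpace ha (ContinuousMap.const I (EuclideanSpace.single m 1))⟩
    have h2 : Γ.ev t ⟨_, act_mem_sectionSpace ha
        (ContinuousMap.const I (EuclideanSpace.single m 1))⟩ = WithLp.toLp 2 fun k => a t k m := by
      ext k
      change (a t *ᵥ Pi.single m 1) k = a t k m
      simp
    rw [h2] at h1
    have h3 := congrArg (fun x : EuclideanSpace ℂ (Fin n) => x k) h1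
    simp only at h3
    rw [h3, WithLp.ofLp_sum, Finset.sum_apply, Matrix.mul_assoc, Matrix.mul_apply]
    refine Finset.sum_congr rfl fun i _ => ?_
    rw [Matrix.mul_apply, PiLp.smul_apply, smul_eq_mul, mul_comm, PiLp.inner_apply]
    congr 1
    refine Finset.sum_congr rfl fun l _ => ?_
    rw [Matrix.conjTranspose_apply, RCLike.inner_apply, mul_comm]
    rfl
  have hWW' : ∀ a ∈ A, ∀ t, a t * (W t * (W t)ᴴ) = a t := by
    intro a ha t
    have h1 := congrArg Matrix.conjTranspose (hWW (star a) (star_mem ha) t)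
    simpa [Matrix.star_eq_conjTranspose, Matrix.conjTranspose_mul, Matrix.mul_assoc] using h1
  refine ⟨U, W, ⟨fun i => ?_, fun t => ?_, fun t i ht k => ?_, fun t k i => ?_, fun F hF => ?_,
    fun a ha => ?_, fun a ha t => ?_⟩⟩
  · have : U i = {t | ‖Γ.ev t (ξ i)‖ ≠ 0} := by ext t; simp [U]
    rw [this]
    exact isOpen_ne_fun (Γ.continuous_norm (ξ i)) continuous_const
  · ext i j
    rw [hgram, Matrix.diagonal_apply]
    split_ifs with hij
    · subst hij
      by_cases ht : t ∈ U i
      · rw [inner_self_eq_norm_sq_to_K, Γ.norm_unit ht]; simp [ht]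
      · rw [Γ.unit_eq_zero (not_not.1 ht)]; simp [ht]
    · rw [HilbertField.unit, HilbertField.unit, inner_smul_left, inner_smul_right, horth i j hij,
        mul_zero, mul_zero]
  · change Γ.unit (ξ i) t k = 0
    rw [Γ.unit_eq_zero (not_not.1 ht)]; rfl
  · exact (PiLp.norm_apply_le _ k).trans (Γ.norm_unit_le (ξ i) t)
  -- Splitting the entry as a product GR gives the field |Gu⟩⟨Ru'|, in which both vectors are
  -- continuous sections although the unit vectors u, u' are not.
  · have hex : ∀ i j, ∃ b ∈ A, ∀ t k l, b t k l = W t k i * F t i j * star (W t l j) := by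
      intro i j
      obtain ⟨R, G, h0, hGR⟩ := exists_mul_eq ⟨fun t => F t i j, F.continuous.matrix_elem i j⟩
      have hFU : ∀ t, (Γ.ev t (ξ i) = 0 ∨ Γ.ev t (ξ j) = 0) → F t i j = 0 := by
        intro t ht
        by_contra hne
        have := hF t i j hne
        rcases ht with ht | ht
        · exact this.1 ht
        · exact this.2 ht
      obtain ⟨ζ, hζ⟩ := Γ.exists_smul_unit G (ξ i) fun t ht => (h0 t (hFU t (Or.inl ht))).2
      obtain ⟨ζ', hζ'⟩ := Γ.exists_smul_unit ⟨fun t => (R t : ℂ), by fun_prop⟩ (ξ j)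
        fun t ht => by
          change ((R t : ℝ) : ℂ) = 0
          rw [(h0 t (hFU t (Or.inr ht))).1, Complex.ofReal_zero]
      refine ⟨rankOne ζ ζ', rankOne_mem hA ζ.2 ζ'.2, fun t k l => ?_⟩
      rw [rankOne_apply]
      have h1 : (ζ : C(I, EuclideanSpace ℂ (Fin n))) t k = G t * W t k i :=
        congrArg (fun x : EuclideanSpace ℂ (Fin n) => x k) (hζ t)
      have h2 : (ζ' : C(I, EuclideanSpace ℂ (Fin n))) t l = (R t : ℂ) * W t l j :=
        congrArg (fun x : EuclideanSpace ℂ (Fin n) => x l) (hζ' t)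
      have h3 : G t * R t = F t i j := hGR t
      have h4 : star ((R t : ℝ) : ℂ) = R t := Complex.conj_ofReal _
      rw [h1, h2, star_mul', h4, ← h3]
      ring
    choose b hbA hb using hex
    refine ⟨∑ i, ∑ j, b i j, sum_mem fun i _ => sum_mem fun j _ => hbA i j, fun t => ?_⟩
    ext k l
    have h5 : (∑ i, ∑ j, b i j : IntervalAlgebra n) t k l = ∑ i, ∑ j, b i j t k l := by
      simp only [ContinuousMap.coe_sum, Finset.sum_apply, Matrix.sum_apply]
    rw [h5, Matrix.mul_apply, Finset.sum_comm]
    refine Finset.sum_congr rfl fun j _ => ?_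
    rw [Matrix.mul_apply, Finset.sum_mul]
    exact Finset.sum_congr rfl fun i _ => hb i j t k l
  · refine continuous_matrix fun i j => ?_
    simp_rw [hcoeff]
    -- Both arguments in ⟨uᵢ, a uⱼ⟩ are discontinuous normalizations. Moving a to the left gives r =
    -- a*uᵢ, which is continuous because its coordinates are conjugate coefficients of the sections
    -- a eₘ along uᵢ.
    let r : I → EuclideanSpace ℂ (Fin n) := fun t =>
      WithLp.toLp 2 ((a t)ᴴ *ᵥ WithLp.ofLp (Γ.unit (ξ i) t))
    have hr : Continuous r := by
      refine (PiLp.continuous_toLp 2 _).comp (continuous_pi fun m => ?_)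
      have h1 := hcont i
        ⟨_, act_mem_sectionSpace ha (ContinuousMap.const I (EuclideanSpace.single m 1))⟩
      have h2 : ∀ t, ((a t)ᴴ *ᵥ WithLp.ofLp (Γ.unit (ξ i) t)) m = star ⟪Γ.unit (ξ i) t, Γ.ev t
          ⟨_, act_mem_sectionSpace ha (ContinuousMap.const I (EuclideanSpace.single m 1))⟩⟫_ℂ := by
        intro t
        have h3 : Γ.ev t ⟨_, act_mem_sectionSpace ha
            (ContinuousMap.const I (EuclideanSpace.single m 1))⟩ =
            WithLp.toLp 2 (a t *ᵥ WithLp.ofLp (EuclideanSpace.single m (1 : ℂ))) := rfl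
        rw [h3, inner_toLp_mulVec]
        change _ = (starRingEnd ℂ) _
        rw [inner_conj_symm, EuclideanSpace.inner_single_left]
        simp
      simp_rw [h2]
      exact h1.star
    have hξi : ∀ t, ((‖Γ.ev t (ξ i)‖ : ℝ) : ℂ) • r t =
        Γ.ev t ⟨_, act_mem_sectionSpace (star_mem ha) (ξ i : C(I, EuclideanSpace ℂ (Fin n)))⟩ := by
      intro t
      have h1 : Γ.ev t ⟨_, act_mem_sectionSpace (star_mem ha)
          (ξ i : C(I, EuclideanSpace ℂ (Fin n)))⟩ =
          WithLp.toLp 2 ((a t)ᴴ *ᵥ WithLp.ofLp (Γ.ev t (ξ i))) := rfl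
      conv_rhs => rw [h1, ← Γ.norm_smul_unit (ξ i) t, WithLp.ofLp_smul, Matrix.mulVec_smul]
      rfl
    -- The field r is even a section: a*ξᵢ = ‖ξᵢ‖r is one, and r is ‖r‖ times its normalization.
    -- Pairing this section with uⱼ is then continuous.
    obtain ⟨ζ, hζ⟩ := Γ.exists_smul_unit ⟨fun t => ((‖r t‖ : ℝ) : ℂ), by fun_prop⟩
      ⟨_, act_mem_sectionSpace (star_mem ha) (ξ i : C(I, EuclideanSpace ℂ (Fin n)))⟩ (by
        intro t ht
        rw [← hξi, smul_eq_zero] at ht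
        rcases ht with ht | ht
        · have h1 : Γ.ev t (ξ i) = 0 := by simpa using ht
          simp [r, Γ.unit_eq_zero h1]
        · simp [ht])
    have hζr : ∀ t, Γ.ev t ζ = r t := by
      intro t
      rw [hζ, HilbertField.unit, ← hξi, norm_smul]
      by_cases h1 : Γ.ev t (ξ i) = 0
      · simp [r, h1, Γ.unit_eq_zero h1]
      · by_cases h2 : r t = 0
        · simp [h2]
        · have h3 : ((‖Γ.ev t (ξ i)‖ : ℝ) : ℂ) ≠ 0 := by simpa using h1
          have h4 : ((‖r t‖ : ℝ) : ℂ) ≠ 0 := by simpa using h2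
          rw [Complex.norm_real, norm_norm, smul_smul, smul_smul, ContinuousMap.coe_mk]
          push_cast
          rw [mul_inv, show ((‖r t‖ : ℝ) : ℂ) * (((‖Γ.ev t (ξ i)‖ : ℝ) : ℂ)⁻¹ * ((‖r t‖ : ℝ) : ℂ)⁻¹)
            * ((‖Γ.ev t (ξ i)‖ : ℝ) : ℂ) = 1 by field_simp, one_smul]
    have h6 : ∀ t, ⟪Γ.unit (ξ i) t, WithLp.toLp 2 (a t *ᵥ WithLp.ofLp (Γ.unit (ξ j) t))⟫_ℂ =
        star ⟪Γ.unit (ξ j) t, Γ.ev t ζ⟫_ℂ := by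
      intro t
      rw [inner_toLp_mulVec, hζr]
      exact (inner_conj_symm _ _).symm
    simp_rw [h6]
    exact (hcont j ζ).star
  · calc _ = W t * (W t)ᴴ * (a t * (W t * (W t)ᴴ)) := by simp only [Matrix.mul_assoc]
      _ = a t := by rw [hWW' a ha, hWW a ha]

end SectionSpace

/-! ### The spectrum of an algebra of block matrices -/

section BlockSpectrum

variable {m : ℕ} {U : Fin (m + 1) → Set I} {B : Type u} [NonUnitalRing B] [StarRing B] [Module ℂ B]

theorem coordFun_apply {n : ℕ} (f : C(I, ℂ)) (i j : Fin n) (t : I) :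
    coordFun f i j t = Matrix.single i j (f t) := rfl

/-- The entries of an element of an algebra of matrix functions. -/
noncomputable def blockEntry (Θ : B →⋆ₙₐ[ℂ] IntervalAlgebra (m + 1)) (b : B) (i j : Fin (m + 1)) :
    C(I, ℂ) :=
  ⟨fun t => Θ b t i j, (Θ b).continuous.matrix_elem i j⟩

/-- The map `Θ` identifies `B` with `blockAlgebra U`, and the first block is full. -/
structure IsBlockModel (Θ : B →⋆ₙₐ[ℂ] IntervalAlgebra (m + 1)) (U : Fin (m + 1) → Set I) :
    Prop where
  injective : Function.Injective Θ
  map_mem (b : B) : Θ b ∈ blockAlgebra U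
  exists_eq (F : IntervalAlgebra (m + 1)) (hF : F ∈ blockAlgebra U) : ∃ b, Θ b = F
  isOpen (i : Fin (m + 1)) : IsOpen (U i)
  eq_univ : U 0 = Set.univ

variable {Θ : B →⋆ₙₐ[ℂ] IntervalAlgebra (m + 1)}

namespace IsBlockModel

variable (hΘ : IsBlockModel Θ U)

include hΘ in
theorem mem_zero {f : C(I, ℂ)} (t : I) (_ : f t ≠ 0) : t ∈ U 0 := by
  rw [hΘ.eq_univ]; exact Set.mem_univ t

/-- The element whose only nonzero column is the zeroth one, with entry `f` in the row `i`. -/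
noncomputable def col (f : C(I, ℂ)) (i : Fin (m + 1)) (h : ∀ t, f t ≠ 0 → t ∈ U i) : B :=
  (hΘ.exists_eq (coordFun f i 0) (coordFun_mem fun t ht => ⟨h t ht, hΘ.mem_zero t ht⟩)).choose

theorem map_col {f : C(I, ℂ)} {i : Fin (m + 1)} (h : ∀ t, f t ≠ 0 → t ∈ U i) :
    Θ (hΘ.col f i h) = coordFun f i 0 :=
  (hΘ.exists_eq (coordFun f i 0)
    (coordFun_mem fun t ht => ⟨h t ht, hΘ.mem_zero t ht⟩)).choose_spec

include hΘ in
theorem entry_ne_zero {b : B} {i j : Fin (m + 1)} {t : I} (h : blockEntry Θ b i j t ≠ 0) :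
    t ∈ U i ∧ t ∈ U j := hΘ.map_mem b t i j h

include hΘ in
theorem ext {a b : B} (h : ∀ t i j, blockEntry Θ a i j t = blockEntry Θ b i j t) : a = b := by
  refine hΘ.injective (ContinuousMap.ext fun t => ?_)
  ext i j
  exact h t i j

end IsBlockModel

theorem blockEntry_mul (a b : B) (i j : Fin (m + 1)) (t : I) :
    blockEntry Θ (a * b) i j t = ∑ k, blockEntry Θ a i k t * blockEntry Θ b k j t := by
  change Θ (a * b) t i j = _
  rw [map_mul, ContinuousMap.mul_apply, Matrix.mul_apply]
  rfl

theorem blockEntry_add (a b : B) (i j : Fin (m + 1)) (t : I) :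
    blockEntry Θ (a + b) i j t = blockEntry Θ a i j t + blockEntry Θ b i j t := by
  change Θ (a + b) t i j = _
  rw [map_add]
  rfl

theorem blockEntry_smul (c : ℂ) (a : B) (i j : Fin (m + 1)) (t : I) :
    blockEntry Θ (c • a) i j t = c * blockEntry Θ a i j t := by
  change Θ (c • a) t i j = _
  rw [map_smul]
  rfl

theorem blockEntry_zero (i j : Fin (m + 1)) (t : I) : blockEntry Θ 0 i j t = 0 := by
  change Θ 0 t i j = _
  rw [map_zero]
  rfl

theorem blockEntry_sum {ι : Type*} (s : Finset ι) (a : ι → B) (i j : Fin (m + 1)) (t : I) :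
    blockEntry Θ (∑ k ∈ s, a k) i j t = ∑ k ∈ s, blockEntry Θ (a k) i j t := by
  classical
  induction s using Finset.induction_on with
  | empty => rw [Finset.sum_empty, Finset.sum_empty, blockEntry_zero]
  | insert k s hk ih => rw [Finset.sum_insert hk, Finset.sum_insert hk, blockEntry_add, ih]

theorem blockEntry_star (a : B) (i j : Fin (m + 1)) (t : I) :
    blockEntry Θ (star a) i j t = star (blockEntry Θ a j i t) := by
  change Θ (star a) t i j = _
  rw [map_star]
  rfl

namespace IsBlockModel

variable (hΘ : IsBlockModel Θ U)

theorem entry_col {f : C(I, ℂ)} {i : Fin (m + 1)} (h : ∀ t, f t ≠ 0 → t ∈ U i)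
    (k l : Fin (m + 1)) (t : I) :
    blockEntry Θ (hΘ.col f i h) k l t = if i = k ∧ 0 = l then f t else 0 := by
  change Θ (hΘ.col f i h) t k l = _
  rw [hΘ.map_col]
  exact Matrix.single_apply ..

/-- The element with `(0, 0)` entry `f` and all other entries `0`. -/
noncomputable def corner (f : C(I, ℂ)) : B := hΘ.col f 0 hΘ.mem_zero

theorem entry_corner (f : C(I, ℂ)) (k l : Fin (m + 1)) (t : I) :
    blockEntry Θ (hΘ.corner f) k l t = if 0 = k ∧ 0 = l then f t else 0 :=
  hΘ.entry_col _ k l t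

theorem mul_col (b : B) {f : C(I, ℂ)} {i : Fin (m + 1)} (h : ∀ t, f t ≠ 0 → t ∈ U i) :
    b * hΘ.col f i h = ∑ k, hΘ.col (blockEntry Θ b k i * f) k
      fun _ ht => (hΘ.entry_ne_zero (left_ne_zero_of_mul ht)).1 := by
  refine hΘ.ext fun t k l => ?_
  rw [blockEntry_mul, blockEntry_sum]
  simp only [hΘ.entry_col, ite_and, mul_ite, mul_zero]
  by_cases hl : 0 = l <;> simp [hl]

/-- Inner products of columns take values in the corner. This determines the Gram matrix of the
vectors π(col)v in any representation once the corner is understood. -/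
theorem star_col_mul_col {f g : C(I, ℂ)} {i j : Fin (m + 1)}
    (hf : ∀ t, f t ≠ 0 → t ∈ U i) (hg : ∀ t, g t ≠ 0 → t ∈ U j) :
    star (hΘ.col f i hf) * hΘ.col g j hg =
      if i = j then hΘ.corner (star f * g) else 0 := by
  refine hΘ.ext fun t k l => ?_
  rw [blockEntry_mul]
  simp only [blockEntry_star, hΘ.entry_col]
  split_ifs with hij
  · subst hij
    rw [hΘ.entry_corner, Finset.sum_eq_single i]
    · by_cases hk : 0 = k <;> by_cases hl : 0 = l <;> simp [hk, hl, apply_ite (starRingEnd ℂ)]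
    · intro b _ hb
      simp [hb.symm]
    · simp
  · rw [blockEntry_zero]
    refine Finset.sum_eq_zero fun b _ => ?_
    by_cases hb : i = b
    · subst hb
      simp [Ne.symm hij]
    · simp [hb]

theorem corner_mul_mul (f g : C(I, ℂ)) (b : B) :
    hΘ.corner f * b * hΘ.corner g = hΘ.corner (f * blockEntry Θ b 0 0 * g) := by
  refine hΘ.ext fun t k l => ?_
  rw [blockEntry_mul]
  simp only [blockEntry_mul, hΘ.entry_corner, ite_and]
  by_cases hk : 0 = k <;> by_cases hl : 0 = l <;> simp [hk, hl]

theorem corner_mul (f g : C(I, ℂ)) :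
    hΘ.corner f * hΘ.corner g = hΘ.corner (f * g) := by
  refine hΘ.ext fun t k l => ?_
  rw [blockEntry_mul]
  simp only [hΘ.entry_corner, ite_and]
  by_cases hk : 0 = k <;> by_cases hl : 0 = l <;> simp [hk, hl]

theorem star_corner (f : C(I, ℂ)) : star (hΘ.corner f) = hΘ.corner (star f) := by
  refine hΘ.ext fun t k l => ?_
  simp only [blockEntry_star, hΘ.entry_corner, ite_and]
  by_cases hk : 0 = k <;> by_cases hl : 0 = l <;> simp [hk, hl, apply_ite (starRingEnd ℂ)]

/-- The corner at index 0 is full: since U 0 is everything, each entry factors through index 0 as a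
column times the adjoint of a column. -/
theorem exists_eq_sum_mul_star (b : B) : ∃ x y : Fin (m + 1) → Fin (m + 1) → B,
    b = ∑ i, ∑ j, x i j * star (y i j) ∧ ∀ i j, x i j * hΘ.corner 1 = x i j := by
  choose R G hRG hmul using fun i j => exists_mul_eq (blockEntry Θ b i j)
  have hG : ∀ i j t, G i j t ≠ 0 → t ∈ U i := fun i j t h =>
    (hΘ.entry_ne_zero fun h1 => h (hRG i j t h1).2).1
  have hR : ∀ i j t, (⟨fun t => (R i j t : ℂ), by fun_prop⟩ : C(I, ℂ)) t ≠ 0 → t ∈ U j :=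
    fun i j t h => (hΘ.entry_ne_zero (i := i) fun h1 => h (by
      change ((R i j t : ℝ) : ℂ) = 0
      rw [(hRG i j t h1).1, Complex.ofReal_zero])).2
  refine ⟨fun i j => hΘ.col (G i j) i (hG i j),
    fun i j => hΘ.col ⟨fun t => (R i j t : ℂ), by fun_prop⟩ j (hR i j), ?_, fun i j => ?_⟩
  · refine hΘ.ext fun t k l => ?_
    simp only [blockEntry_sum, blockEntry_mul, blockEntry_star, hΘ.entry_col]
    rw [Finset.sum_eq_single k, Finset.sum_eq_single l, Finset.sum_eq_single 0]
    · have h1 : star ((R k l t : ℝ) : ℂ) = R k l t := Complex.conj_ofReal _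
      simp only [and_self, if_true, ContinuousMap.coe_mk, h1, hmul]
    · intro c _ hc; simp [hc.symm]
    · simp
    · intro c _ hc; simp [hc]
    · simp
    · intro c _ hc; simp [hc]
    · simp
  · refine hΘ.ext fun t k l => ?_
    simp only [blockEntry_mul, hΘ.entry_col, hΘ.entry_corner, ite_and]
    by_cases hk : i = k <;> by_cases hl : 0 = l <;> simp [hk, hl]

end IsBlockModel

namespace IrrepOf

variable (π : IrrepOf B) (hΘ : IsBlockModel Θ U)

/-- The restriction of a representation to the corner `C[0,1]`. -/
noncomputable def corner : C(I, ℂ) →⋆ₙₐ[ℂ] (π.H →L[ℂ] π.H) where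
  toFun f := π.rep (hΘ.corner f)
  map_smul' c f := by
    have : hΘ.corner (c • f) = c • hΘ.corner f := hΘ.ext fun t k l => by
      rw [blockEntry_smul, hΘ.entry_corner, hΘ.entry_corner, mul_ite, mul_zero]
      rfl
    rw [this, map_smul]
    rfl
  map_zero' := by
    have : hΘ.corner 0 = 0 := hΘ.ext fun t k l => by
      rw [blockEntry_zero, hΘ.entry_corner]; simp
    rw [this, map_zero]
  map_add' f g := by
    have : hΘ.corner (f + g) = hΘ.corner f + hΘ.corner g :=
      hΘ.ext fun t k l => by
        simp only [blockEntry_add, hΘ.entry_corner]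
        split_ifs <;> simp
    rw [this, map_add]
  map_mul' f g := by rw [← hΘ.corner_mul, map_mul]
  map_star' f := by rw [← hΘ.star_corner, map_star]

theorem corner_apply (f : C(I, ℂ)) : π.corner hΘ f = π.rep (hΘ.corner f) := rfl

theorem corner_one_ne_zero : π.corner hΘ 1 ≠ 0 := by
  intro h
  refine π.ne_zero (NonUnitalStarAlgHom.ext fun b => ?_)
  obtain ⟨x, y, hb, hx⟩ := hΘ.exists_eq_sum_mul_star b
  rw [hb, map_sum]
  refine Finset.sum_eq_zero fun i _ => ?_
  rw [map_sum]
  refine Finset.sum_eq_zero fun j _ => ?_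
  rw [map_mul, ← hx i j, map_mul, ← corner_apply, h, mul_zero, zero_mul]

/-- In an irreducible representation the kernel on the corner is prime, because compressing any
element to the corner gives a function. This kernel lies in a maximal ideal, which is the ideal of a
point t, and it turns out to contain every function vanishing at t. -/
theorem exists_corner_eq : ∃ t, ∀ f : C(I, ℂ), π.corner hΘ f = f t • π.corner hΘ 1 := by
  have hprime : ∀ f g : C(I, ℂ), f * g = 0 → π.corner hΘ f = 0 ∨ π.corner hΘ g = 0 := by
    intro f g hfg
    by_contra! hne
    obtain ⟨c, hc⟩ := π.exists_mul_mul_ne_zero hne.1 hne.2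
    refine hc ?_
    rw [hΘ.corner_mul_mul, mul_right_comm, hfg, zero_mul, ← corner_apply, map_zero]
  let K : Ideal C(I, ℂ) :=
    { carrier := {f | π.corner hΘ f = 0}
      add_mem' := fun {f g} hf hg => by
        change π.corner hΘ (f + g) = 0
        rw [map_add, hf, hg, add_zero]
      zero_mem' := map_zero _
      smul_mem' := fun f g hg => by
        change π.corner hΘ (f * g) = 0
        rw [map_mul, hg, mul_zero] }
  have hK : K ≠ ⊤ := fun h => π.corner_one_ne_zero hΘ ((Ideal.eq_top_iff_one K).1 h)
  obtain ⟨M, hM, hKM⟩ := Ideal.exists_le_maximal K hK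
  obtain ⟨t, ht⟩ := (ContinuousMap.ideal_isMaximal_iff M).1 hM
  have hvan : ∀ f : C(I, ℂ), π.corner hΘ f = 0 → f t = 0 := fun f hf => by
    have h1 : f ∈ M := hKM hf
    rwa [← ht, ContinuousMap.mem_idealOfSet_compl_singleton] at h1
  have hzero : ∀ f : C(I, ℂ), f t = 0 → π.corner hΘ f = 0 := by
    intro f hf
    -- Approximate f by G supported away from t and take a bump g with g(t) = 1 and Gg = 0. As g is
    -- not in the kernel, G is.
    rw [← norm_le_zero_iff]
    refine le_of_forall_pos_le_add fun ε hε => ?_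
    obtain ⟨G, K, hKc, hKf, hGK, hGf⟩ := exists_compact_cutoff f hε
    obtain ⟨g, hg1, hg0⟩ := exists_bump Kᶜ hKc.isClosed.isOpen_compl (t₀ := t) fun h => hKf t h hf
    have hGg : π.corner hΘ G = 0 := by
      refine (hprime G g ?_).resolve_right fun h => ?_
      · ext s
        by_cases hs : s ∈ K
        · rw [ContinuousMap.mul_apply, hg0 s (fun h => h hs), mul_zero]; rfl
        · rw [ContinuousMap.mul_apply, hGK s hs, zero_mul]; rfl
      · exact one_ne_zero (hg1.symm.trans (hvan g h))
    have h1 : π.corner hΘ f = -π.corner hΘ (G - f) := by rw [map_sub, hGg]; simp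
    rw [h1, norm_neg, zero_add]
    exact (NonUnitalStarAlgHom.norm_apply_le _ _).trans ((ContinuousMap.norm_le _ hε.le).2 hGf)
  refine ⟨t, fun f => ?_⟩
  have h1 := hzero (f - f t • 1) (by simp)
  rw [map_sub, map_smul, sub_eq_zero] at h1
  exact h1

open Classical in
-- Start from a unit vector v in the range of the corner projection and move it by the columns. Only
-- columns with t ∈ U i give nonzero vectors; these are orthonormal, and their span is invariant and
-- finite-dimensional, hence the whole space by irreducibility.
theorem exists_orthonormalBasis (π : IrrepOf B) (hΘ : IsBlockModel Θ U) :
    ∃ (t : I) (w : OrthonormalBasis {i // t ∈ U i} ℂ π.H),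
      ∀ b j, π.rep b (w j) = ∑ i : {i // t ∈ U i}, blockEntry Θ b i j t • w i := by
  obtain ⟨t, ht⟩ := π.exists_corner_eq hΘ
  obtain ⟨x, hx⟩ : ∃ x, π.corner hΘ 1 x ≠ 0 := by
    by_contra! h
    exact π.corner_one_ne_zero hΘ (ContinuousLinearMap.ext h)
  obtain ⟨v, hPv, hv⟩ : ∃ v, π.corner hΘ 1 v = v ∧ ⟪v, v⟫_ℂ = 1 := by
    refine ⟨((‖π.corner hΘ 1 x‖ : ℝ) : ℂ)⁻¹ • π.corner hΘ 1 x, ?_, ?_⟩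
    · rw [map_smul, ← mul_apply_eq_comp, ← map_mul, one_mul]
    · rw [inner_self_eq_norm_sq_to_K, norm_smul, norm_inv, Complex.norm_real, norm_norm,
        inv_mul_cancel₀ (norm_ne_zero_iff.2 hx)]
      simp
  have key : ∀ (f g : C(I, ℂ)) (i j : Fin (m + 1)) (hf : ∀ s, f s ≠ 0 → s ∈ U i)
      (hg : ∀ s, g s ≠ 0 → s ∈ U j), ⟪π.rep (hΘ.col f i hf) v, π.rep (hΘ.col g j hg) v⟫_ℂ =
        if i = j then star (f t) * g t else 0 := by
    intro f g i j hf hg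
    rw [← π.inner_rep_star, ← mul_apply_eq_comp, ← map_mul, hΘ.star_col_mul_col]
    split_ifs
    · rw [← corner_apply, ht, smul_apply, hPv, inner_smul_right, hv, mul_one]
      rfl
    · rw [map_zero, zero_apply, inner_zero_right]
  have hbump : ∀ i, ∃ g : C(I, ℂ), (∀ s, g s ≠ 0 → s ∈ U i) ∧ (t ∈ U i → g t = 1) := by
    intro i
    by_cases hi : t ∈ U i
    · obtain ⟨g, hg1, hg0⟩ := exists_bump (U i) (hΘ.isOpen i) hi
      exact ⟨g, fun s => not_imp_comm.1 (hg0 s), fun _ => hg1⟩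
    · exact ⟨0, fun s hs => absurd rfl hs, fun h => absurd h hi⟩
  choose g hgU hg1 using hbump
  let w (i : Fin (m + 1)) : π.H := π.rep (hΘ.col (g i) i (hgU i)) v
  -- A column acts on v only through its value at t; the difference of the two sides has norm zero
  -- by `key`. So the choice of the bumps g i is immaterial.
  have hcol : ∀ (f : C(I, ℂ)) (i : Fin (m + 1)) (hf : ∀ s, f s ≠ 0 → s ∈ U i),
      π.rep (hΘ.col f i hf) v = f t • w i := by
    intro f i hf
    rw [← sub_eq_zero, ← inner_self_eq_zero (𝕜 := ℂ)]
    simp only [w, inner_sub_left, inner_sub_right, inner_smul_left, inner_smul_right, key, if_true]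
    by_cases hi : t ∈ U i
    · rw [hg1 i hi]
      simp [mul_comm]
    · have : f t = 0 := not_not.1 (mt (hf t) hi)
      simp [this]
  have hrep : ∀ b j, π.rep b (w j) =
      ∑ i : {i // t ∈ U i}, blockEntry Θ b i j t • w i := by
    intro b j
    have h1 : π.rep b (w j) = ∑ i, (blockEntry Θ b i j * g j) t • w i := by
      rw [← mul_apply_eq_comp, ← map_mul, hΘ.mul_col, map_sum, _root_.sum_apply]
      exact Finset.sum_congr rfl fun i _ => hcol _ _ _
    have h2 : ∀ i, (blockEntry Θ b i j * g j) t = blockEntry Θ b i j t := by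
      intro i
      by_cases hz : blockEntry Θ b i j t = 0
      · rw [ContinuousMap.mul_apply, hz, zero_mul]
      · rw [ContinuousMap.mul_apply, hg1 j (hΘ.entry_ne_zero hz).2, mul_one]
    rw [h1, ← Finset.sum_subtype (Finset.univ.filter fun i => t ∈ U i) (by simp)
      (fun i => blockEntry Θ b i j t • w i), Finset.sum_filter_of_ne]
    · simp only [h2]
    · intro i _ hne
      exact (hΘ.entry_ne_zero (left_ne_zero_of_smul hne)).1
  have hon : Orthonormal ℂ fun i : {i // t ∈ U i} => w i := by
    rw [orthonormal_iff_ite]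
    rintro ⟨i, hi⟩ ⟨j, hj⟩
    change ⟪π.rep _ v, π.rep _ v⟫_ℂ = _
    rw [key, hg1 i hi, hg1 j hj]
    simp
  have hinv : ∀ b, ∀ x ∈ Submodule.span ℂ (Set.range fun i : {i // t ∈ U i} => w i),
      π.rep b x ∈ Submodule.span ℂ (Set.range fun i : {i // t ∈ U i} => w i) := by
    intro b x hx
    induction hx using Submodule.span_induction with
    | mem x hx =>
      obtain ⟨j, rfl⟩ := hx
      change π.rep b (w j) ∈ _
      rw [hrep]
      exact Submodule.sum_mem _ fun i _ => Submodule.smul_mem _ _ (Submodule.subset_span ⟨i, rfl⟩)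
    | zero => rw [map_zero]; exact Submodule.zero_mem _
    | add x y _ _ hx hy => rw [map_add]; exact Submodule.add_mem _ hx hy
    | smul c x _ hx => rw [map_smul]; exact Submodule.smul_mem _ _ hx
  have hspan : ⊤ ≤ Submodule.span ℂ (Set.range fun i : {i // t ∈ U i} => w i) := by
    have hfin : FiniteDimensional ℂ
        (Submodule.span ℂ (Set.range fun i : {i // t ∈ U i} => w i)) :=
      FiniteDimensional.span_of_finite ℂ (Set.finite_range _)
    refine ((π.irreducible _ (Submodule.closed_of_finiteDimensional _) hinv).resolve_left
      fun h => ?_).ge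
    have h0 : t ∈ U 0 := by rw [hΘ.eq_univ]; exact Set.mem_univ t
    have h1 : w 0 ∈ Submodule.span ℂ (Set.range fun i : {i // t ∈ U i} => w i) :=
      Submodule.subset_span ⟨⟨0, h0⟩, rfl⟩
    rw [h, Submodule.mem_bot] at h1
    exact hon.ne_zero ⟨0, h0⟩ h1
  refine ⟨t, OrthonormalBasis.mk hon hspan, fun b j => ?_⟩
  simp only [OrthonormalBasis.coe_mk]
  exact hrep b j

end IrrepOf

open Classical in
/-- The representation of `B` on `ℂ^{i | t ∈ U i}` given by evaluation at `t`. -/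
noncomputable def IsBlockModel.evalRep (hΘ : IsBlockModel Θ U) (t : I) :
    B →⋆ₙₐ[ℂ] (EuclideanSpace ℂ (ULift.{u} {i // t ∈ U i}) →L[ℂ]
      EuclideanSpace ℂ (ULift.{u} {i // t ∈ U i})) where
  toFun b := Matrix.toEuclideanCLM (𝕜 := ℂ)
    (Matrix.of fun i j => blockEntry Θ b i.down j.down t)
  map_smul' c b := by
    rw [MonoidHom.id_apply, ← map_smul]
    congr 1
    ext i j
    exact blockEntry_smul ..
  map_zero' := by
    rw [← map_zero (Matrix.toEuclideanCLM (𝕜 := ℂ) (n := ULift.{u} {i // t ∈ U i}))]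
    congr 1
    ext i j
    exact blockEntry_zero ..
  map_add' a b := by
    rw [← map_add]
    congr 1
    ext i j
    exact blockEntry_add ..
  map_mul' a b := by
    rw [← map_mul]
    congr 1
    ext i j
    rw [Matrix.mul_apply, Matrix.of_apply, blockEntry_mul]
    simp only [Matrix.of_apply]
    have h1 : ∑ k : ULift.{u} {i // t ∈ U i},
        blockEntry Θ a i.down k.down t * blockEntry Θ b k.down j.down t =
        ∑ k : {i // t ∈ U i}, blockEntry Θ a i.down k t * blockEntry Θ b k j.down t :=
      Equiv.ulift.sum_comp fun k : {i // t ∈ U i} =>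
        blockEntry Θ a i.down k t * blockEntry Θ b k j.down t
    rw [h1, ← Finset.sum_subtype (Finset.univ.filter fun i => t ∈ U i)
      (by simp) (fun k => blockEntry Θ a i.down k t * blockEntry Θ b k j.down t),
      Finset.sum_filter_of_ne]
    exact fun k _ hne => (hΘ.entry_ne_zero (left_ne_zero_of_mul hne)).2
  map_star' a := by
    rw [← map_star]
    congr 1
    ext i j
    exact blockEntry_star ..

namespace IsBlockModel

variable (hΘ : IsBlockModel Θ U)

open Classical in
theorem evalRep_apply (t : I) (b : B) (x : EuclideanSpace ℂ (ULift.{u} {i // t ∈ U i}))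
    (i : ULift.{u} {i // t ∈ U i}) :
    hΘ.evalRep t b x i = ∑ j : ULift.{u} {i // t ∈ U i}, blockEntry Θ b i.down j.down t * x j := rfl

include hΘ in
theorem exists_evalRep_eq (t : I) (i j : ULift.{u} {i // t ∈ U i}) :
    ∃ b : B, ∀ x, hΘ.evalRep t b x = x i • EuclideanSpace.single j (1 : ℂ) := by
  classical
  obtain ⟨g, hg1, hg0⟩ := exists_bump (U i.down ∩ U j.down)
    ((hΘ.isOpen _).inter (hΘ.isOpen _)) ⟨i.down.2, j.down.2⟩
  obtain ⟨b, hb⟩ := hΘ.exists_eq (coordFun g j.down i.down) (coordFun_mem fun s hs =>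
    (not_imp_comm.1 (hg0 s) hs).symm)
  refine ⟨b, fun x => ?_⟩
  have hentry : ∀ k l, blockEntry Θ b k l t = if (j.down : Fin (m + 1)) = k ∧
      (i.down : Fin (m + 1)) = l then 1 else 0 := by
    intro k l
    change Θ b t k l = _
    rw [hb, coordFun_apply, Matrix.single_apply, hg1]
  have hdown : ∀ k l : ULift.{u} {i // t ∈ U i},
      (k.down : Fin (m + 1)) = l.down ↔ k = l := fun k l =>
    ⟨fun h => ULift.ext _ _ (Subtype.ext h), fun h => by rw [h]⟩
  ext k
  rw [evalRep_apply]
  simp only [hentry, hdown, ite_and]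
  by_cases hk : j = k
  · subst hk; simp
  · simp [hk, Ne.symm hk]

open Classical in
/-- Evaluation at `t` as an irreducible representation. -/
noncomputable def evalIrrep (t : I) : IrrepOf B where
  H := EuclideanSpace ℂ (ULift.{u} {i // t ∈ U i})
  rep := hΘ.evalRep t
  ne_zero h := by
    have h0 : t ∈ U 0 := by rw [hΘ.eq_univ]; exact Set.mem_univ t
    obtain ⟨b, hb⟩ := hΘ.exists_evalRep_eq t ⟨0, h0⟩ ⟨0, h0⟩
    have h1 := hb (EuclideanSpace.single ⟨0, h0⟩ 1)
    rw [h] at h1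
    have h2 := congrArg (fun x : EuclideanSpace ℂ (ULift.{u} {i // t ∈ U i}) => x ⟨0, h0⟩) h1
    simp at h2
  irreducible K _ hK := by
    refine or_iff_not_imp_left.2 fun hne => ?_
    obtain ⟨x, hx, hx0⟩ := K.ne_bot_iff.1 hne
    obtain ⟨i, hi⟩ : ∃ i, x i ≠ 0 := by
      by_contra! h
      exact hx0 (PiLp.ext h)
    have hsingle : ∀ j, EuclideanSpace.single j (1 : ℂ) ∈ K := by
      intro j
      obtain ⟨b, hb⟩ := hΘ.exists_evalRep_eq t i j
      have h1 := hK b x hx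
      rw [hb] at h1
      exact (K.smul_mem_iff hi).1 h1
    refine K.eq_top_iff'.2 fun y => ?_
    rw [← (EuclideanSpace.basisFun _ ℂ).sum_repr y]
    exact K.sum_mem fun j _ => K.smul_mem _ (by rw [EuclideanSpace.basisFun_apply]; exact hsingle j)

theorem evalIrrep_eq_zero_iff (t : I) (b : B) : (hΘ.evalIrrep t).rep b = 0 ↔ Θ b t = 0 := by
  classical
  change hΘ.evalRep t b = 0 ↔ _
  constructor
  · intro h
    ext i j
    by_contra hne
    obtain ⟨hi, hj⟩ := hΘ.map_mem b t i j hne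
    have h1 := hΘ.evalRep_apply t b (EuclideanSpace.single ⟨j, hj⟩ 1) ⟨i, hi⟩
    rw [h] at h1
    simp at h1
    exact hne h1.symm
  · intro h
    ext x i
    rw [evalRep_apply]
    refine Finset.sum_eq_zero fun j _ => ?_
    have : blockEntry Θ b i.down j.down t = 0 := by
      change Θ b t _ _ = 0
      rw [h]; rfl
    rw [this, zero_mul]

/-- The orthonormal basis found above transforms by the matrix entries at t, exactly as the standard
basis does under evaluation. -/
theorem exists_equiv_evalIrrep (π : IrrepOf B) : ∃ t, π ≈ hΘ.evalIrrep t := by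
  classical
  obtain ⟨t, w, hw⟩ := π.exists_orthonormalBasis hΘ
  let V : π.H ≃ₗᵢ[ℂ] EuclideanSpace ℂ (ULift.{u} {i // t ∈ U i}) :=
    w.equiv (EuclideanSpace.basisFun _ ℂ) Equiv.ulift.symm
  have hV : ∀ i, V (w i) = EuclideanSpace.single ⟨i⟩ 1 := by
    intro i
    simp [V]
  refine ⟨t, V, fun b x => ?_⟩
  have h1 : V.toLinearEquiv.toLinearMap ∘ₗ (π.rep b).toLinearMap =
      (hΘ.evalRep t b).toLinearMap ∘ₗ V.toLinearEquiv.toLinearMap := by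
    refine w.toBasis.ext fun j => ?_
    rw [OrthonormalBasis.coe_toBasis]
    change V (π.rep b (w j)) = hΘ.evalRep t b (V (w j))
    rw [hw, map_sum]
    ext k
    rw [hV, evalRep_apply]
    simp [hV, Finset.sum_apply, Pi.single_apply]
    rw [Finset.sum_eq_single k.down]
    · simp
    · exact fun i _ hi => if_neg fun h => hi (congrArg ULift.down h).symm
    · simp
  exact LinearMap.congr_fun h1 x

theorem exists_toSpectrum_eq (x : CStarSpectrum B) : ∃ t, (hΘ.evalIrrep t).toSpectrum = x := by
  induction x using Quotient.inductionOn with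
  | h π =>
    obtain ⟨t, ht⟩ := hΘ.exists_equiv_evalIrrep π
    exact ⟨t, (Quotient.sound ht).symm⟩

theorem map_corner (f : C(I, ℂ)) : Θ (hΘ.corner f) = coordFun f 0 0 := hΘ.map_col _

theorem evalIrrep_corner_eq_zero_iff (t : I) (f : C(I, ℂ)) :
    (hΘ.evalIrrep t).rep (hΘ.corner f) = 0 ↔ f t = 0 := by
  rw [hΘ.evalIrrep_eq_zero_iff, map_corner, coordFun_apply]
  refine ⟨fun h => by simpa using congrFun (congrFun h 0) 0, fun h => by rw [h]; simp⟩

theorem toSpectrum_injective : Function.Injective fun t => (hΘ.evalIrrep t).toSpectrum := by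
  intro s t hst
  by_contra hne
  obtain ⟨f, hf1, hf0⟩ := exists_bump {t}ᶜ isOpen_compl_singleton (t₀ := s) hne
  have h1 := IrrepOf.rep_eq_zero_iff_of_equiv (Quotient.exact hst) (hΘ.corner f)
  rw [evalIrrep_corner_eq_zero_iff, evalIrrep_corner_eq_zero_iff, hf1,
    hf0 t fun h => h rfl] at h1
  exact one_ne_zero (h1.2 rfl)

theorem continuous_toSpectrum : Continuous fun t => (hΘ.evalIrrep t).toSpectrum := by
  refine continuous_generateFrom_iff.2 ?_
  rintro _ ⟨a, rfl⟩
  have : (fun t => (hΘ.evalIrrep t).toSpectrum) ⁻¹'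
      {x | ∃ ρ : IrrepOf B, ρ.toSpectrum = x ∧ ρ.rep a ≠ 0} = {t | Θ a t ≠ 0} := by
    ext t
    rw [Set.mem_preimage, IrrepOf.toSpectrum_mem_iff, ne_eq, evalIrrep_eq_zero_iff]
    rfl
  rw [this]
  exact isOpen_ne_fun (Θ a).continuous continuous_const

/-- A bump f inside O, placed in the corner, cuts out a basic open subset of the spectrum that lies
in the image of O. -/
theorem isOpenMap_toSpectrum : IsOpenMap fun t => (hΘ.evalIrrep t).toSpectrum := by
  intro O hO
  refine isOpen_iff_forall_mem_open.2 ?_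
  rintro _ ⟨t, ht, rfl⟩
  obtain ⟨f, hf1, hf0⟩ := exists_bump O hO ht
  refine ⟨{x | ∃ ρ : IrrepOf B, ρ.toSpectrum = x ∧ ρ.rep (hΘ.corner f) ≠ 0}, fun x hx => ?_,
    TopologicalSpace.isOpen_generateFrom_of_mem ⟨_, rfl⟩, ?_⟩
  · obtain ⟨s, rfl⟩ := hΘ.exists_toSpectrum_eq x
    rw [IrrepOf.toSpectrum_mem_iff, ne_eq, evalIrrep_corner_eq_zero_iff] at hx
    exact ⟨s, not_imp_comm.1 (hf0 s) hx, rfl⟩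
  · rw [IrrepOf.toSpectrum_mem_iff, ne_eq, evalIrrep_corner_eq_zero_iff, hf1]
    exact one_ne_zero

/-- The spectrum is the unit interval. -/
noncomputable def homeomorph : I ≃ₜ CStarSpectrum B :=
  (Equiv.ofBijective _ ⟨hΘ.toSpectrum_injective,
    hΘ.exists_toSpectrum_eq⟩).toHomeomorphOfContinuousOpen
    hΘ.continuous_toSpectrum hΘ.isOpenMap_toSpectrum

theorem homeomorph_apply (t : I) : hΘ.homeomorph t = (hΘ.evalIrrep t).toSpectrum := rfl

theorem dimFunction_evalIrrep (t : I) :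
    dimFunction (hΘ.evalIrrep t).toSpectrum = Nat.card {i // t ∈ U i} := by
  classical
  change Cardinal.toENat (Module.rank ℂ (EuclideanSpace ℂ (ULift.{u} {i // t ∈ U i}))) = _
  rw [← Module.finrank_eq_rank, finrank_euclideanSpace, Cardinal.toENat_nat,
    Nat.card_eq_fintype_card, Fintype.card_ulift]

include hΘ in
-- The unit of the corner is a projection of rank one in every irreducible representation, because
-- index 0 is present at every point. So one element serves the whole spectrum.
theorem isContinuousTrace : IsContinuousTrace B where
  hausdorff := hΘ.homeomorph.t2Space
  fell x := by
    refine ⟨Set.univ, Filter.univ_mem, hΘ.corner 1, fun π _ => ⟨?_, ?_⟩⟩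
    · refine ⟨?_, ?_⟩
      · rw [IsIdempotentElem, ← map_mul, corner_mul, one_mul]
      · rw [IsSelfAdjoint, ← map_star, star_corner, star_one]
    · classical
      obtain ⟨t, w, hw⟩ := π.exists_orthonormalBasis hΘ
      have h0 : t ∈ U 0 := by rw [hΘ.eq_univ]; exact Set.mem_univ t
      have hw0 : ∀ j, π.rep (hΘ.corner 1) (w j) = if j = ⟨0, h0⟩ then w ⟨0, h0⟩ else 0 := by
        intro j
        rw [hw, Finset.sum_eq_single ⟨0, h0⟩]
        · rw [hΘ.entry_corner]
          by_cases hj : j = ⟨0, h0⟩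
          · simp [hj]
          · have : ¬ (0 : Fin (m + 1)) = j := fun h => hj (Subtype.ext h.symm)
            simp [hj, this]
        · intro i _ hi
          have : ¬ (0 : Fin (m + 1)) = i := fun h => hi (Subtype.ext h.symm)
          rw [hΘ.entry_corner]
          simp [this]
        · simp
      have hrange : (π.rep (hΘ.corner 1)).range = Submodule.span ℂ {w ⟨0, h0⟩} := by
        refine le_antisymm ?_ ?_
        · rintro _ ⟨x, rfl⟩
          change π.rep (hΘ.corner 1) x ∈ _
          rw [← w.sum_repr x, map_sum]
          refine Submodule.sum_mem _ fun j _ => ?_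
          rw [map_smul, hw0]
          refine Submodule.smul_mem _ _ ?_
          split_ifs
          · exact Submodule.mem_span_singleton_self _
          · exact Submodule.zero_mem _
        · rw [Submodule.span_singleton_le_iff_mem]
          exact ⟨w ⟨0, h0⟩, by simpa using hw0 ⟨0, h0⟩⟩
      rw [hrange]
      exact finrank_span_singleton (w.orthonormal.ne_zero _)

include hΘ in
theorem isSpecialContinuousTrace (hs : IsFiniteStep fun t i => t ∈ U i) :
    IsSpecialContinuousTrace B := by
  refine ⟨hΘ.isContinuousTrace, fun x => ?_, hΘ.homeomorph.symm, ?_⟩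
  · obtain ⟨t, rfl⟩ := hΘ.exists_toSpectrum_eq x
    rw [dimFunction_evalIrrep]
    exact ENat.natCast_ne_top _
  · simp only [Homeomorph.symm_symm, homeomorph_apply, dimFunction_evalIrrep]
    exact hs.comp fun x : Fin (m + 1) → Prop => (Nat.card {i // x i} : ℕ∞)

end IsBlockModel

end BlockSpectrum

/-! ### The Hilbert field attached to a rank-one projection -/

section LineField

variable {A : Type u} [NonUnitalCStarAlgebra A] {ρ : I → IrrepOf A}

/-- A continuous field of rank-one projections. -/
structure IsLineField (ρ : I → IrrepOf A) (p : A) (v : ∀ t, (ρ t).H) : Prop where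
  field : IsSpectralField ρ
  norm_eq (t : I) : ‖v t‖ = 1
  rep_eq (t : I) (x : (ρ t).H) : (ρ t).rep p x = ⟪v t, x⟫_ℂ • v t

namespace IsLineField

variable {p : A} {v : ∀ t, (ρ t).H}

section

variable (h : IsLineField ρ p v)

include h

theorem inner_self (t : I) : ⟪v t, v t⟫_ℂ = 1 := by
  rw [inner_self_eq_norm_sq_to_K, h.norm_eq]; simp

theorem rep_self (t : I) : (ρ t).rep p (v t) = v t := by rw [h.rep_eq, h.inner_self, one_smul]

/-- In the fibre, ap is the rank-one operator |av⟩⟨v| with v a unit vector. -/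
theorem norm_rep_mul (a : A) (t : I) : ‖(ρ t).rep (a * p)‖ = ‖(ρ t).rep a (v t)‖ := by
  refine le_antisymm ?_ ?_
  · refine ContinuousLinearMap.opNorm_le_bound _ (norm_nonneg _) fun x => ?_
    rw [map_mul, mul_apply_eq_comp, h.rep_eq, map_smul, norm_smul, mul_comm]
    gcongr
    simpa [h.norm_eq] using norm_inner_le_norm (𝕜 := ℂ) (v t) x
  · have h1 := ((ρ t).rep (a * p)).le_opNorm (v t)
    rwa [map_mul, mul_apply_eq_comp, h.rep_self, h.norm_eq, mul_one, ← map_mul] at h1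

/-- In the fibre, p(c + ‖c‖)p is the multiple ⟨v, cv⟩ + ‖c‖ ≥ 0 of p, so lower semicontinuity of the
norm gives that of ⟨v, cv⟩. Using −c as well yields continuity. -/
theorem isOpen_re_lt {c : A} (hc : IsSelfAdjoint c) (r : ℝ) :
    IsOpen {t | r < (⟪v t, (ρ t).rep c (v t)⟫_ℂ).re} := by
  have hle : ∀ t, |(⟪v t, (ρ t).rep c (v t)⟫_ℂ).re| ≤ ‖c‖ := by
    intro t
    refine (Complex.abs_re_le_norm _).trans ((norm_inner_le_norm _ _).trans ?_)
    rw [h.norm_eq, one_mul]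
    refine (((ρ t).rep c).le_opNorm _).trans ?_
    rw [h.norm_eq, mul_one]
    exact IsSpectralField.norm_rep_le t c
  have him : ∀ t, ((⟪v t, (ρ t).rep c (v t)⟫_ℂ).re : ℂ) = ⟪v t, (ρ t).rep c (v t)⟫_ℂ := by
    intro t
    refine Complex.conj_eq_iff_re.1 ?_
    rw [inner_conj_symm, ← (ρ t).inner_rep_star, hc.star_eq]
  -- The norm criterion needs the threshold r + ‖c‖ to be nonnegative; below that the set is the
  -- whole interval.
  rcases lt_or_ge r (-‖c‖) with hr | hr
  · have : {t | r < (⟪v t, (ρ t).rep c (v t)⟫_ℂ).re} = Set.univ :=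
      Set.eq_univ_of_forall fun t => hr.trans_le (neg_le_of_abs_le (hle t))
    rw [this]
    exact isOpen_univ
  · have hnorm : ∀ t, ‖(ρ t).rep ((p * c + (‖c‖ : ℂ) • p) * p)‖ =
        (⟪v t, (ρ t).rep c (v t)⟫_ℂ).re + ‖c‖ := by
      intro t
      rw [h.norm_rep_mul, map_add, map_mul, map_smul, add_apply, smul_apply, mul_apply_eq_comp,
        h.rep_eq, h.rep_self, ← add_smul, norm_smul, h.norm_eq, mul_one, ← him, ← Complex.ofReal_add,
        Complex.norm_real, Real.norm_of_nonneg]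
      · simp
      · linarith [neg_le_of_abs_le (hle t)]
    have := h.field.isOpen_lt_norm ((p * c + (‖c‖ : ℂ) • p) * p) (r := r + ‖c‖) (by linarith)
    simpa only [hnorm, add_lt_add_iff_right] using this

theorem continuous_re {c : A} (hc : IsSelfAdjoint c) :
    Continuous fun t => (⟪v t, (ρ t).rep c (v t)⟫_ℂ).re := by
  refine continuous_iff_lower_upperSemicontinuous.2
    ⟨lowerSemicontinuous_iff_isOpen_preimage.2 fun r => h.isOpen_re_lt hc r,
      upperSemicontinuous_iff_isOpen_preimage.2 fun r => ?_⟩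
  have h1 := h.isOpen_re_lt hc.neg (-r)
  have h2 : ∀ t, (⟪v t, (ρ t).rep (-c) (v t)⟫_ℂ).re = -(⟪v t, (ρ t).rep c (v t)⟫_ℂ).re := by
    intro t
    rw [map_neg, _root_.neg_apply, inner_neg_right, Complex.neg_re]
  simp only [h2, neg_lt_neg_iff] at h1
  exact h1

theorem continuous_inner (c : A) : Continuous fun t => ⟪v t, (ρ t).rep c (v t)⟫_ℂ := by
  have hsa : ∀ c : A, IsSelfAdjoint c → Continuous fun t => ⟪v t, (ρ t).rep c (v t)⟫_ℂ := by
    intro c hc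
    have him : ∀ t, ⟪v t, (ρ t).rep c (v t)⟫_ℂ = ((⟪v t, (ρ t).rep c (v t)⟫_ℂ).re : ℂ) := by
      intro t
      refine (Complex.conj_eq_iff_re.1 ?_).symm
      rw [inner_conj_symm, ← (ρ t).inner_rep_star, hc.star_eq]
    rw [funext him]
    exact Complex.continuous_ofReal.comp (h.continuous_re hc)
  have h1 : ∀ t, ⟪v t, (ρ t).rep c (v t)⟫_ℂ = ⟪v t, (ρ t).rep (realPart c : A) (v t)⟫_ℂ +
      Complex.I * ⟪v t, (ρ t).rep (imaginaryPart c : A) (v t)⟫_ℂ := by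
    intro t
    conv_lhs => rw [← realPart_add_I_smul_imaginaryPart c]
    rw [map_add, map_smul, add_apply, smul_apply, inner_add_right, inner_smul_right]
  simp_rw [h1]
  exact (hsa _ (realPart c).2).add (continuous_const.mul (hsa _ (imaginaryPart c).2))

end

end IsLineField

variable {p : A}

/-- The space of elements supported on a projection `p` from the right. -/
def lineSpace (p : A) : Submodule ℂ A where
  carrier := {a | a * p = a}
  add_mem' {a b} ha hb := by
    change (a + b) * p = a + b
    rw [add_mul, ha, hb]
  zero_mem' := zero_mul p
  smul_mem' c a ha := by
    change c • a * p = c • a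
    rw [smul_mul_assoc, ha]

theorem mem_lineSpace {a : A} : a ∈ lineSpace p ↔ a * p = a := Iff.rfl

theorem isClosed_lineSpace : IsClosed (lineSpace p : Set A) :=
  isClosed_eq (continuous_mul_const p) continuous_id

instance : CompleteSpace (lineSpace p) := isClosed_lineSpace.completeSpace_coe

theorem mul_mem_lineSpace (a : A) {ξ : A} (hξ : ξ ∈ lineSpace p) : a * ξ ∈ lineSpace p := by
  rw [mem_lineSpace, mul_assoc, hξ]

namespace IsLineField

variable {v : ∀ t, (ρ t).H} (h : IsLineField ρ p v)

include h

/-- The Hilbert field of the elements supported on a field of rank-one projections. -/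
noncomputable def hilbertField : HilbertField (lineSpace p) fun t => (ρ t).H where
  ev t :=
    { toFun := fun a => (ρ t).rep a (v t)
      map_add' := fun a b => by rw [Submodule.coe_add, map_add, add_apply]
      map_smul' := fun c a => by rw [Submodule.coe_smul, map_smul, smul_apply]; rfl }
  norm_ev_le t ξ := by
    refine (((ρ t).rep (ξ : A)).le_opNorm _).trans ?_
    rw [h.norm_eq, mul_one]
    exact IsSpectralField.norm_rep_le t (ξ : A)
  norm_le ξ C hC hξ := h.field.norm_le hC fun t => by
    have := h.norm_rep_mul ξ t
    rw [ξ.2] at this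
    exact this.le.trans (hξ t)
  continuous_inner ξ η := by
    refine (h.continuous_inner (star (ξ : A) * η)).congr fun t => ?_
    rw [map_mul, mul_apply_eq_comp, (ρ t).inner_rep_star]
    rfl
  exists_smul f ξ := by
    obtain ⟨b, hb⟩ := h.field.exists_smul f ξ
    refine ⟨⟨b, h.field.ext fun t => ?_⟩, fun t => ?_⟩
    · rw [map_mul, hb, smul_mul_assoc, ← map_mul, ξ.2]
    · change (ρ t).rep b (v t) = f t • (ρ t).rep ξ (v t)
      rw [hb, smul_apply]

theorem hilbertField_ev (t : I) (ξ : lineSpace p) : h.hilbertField.ev t ξ = (ρ t).rep ξ (v t) := rfl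

theorem rep_mul_star (ξ η : lineSpace p) (t : I) (x : (ρ t).H) :
    (ρ t).rep (ξ * star (η : A)) x =
      ⟪h.hilbertField.ev t η, x⟫_ℂ • h.hilbertField.ev t ξ := by
  rw [map_mul, mul_apply_eq_comp, ← ξ.2, map_mul, mul_apply_eq_comp, h.rep_eq, map_smul,
    (ρ t).inner_rep_star]
  rfl

theorem mem_self : p ∈ lineSpace p := by
  refine h.field.ext fun t => ?_
  ext x
  rw [map_mul, mul_apply_eq_comp, h.rep_eq t x, map_smul, h.rep_self]

/-- The closed span of the products ξη* is a two-sided ideal, since Ap is a left ideal, and it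
contains pp*, which is nonzero in every fibre. So it is everything, although J itself is only a
closed subspace. -/
theorem eq_top_of_mul_star_mem {J : Submodule ℂ A} (hJ : IsClosed (J : Set A))
    (hmem : ∀ ξ η : lineSpace p, (ξ : A) * star (η : A) ∈ J) : J = ⊤ := by
  let K : Submodule ℂ A :=
    (Submodule.span ℂ {a | ∃ ξ η : lineSpace p, a = ξ * star (η : A)}).topologicalClosure
  have hKJ : K ≤ J := by
    refine Submodule.topologicalClosure_minimal _ (Submodule.span_le.2 ?_) hJ
    rintro _ ⟨ξ, η, rfl⟩
    exact hmem ξ η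
  have hK : ∀ ξ η : lineSpace p, (ξ : A) * star (η : A) ∈ K := fun ξ η =>
    Submodule.le_topologicalClosure _ (Submodule.subset_span ⟨ξ, η, rfl⟩)
  have hKc : IsClosed (K : Set A) := Submodule.isClosed_topologicalClosure _
  have hKmin : ∀ P : Submodule ℂ A, IsClosed (P : Set A) →
      (∀ ξ η : lineSpace p, (ξ : A) * star (η : A) ∈ P) → K ≤ P := fun P hP hm => by
    refine Submodule.topologicalClosure_minimal _ (Submodule.span_le.2 ?_) hP
    rintro _ ⟨ξ, η, rfl⟩
    exact hm ξ η
  have hl : ∀ a, ∀ j ∈ K, a * j ∈ K := by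
    intro a
    refine hKmin (K.comap (LinearMap.mulLeft ℂ a)) (hKc.preimage (continuous_const_mul a))
      fun ξ η => ?_
    change a * (ξ * star (η : A)) ∈ K
    rw [← mul_assoc]
    exact hK ⟨_, mul_mem_lineSpace a ξ.2⟩ η
  have hr : ∀ a, ∀ j ∈ K, j * a ∈ K := by
    intro a
    refine hKmin (K.comap (LinearMap.mulRight ℂ a)) (hKc.preimage (continuous_mul_const a))
      fun ξ η => ?_
    change ξ * star (η : A) * a ∈ K
    have : (ξ : A) * star (η : A) * a = ξ * star (star a * (η : A)) := by
      rw [star_mul, star_star, mul_assoc]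
    rw [this]
    exact hK ξ ⟨_, mul_mem_lineSpace (star a) η.2⟩
  refine top_le_iff.1 ((h.field.eq_top hKc hl hr fun t => ⟨_, hK ⟨p, h.mem_self⟩ ⟨p, h.mem_self⟩,
    fun h0 => ?_⟩).ge.trans hKJ)
  have h1 := h.rep_mul_star ⟨p, h.mem_self⟩ ⟨p, h.mem_self⟩ t (v t)
  rw [h0, hilbertField_ev, h.rep_self, h.inner_self, one_smul] at h1
  have h2 := h.inner_self t
  rw [← h1, zero_apply, inner_zero_left] at h2
  exact zero_ne_one h2

end IsLineField

theorem IsSpectralField.exists_isLineField (hρ : IsSpectralField ρ) : ∃ p v, IsLineField ρ p v := by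
  obtain ⟨p, v, hv, hp⟩ := hρ.exists_rank_one_projection
  exact ⟨p, v, hρ, hv, hp⟩

end LineField

/-! ### Operator frames of separable continuous-trace algebras -/

section OperatorFrame

variable {A : Type u} [NonUnitalCStarAlgebra A] {ρ : I → IrrepOf A}

/-- An orthogonal family of sections of a spectral field, the `i`-th of which is a unit vector on
the open set `O i`, whose rank-one operators generate the algebra. -/
structure IsOperatorFrame (ρ : I → IrrepOf A) (u : ℕ → ∀ t, (ρ t).H) (O : ℕ → Set I) : Prop where
  field : IsSpectralField ρ
  isOpen (i : ℕ) : IsOpen (O i)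
  eq_univ : O 0 = Set.univ
  inner_self (i : ℕ) (t : I) (ht : t ∈ O i) : ⟪u i t, u i t⟫_ℂ = 1
  inner_ne (i j : ℕ) (hij : i ≠ j) (t : I) : ⟪u i t, u j t⟫_ℂ = 0
  exists_rep_eq (i j : ℕ) (F : C(I, ℂ)) (hF : ∀ t, F t ≠ 0 → t ∈ O i ∧ t ∈ O j) :
    ∃ a : A, ∀ t x, (ρ t).rep a x = (F t * ⟪u j t, x⟫_ℂ) • u i t
  eq_top (J : Submodule ℂ A) (hJ : IsClosed (J : Set A))
    (hmem : ∀ (i j : ℕ) (F : C(I, ℂ)) (_ : ∀ t, F t ≠ 0 → t ∈ O i ∧ t ∈ O j) (a : A),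
      (∀ t x, (ρ t).rep a x = (F t * ⟪u j t, x⟫_ℂ) • u i t) → a ∈ J) : J = ⊤

theorem IsLineField.exists_isOperatorFrame [TopologicalSpace.SeparableSpace A] {p : A}
    {v : ∀ t, (ρ t).H} (h : IsLineField ρ p v) : ∃ u O, IsOperatorFrame ρ u O := by
  have := UniformSpace.secondCountable_of_separable A
  let d := TopologicalSpace.denseSeq (lineSpace p)
  set Γ := h.hilbertField with hΓ
  -- Unpairing makes the sequence revisit each member of the dense sequence infinitely often, so the
  -- errors 1/(n+1) become arbitrarily small for every one of them.
  obtain ⟨ξ, horth, hcont, hexp, happ⟩ := Γ.exists_frame fun n => d n.unpair.1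
  have hO : ∀ i (F : C(I, ℂ)), (∀ t, F t ≠ 0 → t ∈ {t | Γ.ev t (ξ i) ≠ 0}) →
      ∀ t, Γ.ev t (ξ i) = 0 → F t = 0 := fun i F hF t ht => by
    by_contra hne
    exact hF t hne ht
  refine ⟨fun i t => Γ.unit (ξ i) t, fun i => {t | Γ.ev t (ξ i) ≠ 0}, h.field, fun i => ?_, ?_,
    fun i t ht => ?_, fun i j hij t => ?_, fun i j F hF => ?_, fun J hJ hmem => ?_⟩
  · have : {t | Γ.ev t (ξ i) ≠ 0} = {t | ‖Γ.ev t (ξ i)‖ ≠ 0} := by ext t; simp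
    rw [this]
    exact isOpen_ne_fun (Γ.continuous_norm (ξ i)) continuous_const
  -- If ξ₀ vanished at t, every section would; but p is a section with value v t ≠ 0.
  · refine Set.eq_univ_of_forall fun t h0 => ?_
    have h1 := hexp 0 t h0 ⟨p, h.mem_self⟩
    rw [Finset.range_zero, Finset.sum_empty, hΓ, h.hilbertField_ev, h.rep_self] at h1
    have h2 := h.norm_eq t
    rw [h1, norm_zero] at h2
    exact zero_ne_one h2
  · rw [inner_self_eq_norm_sq_to_K, Γ.norm_unit ht]; simp
  · rw [HilbertField.unit, HilbertField.unit, inner_smul_left, inner_smul_right, horth i j hij,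
      mul_zero, mul_zero]
  · obtain ⟨R, G, h0, hGR⟩ := exists_mul_eq F
    obtain ⟨ζ, hζ⟩ := Γ.exists_smul_unit G (ξ i) fun t ht =>
      (h0 t (hO i F (fun t h => (hF t h).1) t ht)).2
    obtain ⟨ζ', hζ'⟩ := Γ.exists_smul_unit ⟨fun t => (R t : ℂ), by fun_prop⟩ (ξ j) fun t ht => by
      change ((R t : ℝ) : ℂ) = 0
      rw [(h0 t (hO j F (fun t h => (hF t h).2) t ht)).1, Complex.ofReal_zero]
    refine ⟨ζ * star (ζ' : A), fun t x => ?_⟩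
    rw [h.rep_mul_star, ← hΓ, hζ, hζ', inner_smul_left, smul_smul, ContinuousMap.coe_mk,
      Complex.conj_ofReal, ← hGR t]
    congr 1
    ring
  · let S : Set (lineSpace p) := {ζ | ∃ (i : ℕ) (F : C(I, ℂ)),
      -- Sections that are multiples of a single frame vector. They span a dense subspace, and
      -- density is then used in each factor of ξη* separately.
      (∀ t, F t ≠ 0 → Γ.ev t (ξ i) ≠ 0) ∧ ∀ t, Γ.ev t ζ = F t • Γ.unit (ξ i) t}
    have hS : (Submodule.span ℂ S).topologicalClosure = ⊤ := by
      have hd : ∀ k, d k ∈ (Submodule.span ℂ S).topologicalClosure := by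
        intro k
        refine Metric.mem_closure_iff.2 fun ε hε => ?_
        obtain ⟨M, hM⟩ := exists_nat_one_div_lt hε
        have hF : ∀ i, ∃ ζ ∈ S, ∀ t, Γ.ev t ζ = ⟪Γ.unit (ξ i) t, Γ.ev t (d k)⟫_ℂ • Γ.unit (ξ i) t := by
          intro i
          obtain ⟨ζ, hζ⟩ := Γ.exists_smul_unit ⟨_, hcont i (d k)⟩ (ξ i) fun t ht => by
            change ⟪Γ.unit (ξ i) t, Γ.ev t (d k)⟫_ℂ = 0
            rw [Γ.unit_eq_zero ht, inner_zero_left]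
          refine ⟨ζ, ⟨i, _, fun t hne h0 => hne ?_, hζ⟩, hζ⟩
          change ⟪Γ.unit (ξ i) t, Γ.ev t (d k)⟫_ℂ = 0
          rw [Γ.unit_eq_zero h0, inner_zero_left]
        choose ζ hζS hζ using hF
        refine ⟨∑ i ∈ Finset.range (Nat.pair k M + 1), ζ i,
          Submodule.sum_mem _ fun i _ => Submodule.subset_span (hζS i), ?_⟩
        rw [dist_eq_norm]
        refine lt_of_le_of_lt (Γ.norm_le _ (1 / ((M : ℝ) + 1)) (by positivity) fun t => ?_) hM
        have h1 := happ (Nat.pair k M) t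
        rw [Nat.unpair_pair] at h1
        rw [map_sub, map_sum]
        simp only [hζ]
        refine h1.trans (one_div_le_one_div_of_le (by positivity) ?_)
        have := Nat.right_le_pair k M
        gcongr
      refine eq_top_iff.2 fun η _ => ?_
      have hc : IsClosed ((Submodule.span ℂ S).topologicalClosure : Set (lineSpace p)) :=
        Submodule.isClosed_topologicalClosure _
      exact closure_minimal (Set.range_subset_iff.2 hd) hc
        (TopologicalSpace.denseRange_denseSeq (lineSpace p) η)
    have hall : ∀ P : Submodule ℂ (lineSpace p), IsClosed (P : Set (lineSpace p)) → S ⊆ P →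
        ∀ η, η ∈ P := fun P hP hSP η => by
      have h1 : (Submodule.span ℂ S).topologicalClosure ≤ P :=
        Submodule.topologicalClosure_minimal _ (Submodule.span_le.2 hSP) hP
      rw [hS] at h1
      exact h1 trivial
    have hright : ∀ ζ ∈ S, ∀ η : lineSpace p, (ζ : A) * star (η : A) ∈ J := by
      rintro ζ ⟨i, F, hF, hζ⟩
      let P : Submodule ℂ (lineSpace p) :=
        { carrier := {η | (ζ : A) * star (η : A) ∈ J}
          add_mem' := fun {η η'} h1 h2 => by
            change (ζ : A) * star ((η : A) + η') ∈ J
            rw [star_add, mul_add]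
            exact J.add_mem h1 h2
          zero_mem' := by
            change (ζ : A) * star (0 : A) ∈ J
            rw [star_zero, mul_zero]
            exact J.zero_mem
          smul_mem' := fun c η h1 => by
            change (ζ : A) * star (c • (η : A)) ∈ J
            rw [star_smul, mul_smul_comm]
            exact J.smul_mem _ h1 }
      have hP : IsClosed (P : Set (lineSpace p)) :=
        hJ.preimage (continuous_const.mul continuous_subtype_val.star)
      refine hall P hP ?_
      rintro η ⟨j, G, hG, hη⟩
      refine hmem i j (F * star G) (fun t ht => ?_) _ fun t x => ?_
      · exact ⟨hF t (left_ne_zero_of_mul ht), hG t fun h0 => right_ne_zero_of_mul ht (by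
          rw [ContinuousMap.star_apply, h0, star_zero])⟩
      · rw [h.rep_mul_star, ← hΓ, hζ, hη, inner_smul_left, smul_smul]
        congr 1
        change _ = F t * star (G t) * _
        rw [mul_comm, ← mul_assoc]
        rfl
    refine h.eq_top_of_mul_star_mem hJ fun ζ η => ?_
    let P : Submodule ℂ (lineSpace p) :=
      J.comap ((LinearMap.mulRight ℂ (star (η : A))) ∘ₗ (lineSpace p).subtype)
    have hP : IsClosed (P : Set (lineSpace p)) :=
      hJ.preimage (continuous_subtype_val.mul continuous_const)
    exact hall P hP (fun ζ hζ => hright ζ hζ η) ζ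

end OperatorFrame

/-! ### Truncated frames and the special subalgebras -/

section FrameAlgebra

variable {A : Type u} [NonUnitalCStarAlgebra A] {ρ : I → IrrepOf A} {u : ℕ → ∀ t, (ρ t).H}
  {O : ℕ → Set I} {m : ℕ} {U : Fin (m + 1) → Set I}

/-- The field of operators `∑ F i j |u i⟩⟨u j|` is the image of `a`. -/
def RepresentedBy (u : ℕ → ∀ t, (ρ t).H) (a : A) (F : IntervalAlgebra (m + 1)) : Prop :=
  ∀ t x, (ρ t).rep a x = ∑ i : Fin (m + 1), ∑ j : Fin (m + 1), (F t i j * ⟪u j t, x⟫_ℂ) • u i t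

namespace IsOperatorFrame

section

variable (h : IsOperatorFrame ρ u O)

include h

theorem norm_eq {i : ℕ} {t : I} (ht : t ∈ O i) : ‖u i t‖ = 1 := by
  have h2 : ‖u i t‖ ^ 2 = 1 := by
    rw [← inner_self_eq_norm_sq (𝕜 := ℂ), h.inner_self i t ht]; simp
  exact (pow_eq_one_iff_of_nonneg (norm_nonneg _) two_ne_zero).1 h2

theorem inner_rep {b : A} {G : IntervalAlgebra (m + 1)} (hb : RepresentedBy u b G) {t : I}
    {j : Fin (m + 1)} (ht : t ∈ O j) (x : (ρ t).H) :
    ⟪u j t, (ρ t).rep b x⟫_ℂ = ∑ l : Fin (m + 1), G t j l * ⟪u l t, x⟫_ℂ := by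
  rw [hb, inner_sum, Finset.sum_eq_single j]
  · rw [inner_sum]
    refine Finset.sum_congr rfl fun l _ => ?_
    rw [inner_smul_right, h.inner_self j t ht, mul_one]
  · intro i _ hij
    rw [inner_sum]
    refine Finset.sum_eq_zero fun l _ => ?_
    rw [inner_smul_right, h.inner_ne j i (fun h1 => hij (Fin.ext h1.symm)), mul_zero]
  · simp

theorem inner_rep_apply {b : A} {G : IntervalAlgebra (m + 1)} (hb : RepresentedBy u b G) {t : I}
    {i j : Fin (m + 1)} (hi : t ∈ O i) (hj : t ∈ O j) : ⟪u i t, (ρ t).rep b (u j t)⟫_ℂ = G t i j := by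
  rw [h.inner_rep hb hi, Finset.sum_eq_single j]
  · rw [h.inner_self j t hj, mul_one]
  · intro l _ hl
    rw [h.inner_ne l j fun h1 => hl (Fin.ext h1), mul_zero]
  · simp

/-- The entries are recovered as ⟨uᵢ, a uⱼ⟩ where both vectors have norm one, and are zero
elsewhere. -/
theorem eq_of_representedBy (hU : ∀ i, U i ⊆ O i) {a : A} {F G : IntervalAlgebra (m + 1)}
    (hF : F ∈ blockAlgebra U) (hG : G ∈ blockAlgebra U) (haF : RepresentedBy u a F)
    (haG : RepresentedBy u a G) : F = G := by
  ext t i j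
  by_cases ht : t ∈ U i ∧ t ∈ U j
  · rw [← h.inner_rep_apply haF (hU i ht.1) (hU j ht.2),
      h.inner_rep_apply haG (hU i ht.1) (hU j ht.2)]
  · rw [not_not.1 (mt (hF t i j) ht), not_not.1 (mt (hG t i j) ht)]

theorem representedBy_mul (hU : ∀ i, U i ⊆ O i) {a b : A} {F G : IntervalAlgebra (m + 1)}
    (hF : F ∈ blockAlgebra U) (haF : RepresentedBy u a F) (hbG : RepresentedBy u b G) :
    RepresentedBy u (a * b) (F * G) := by
  intro t x
  rw [map_mul, mul_apply_eq_comp, haF]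
  refine Finset.sum_congr rfl fun i _ => ?_
  rw [← Finset.sum_smul, ← Finset.sum_smul]
  congr 1
  have h1 : ∀ j, F t i j * ⟪u j t, (ρ t).rep b x⟫_ℂ = ∑ l, F t i j * G t j l * ⟪u l t, x⟫_ℂ := by
    intro j
    by_cases h0 : F t i j = 0
    · simp [h0]
    · rw [h.inner_rep hbG (hU j (hF t i j h0).2), Finset.mul_sum]
      exact Finset.sum_congr rfl fun l _ => (mul_assoc _ _ _).symm
  rw [Finset.sum_congr rfl fun j _ => h1 j, Finset.sum_comm]
  refine Finset.sum_congr rfl fun l _ => ?_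
  rw [ContinuousMap.mul_apply, Matrix.mul_apply, Finset.sum_mul]

end

theorem _root_.RepresentedBy.add {a b : A} {F G : IntervalAlgebra (m + 1)}
    (haF : RepresentedBy u a F) (hbG : RepresentedBy u b G) : RepresentedBy u (a + b) (F + G) := by
  intro t x
  rw [map_add, add_apply, haF, hbG]
  simp only [← Finset.sum_add_distrib, ← add_smul, ← add_mul]
  rfl

theorem _root_.RepresentedBy.zero : RepresentedBy u (0 : A) (0 : IntervalAlgebra (m + 1)) := by
  intro t x
  rw [map_zero, zero_apply]
  refine (Finset.sum_eq_zero fun i _ => Finset.sum_eq_zero fun j _ => ?_).symm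
  change ((0 : ℂ) * _) • _ = _
  rw [zero_mul, zero_smul]

theorem _root_.RepresentedBy.smul (c : ℂ) {a : A} {F : IntervalAlgebra (m + 1)}
    (haF : RepresentedBy u a F) : RepresentedBy u (c • a) (c • F) := by
  intro t x
  rw [map_smul, smul_apply, haF]
  simp only [Finset.smul_sum, smul_smul, ← mul_assoc]
  rfl

theorem _root_.RepresentedBy.star {a : A} {F : IntervalAlgebra (m + 1)}
    (haF : RepresentedBy u a F) : RepresentedBy u (star a) (star F) := by
  intro t x
  refine ext_inner_left ℂ fun y => ?_
  rw [(ρ t).inner_rep_star, haF, sum_inner, inner_sum]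
  simp only [sum_inner, inner_sum, inner_smul_left, inner_smul_right, map_mul, inner_conj_symm]
  rw [Finset.sum_comm]
  refine Finset.sum_congr rfl fun i _ => Finset.sum_congr rfl fun j _ => ?_
  change _ = (starRingEnd ℂ) (F t j i) * _ * _
  rw [mul_right_comm]

/-- The elements whose matrix coefficients in the truncated frame are continuous. -/
def frameAlgebra (h : IsOperatorFrame ρ u O) (hU : ∀ i, U i ⊆ O i) :
    NonUnitalStarSubalgebra ℂ A where
  carrier := {a | ∃ F ∈ blockAlgebra U, RepresentedBy u a F}
  add_mem' := fun ⟨F, hF, ha⟩ ⟨G, hG, hb⟩ => ⟨F + G, add_mem hF hG, ha.add hb⟩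
  zero_mem' := ⟨0, zero_mem _, .zero⟩
  mul_mem' := fun ⟨F, hF, ha⟩ ⟨G, hG, hb⟩ =>
    ⟨F * G, mul_mem hF hG, h.representedBy_mul hU hF ha hb⟩
  smul_mem' c _ := fun ⟨F, hF, ha⟩ => ⟨c • F, SMulMemClass.smul_mem c hF, ha.smul c⟩
  star_mem' := fun ⟨F, hF, ha⟩ => ⟨star F, star_mem hF, ha.star⟩

variable (h : IsOperatorFrame ρ u O) (hU : ∀ i, U i ⊆ O i)

/-- The matrix coefficients of an element of `frameAlgebra`. -/
noncomputable def frameCoeff : h.frameAlgebra hU →⋆ₙₐ[ℂ] IntervalAlgebra (m + 1) where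
  toFun a := a.2.choose
  map_smul' c a := h.eq_of_representedBy hU (c • a).2.choose_spec.1
    (SMulMemClass.smul_mem c a.2.choose_spec.1) (c • a).2.choose_spec.2 (a.2.choose_spec.2.smul c)
  map_zero' := h.eq_of_representedBy hU (0 : h.frameAlgebra hU).2.choose_spec.1 (zero_mem _)
    (0 : h.frameAlgebra hU).2.choose_spec.2 .zero
  map_add' a b := h.eq_of_representedBy hU (a + b).2.choose_spec.1
    (add_mem a.2.choose_spec.1 b.2.choose_spec.1) (a + b).2.choose_spec.2
    (a.2.choose_spec.2.add b.2.choose_spec.2)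
  map_mul' a b := h.eq_of_representedBy hU (a * b).2.choose_spec.1
    (mul_mem a.2.choose_spec.1 b.2.choose_spec.1) (a * b).2.choose_spec.2
    (h.representedBy_mul hU a.2.choose_spec.1 a.2.choose_spec.2 b.2.choose_spec.2)
  map_star' a := h.eq_of_representedBy hU (star a).2.choose_spec.1
    (star_mem a.2.choose_spec.1) (star a).2.choose_spec.2 a.2.choose_spec.2.star

theorem frameCoeff_mem (a : h.frameAlgebra hU) : h.frameCoeff hU a ∈ blockAlgebra U :=
  a.2.choose_spec.1

theorem representedBy_frameCoeff (a : h.frameAlgebra hU) :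
    RepresentedBy u (a : A) (h.frameCoeff hU a) := a.2.choose_spec.2

theorem isBlockModel_frameCoeff (hUo : ∀ i, IsOpen (U i)) (hU0 : U 0 = Set.univ) :
    IsBlockModel (h.frameCoeff hU) U where
  injective a b hab := by
    refine Subtype.ext (h.field.ext fun t => ContinuousLinearMap.ext fun x => ?_)
    rw [h.representedBy_frameCoeff hU a, h.representedBy_frameCoeff hU b, hab]
  map_mem := h.frameCoeff_mem hU
  exists_eq F hF := by
    choose b hb using fun i j : Fin (m + 1) => h.exists_rep_eq i j
      ⟨fun t => F t i j, F.continuous.matrix_elem i j⟩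
      fun t ht => ⟨hU i (hF t i j ht).1, hU j (hF t i j ht).2⟩
    have hrep : RepresentedBy u (∑ i, ∑ j, b i j) F := by
      intro t x
      simp only [map_sum, _root_.sum_apply, hb]
      rfl
    let a : h.frameAlgebra hU := ⟨_, F, hF, hrep⟩
    exact ⟨a, h.eq_of_representedBy hU (h.frameCoeff_mem hU a) hF
      (h.representedBy_frameCoeff hU a) hrep⟩
  isOpen := hUo
  eq_univ := hU0

/-- Passing to a coefficient does not increase the norm, so the coefficients of a convergent
sequence converge uniformly and their limits are continuous. -/
theorem isClosed_frameAlgebra : IsClosed (h.frameAlgebra hU : Set A) := by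
  classical
  refine isClosed_of_closure_subset fun a ha => ?_
  obtain ⟨b, hb, hlim⟩ := mem_closure_iff_seq_limit.1 ha
  choose G hG hbG using hb
  have hnorm : Filter.Tendsto (fun n => ‖b n - a‖) Filter.atTop (𝓝 0) :=
    tendsto_iff_norm_sub_tendsto_zero.1 hlim
  let F : I → Matrix (Fin (m + 1)) (Fin (m + 1)) ℂ := fun t => Matrix.of fun i j =>
    if t ∈ U i ∧ t ∈ U j then ⟪u i t, (ρ t).rep a (u j t)⟫_ℂ else 0
  have hGF : ∀ n t i j, ‖G n t i j - F t i j‖ ≤ ‖b n - a‖ := by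
    intro n t i j
    by_cases ht : t ∈ U i ∧ t ∈ U j
    · have h1 : F t i j = ⟪u i t, (ρ t).rep a (u j t)⟫_ℂ := if_pos ht
      rw [h1, ← h.inner_rep_apply (hbG n) (hU i ht.1) (hU j ht.2), ← inner_sub_right,
        ← _root_.sub_apply, ← map_sub]
      refine (norm_inner_le_norm _ _).trans ?_
      rw [h.norm_eq (hU i ht.1), one_mul]
      refine (((ρ t).rep (b n - a)).le_opNorm _).trans ?_
      rw [h.norm_eq (hU j ht.2), mul_one]
      exact IsSpectralField.norm_rep_le t _
    · have h1 : F t i j = 0 := if_neg ht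
      rw [h1, not_not.1 (mt (hG n t i j) ht), sub_zero, norm_zero]
      exact norm_nonneg _
  have hF : Continuous F := by
    refine continuous_matrix fun i j => ?_
    refine continuous_of_uniform_approx_of_continuous fun s hs => ?_
    obtain ⟨ε, hε, hεs⟩ := Metric.mem_uniformity_dist.1 hs
    obtain ⟨n, hn⟩ := (hnorm.eventually (gt_mem_nhds hε)).exists
    refine ⟨fun t => G n t i j, (G n).continuous.matrix_elem i j, fun t => ?_⟩
    refine hεs ?_
    rw [dist_comm, dist_eq_norm]
    exact (hGF n t i j).trans_lt hn
  refine ⟨⟨F, hF⟩, fun t i j hne => ?_, fun t x => ?_⟩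
  · by_contra ht
    exact hne (if_neg ht)
  · have h1 : Filter.Tendsto (fun n => (ρ t).rep (b n) x) Filter.atTop (𝓝 ((ρ t).rep a x)) := by
      rw [tendsto_iff_norm_sub_tendsto_zero]
      refine squeeze_zero (fun _ => norm_nonneg _) (fun n => ?_) (by simpa using hnorm.mul_const ‖x‖)
      rw [← _root_.sub_apply, ← map_sub]
      refine (((ρ t).rep (b n - a)).le_opNorm _).trans ?_
      gcongr
      exact IsSpectralField.norm_rep_le t _
    have h2 : Filter.Tendsto (fun n => (ρ t).rep (b n) x) Filter.atTop
        (𝓝 (∑ i : Fin (m + 1), ∑ j : Fin (m + 1), (F t i j * ⟪u j t, x⟫_ℂ) • u i t)) := by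
      have h3 : ∀ n, (ρ t).rep (b n) x =
          ∑ i : Fin (m + 1), ∑ j : Fin (m + 1), (G n t i j * ⟪u j t, x⟫_ℂ) • u i t :=
        fun n => hbG n t x
      simp only [h3]
      refine tendsto_finsetSum _ fun i _ => tendsto_finsetSum _ fun j _ => ?_
      refine Filter.Tendsto.smul_const (Filter.Tendsto.mul_const _ ?_) _
      rw [tendsto_iff_norm_sub_tendsto_zero]
      exact squeeze_zero (fun _ => norm_nonneg _) (fun n => hGF n t i j) hnorm
    exact tendsto_nhds_unique h1 h2

/-- A coefficient matrix is padded by a zero row and a zero column for the additional index. -/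
theorem frameAlgebra_le_succ {U' : Fin (m + 2) → Set I} (hU' : ∀ i, U' i ⊆ O i)
    (hUU' : ∀ i, U i ⊆ U' i.castSucc) : h.frameAlgebra hU ≤ h.frameAlgebra hU' := by
  rintro a ⟨F, hF, ha⟩
  let F' : I → Matrix (Fin (m + 2)) (Fin (m + 2)) ℂ := fun t => Matrix.of fun i j =>
    Fin.lastCases 0 (fun i => Fin.lastCases 0 (fun j => F t i j) j) i
  have hl : ∀ t j, F' t (Fin.last _) j = 0 := fun t j => by simp [F']
  have hr : ∀ t i, F' t i (Fin.last _) = 0 := fun t i => by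
    induction i using Fin.lastCases <;> simp [F']
  have hc : ∀ t i j, F' t (Fin.castSucc i) (Fin.castSucc j) = F t i j := fun t i j => by simp [F']
  have hF' : Continuous F' := by
    refine continuous_matrix fun i j => ?_
    induction i using Fin.lastCases with
    | last => simp only [hl]; exact continuous_const
    | cast i =>
      induction j using Fin.lastCases with
      | last => simp only [hr]; exact continuous_const
      | cast j => simp only [hc]; exact F.continuous.matrix_elem i j
  refine ⟨⟨F', hF'⟩, fun t i j hne => ?_, fun t x => ?_⟩
  · rw [ContinuousMap.coe_mk] at hne
    induction i using Fin.lastCases with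
    | last => exact absurd (hl t j) hne
    | cast i =>
      induction j using Fin.lastCases with
      | last => exact absurd (hr t _) hne
      | cast j =>
        rw [hc] at hne
        exact ⟨hUU' i (hF t i j hne).1, hUU' j (hF t i j hne).2⟩
  · rw [ha, Fin.sum_univ_castSucc (n := m + 1)]
    simp only [ContinuousMap.coe_mk, Fin.sum_univ_castSucc (n := m + 1), hl, hr, hc, zero_mul,
      zero_smul, Finset.sum_const_zero, add_zero, Fin.val_castSucc]

include h in
-- At stage k only the indices up to k are kept, each on the k-th finite union of intervals that
-- exhausts its domain. A rank-one generator with compactly supported coefficient lies in all late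
-- stages, and such generators approximate the general ones uniformly.
theorem exists_approximation :
    ∃ B : ℕ → NonUnitalStarSubalgebra ℂ A,
      (∀ k, IsClosed (B k : Set A) ∧ IsSpecialContinuousTrace (B k)) ∧ Monotone B ∧
      closure (⋃ k, (B k : Set A)) = Set.univ := by
  choose W hW using fun i => exists_isExhaustion (h.isOpen i)
  -- Index 0 keeps the full interval at every stage, which makes the corner full and the spectrum
  -- equal to [0,1].
  let V : ℕ → ℕ → Set I := fun k i => if i = 0 then Set.univ else W i k
  have hVo : ∀ k i, IsOpen (V k i) := fun k i => by
    by_cases hi : i = 0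
    · simp [V, hi]
    · simp only [V, hi, if_false]; exact (hW i).isOpen k
  have hWV : ∀ k i, W i k ⊆ V k i := fun k i => by
    by_cases hi : i = 0
    · simp [V, hi]
    · simp [V, hi]
  have hVO : ∀ k i, V k i ⊆ O i := fun k i => by
    by_cases hi : i = 0
    · rw [hi, h.eq_univ]; exact Set.subset_univ _
    · simp only [V, hi, if_false]; exact (hW i).subset k
  have hVm : ∀ k i, V k i ⊆ V (k + 1) i := fun k i => by
    by_cases hi : i = 0
    · simp [V, hi]
    · simp only [V, hi, if_false]; exact (hW i).mono (Nat.le_succ k)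
  have hVs : ∀ k i, IsFiniteStep fun t => t ∈ V k i := fun k i => by
    by_cases hi : i = 0
    · have : V k i = Set.univ := if_pos hi
      rw [this]
      exact IsFiniteStep.of_ordConnected Set.ordConnected_univ
    · simp only [V, hi, if_false]; exact (hW i).isFiniteStep k
  let B : ℕ → NonUnitalStarSubalgebra ℂ A := fun k =>
    h.frameAlgebra (U := fun i : Fin (k + 1) => V k i) fun i => hVO k i
  have hB : Monotone B := monotone_nat_of_le_succ fun k =>
    h.frameAlgebra_le_succ _ _ fun i => hVm k i
  refine ⟨B, fun k => ⟨h.isClosed_frameAlgebra _, ?_⟩, hB, ?_⟩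
  · exact (h.isBlockModel_frameCoeff _ (fun i => hVo k i) rfl).isSpecialContinuousTrace
      (IsFiniteStep.pi fun i => hVs k i)
  · let J : Submodule ℂ A := (⨆ k, (B k).toSubmodule).topologicalClosure
    have hcoe : ((⨆ k, (B k).toSubmodule : Submodule ℂ A) : Set A) = ⋃ k, (B k : Set A) :=
      Submodule.coe_iSup_of_directed _ (Monotone.directed_le fun k l hkl => hB hkl)
    have hJ : J = ⊤ := by
      refine h.eq_top J (Submodule.isClosed_topologicalClosure _) fun i j F hF a ha => ?_
      refine Metric.mem_closure_iff.2 fun ε hε => ?_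
      obtain ⟨G, K, hK, hKF, hGK, hGF⟩ := exists_compact_cutoff F (half_pos hε)
      obtain ⟨N, hN⟩ := (hW i).exists_subset hK fun t ht => (hF t (hKF t ht)).1
      obtain ⟨N', hN'⟩ := (hW j).exists_subset hK fun t ht => (hF t (hKF t ht)).2
      have hGK' : ∀ t, G t ≠ 0 → t ∈ K := fun t => not_imp_comm.1 (hGK t)
      obtain ⟨b, hb⟩ := h.exists_rep_eq i j G fun t ht => hF t (hKF t (hGK' t ht))
      obtain ⟨k, hkN, hkN', hki, hkj⟩ : ∃ k, N ≤ k ∧ N' ≤ k ∧ i ≤ k ∧ j ≤ k :=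
        ⟨N + N' + i + j, by omega, by omega, by omega, by omega⟩
      have hbk : b ∈ B k := by
        refine ⟨coordFun G ⟨i, Nat.lt_succ_of_le hki⟩ ⟨j, Nat.lt_succ_of_le hkj⟩,
          coordFun_mem fun t ht => ?_, fun t x => ?_⟩
        · exact ⟨hWV k i (hN k hkN (hGK' t ht)), hWV k j (hN' k hkN' (hGK' t ht))⟩
        · rw [hb]
          simp only [coordFun_apply, Matrix.single_apply, ite_and, ite_mul, zero_mul, ite_smul,
            zero_smul, Finset.sum_ite_eq, Finset.mem_univ, if_true, Finset.sum_ite_irrel,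
            Finset.sum_const_zero]
      refine ⟨b, ?_, lt_of_le_of_lt ?_ (half_lt_self hε)⟩
      · exact Submodule.mem_iSup_of_mem k hbk
      · rw [dist_comm, dist_eq_norm]
        refine h.field.norm_le (half_pos hε).le fun t => ?_
        refine ContinuousLinearMap.opNorm_le_bound _ (half_pos hε).le fun x => ?_
        rw [map_sub, _root_.sub_apply, ha, hb, ← sub_smul, ← sub_mul]
        by_cases h0 : F t = 0
        · have h1 : G t = 0 := hGK t fun ht => hKF t ht h0
          rw [h0, h1, sub_zero, zero_mul, zero_smul, norm_zero]
          positivity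
        · rw [norm_smul, norm_mul, h.norm_eq (hF t h0).1, mul_one]
          have h1 := norm_inner_le_norm (𝕜 := ℂ) (u j t) x
          rw [h.norm_eq (hF t h0).2, one_mul] at h1
          exact mul_le_mul (hGF t) h1 (norm_nonneg _) (half_pos hε).le
    rw [← hcoe]
    exact congrArg (fun P : Submodule ℂ A => (P : Set A)) hJ

end IsOperatorFrame

end FrameAlgebra

/-! ### The two approximation statements combined -/

theorem theorem8p1p9 :
    (∀ (n : ℕ) (A : NonUnitalStarSubalgebra ℂ (IntervalAlgebra n)), IsHereditary A →
      (∃ B : ℕ → NonUnitalStarSubalgebra ℂ (IntervalAlgebra n),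
        (∀ k, IsStepHereditary (B k)) ∧ Monotone B ∧
        (A : Set (IntervalAlgebra n)) = closure (⋃ k, (B k : Set (IntervalAlgebra n)))) ∧
      (∃ (A' : NonUnitalStarSubalgebra ℂ (IntervalAlgebra n))
          (B : ℕ → NonUnitalStarSubalgebra ℂ (IntervalAlgebra n)),
        IsHereditary A' ∧ Nonempty (A ≃⋆ₐ[ℂ] A') ∧
        (∀ k, IsStrictlyStepHereditary (B k)) ∧ Monotone B ∧
        (A' : Set (IntervalAlgebra n)) = closure (⋃ k, (B k : Set (IntervalAlgebra n))))) ∧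
    (∀ (A : Type u) [NonUnitalCStarAlgebra A] [TopologicalSpace.SeparableSpace A],
      IsContinuousTrace A → Nonempty (CStarSpectrum A ≃ₜ I) →
      ∃ B : ℕ → NonUnitalStarSubalgebra ℂ A,
        (∀ k, IsClosed (B k : Set A) ∧ IsSpecialContinuousTrace (B k)) ∧ Monotone B ∧
        closure (⋃ k, (B k : Set A)) = Set.univ) := by
  refine ⟨fun n A hA => ?_, fun A _ _ hA ⟨h⟩ => ?_⟩
  · obtain ⟨U, W, h⟩ := exists_isMatrixFrame hA
    exact exists_approximation_of_isMatrixFrame hA h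
  · obtain ⟨ρ, hρ⟩ := exists_isSpectralField hA h
    obtain ⟨p, v, hv⟩ := hρ.exists_isLineField
    obtain ⟨u, O, hu⟩ := hv.exists_isOperatorFrame
    exact hu.exists_approximation
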